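/- Fix an integer $L\ge 2$ and divide $[0,1]^2$ into the $L\times L$ grid $\mathcal D_1$ of closed squares of side $1/L$. A grid model $\mathfrak X$ is a random subset of $\mathcal D_1$ (given by its law). It generates random sets as follows: $\mathcal S_0=\{[0,1]^2\}$, and, given $\mathcal S_n$, a realization of $\mathfrak X$, independent for different squares and of the past, is used in each square $R\in\mathcal S_n$, rescaled to $R$, to choose some of its $L^2$ subsquares of side $L^{-n-1}$; $\mathcal S_{n+1}$ is the collection of all chosen subsquares. Let $S_n=\bigcup\mathcal S_n$, $S=\bigcap_n S_n$, and $Z=\lim_{n\to\infty}L^{-n}|\mathcal S_n|$. The model is uniform if $\mathbb P[Q\in\mathcal S_1]=1/L$ for every $Q\in\mathcal D_1$; it is surviving if $|\mathcal S_1|\ge 1$ almost surely; it is vertically (horizontally) degenerate if almost surely exactly one square is selected in each column (row), and non-degenerate if it is neither vertically nor horizontally degenerate. For $\theta\in[0,\pi]$ and $t\in\mathbb R$ let $\operatorname{proj}_\theta(x,y)=-x\sin\theta+y\cos\theta$ and let $\ell(\theta,t)=\operatorname{proj}_\theta^{-1}(t)$ be the line with direction $(\cos\theta,\sin\theta)$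 through $t(-\sin\theta,\cos\theta)$. With $|\cdot|$ denoting length, set $$\operatorname{Fav}(A)=\int_0^\pi|\operatorname{proj}_\theta A|\,d\theta,\qquad V(\theta)=\int_{\mathbb R}\operatorname{Var}\bigl(L\,|\ell(\theta,t)\cap S_1|\bigr)\,dt,$$ and let $S(r)$ be the open $r$-neighbourhood of $S$. **Corollary 5.2.** For a non-degenerate uniform surviving grid model, $V(\theta)>0$ for all $\theta$, the function $2/V$ is integrable on $[0,\pi]$, and almost surely the limit $Z$ exists, $0<Z<\infty$, $\operatorname{Fav}(S(r))<\infty$ for all $r>0$, and $$\lim_{r\downarrow 0}\log_L(1/r)\,\operatorname{Fav}(S(r))=Z\int_0^\pi\frac{2}{V(\theta)}\,d\theta .$$ In particular $\operatorname{Fav}(S(r))$ decays almost surely exactly at the rate $1/\log(1/r)$, with an explicit limit. -/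

import Mathlib

open MeasureTheory ProbabilityTheory Filter Topology Set

namespace GridFractal

noncomputable section

/-- The Euclidean plane. -/
abbrev Plane : Type := EuclideanSpace ℝ (Fin 2)

/-! ### Projections, lines, Favard length -/

/-- Coordinate of the orthogonal projection along the direction `(cos θ, sin θ)`: the number `t` such
that `p` lies on the line through `t (-sin θ, cos θ)` with direction `(cos θ, sin θ)`. -/
def proj (θ : ℝ) (p : Plane) : ℝ := -Real.sin θ * p 0 + Real.cos θ * p 1

/-- The point `t (-sin θ, cos θ) + s (cos θ, sin θ)`; for fixed `θ` and `t`, the map `s ↦ linePoint θ t s`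
is the unit speed parametrization of the line `ℓ(θ, t) = {p | proj θ p = t}`. -/
def linePoint (θ t s : ℝ) : Plane :=
  !₂[t * (-Real.sin θ) + s * Real.cos θ, t * Real.cos θ + s * Real.sin θ]

/-- The length `|ℓ(θ, t) ∩ A|` of the part of the line `ℓ(θ, t)` in `A`. -/
def sectionLength (θ t : ℝ) (A : Set Plane) : ℝ :=
  volume.real {s : ℝ | linePoint θ t s ∈ A}

/-- Favard length: the integral over `θ ∈ [0, π]` of the length of the projection of `A`. -/
def favardLength (A : Set Plane) : ENNReal :=
  ∫⁻ θ in Icc (0 : ℝ) Real.pi, volume (proj θ '' A)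

/-! ### Addresses and squares of the `L`-adic grids -/

/-- Positions in the `L × L` grid, numbered from `0`; `(i, j)` is in column `i` and row `j`. -/
abbrev Digit (L : ℕ) : Type := Fin L × Fin L

/-- A choice of some of the squares of the `L × L` grid. (A finite type, in which every set is
measurable.) -/
abbrev Selection (L : ℕ) : Type := Finset (Digit L)

/-- Lower left corner of the square with address `(i₁, j₁), …, (iₙ, jₙ)`, which is the point
`∑ m, (iₘ, jₘ) L⁻ᵐ` (the coarsest digit comes first). -/
def corner {L : ℕ} : List (Digit L) → ℝ × ℝ
  | [] => (0, 0)
  | q :: w => (((q.1 : ℕ) + (corner w).1) / L, ((q.2 : ℕ) + (corner w).2) / L)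

/-- The closed square with address `w`, of side `L⁻ⁿ` where `n` is the length of `w`. The squares with
addresses of length `n` are the squares of the `Lⁿ × Lⁿ` grid in `[0, 1]²`. -/
def square {L : ℕ} (w : List (Digit L)) : Set Plane :=
  {p | p 0 ∈ Icc (corner w).1 ((corner w).1 + ((L : ℝ) ^ w.length)⁻¹) ∧
       p 1 ∈ Icc (corner w).2 ((corner w).2 + ((L : ℝ) ^ w.length)⁻¹)}

/-! ### Grid models

A grid model is the law `𝔛` of a random selection. -/

/-- Every square of the `L × L` grid is selected with probability `1 / L`. -/
def IsUniform {L : ℕ} (𝔛 : Measure (Selection L)) : Prop :=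
  ∀ q : Digit L, 𝔛 {A | q ∈ A} = (L : ENNReal)⁻¹

/-- Almost surely exactly one square is selected in each column. -/
def IsVerticallyDegenerate {L : ℕ} (𝔛 : Measure (Selection L)) : Prop :=
  ∀ᵐ A ∂𝔛, ∀ i : Fin L, ∃! j : Fin L, (i, j) ∈ A

/-- Almost surely exactly one square is selected in each row. -/
def IsHorizontallyDegenerate {L : ℕ} (𝔛 : Measure (Selection L)) : Prop :=
  ∀ᵐ A ∂𝔛, ∀ j : Fin L, ∃! i : Fin L, (i, j) ∈ A

/-- Neither vertically nor horizontally degenerate. -/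
def IsNondegenerate {L : ℕ} (𝔛 : Measure (Selection L)) : Prop :=
  ¬ IsVerticallyDegenerate 𝔛 ∧ ¬ IsHorizontallyDegenerate 𝔛

/-- Almost surely at least one square is selected. -/
def IsSurviving {L : ℕ} (𝔛 : Measure (Selection L)) : Prop :=
  ∀ᵐ A ∂𝔛, 1 ≤ A.card

/-- `V(θ) = ∫ Var (L |ℓ(θ, t) ∩ S₁|) dt`, where `S₁` is the union of the selected squares. -/
def V {L : ℕ} (𝔛 : Measure (Selection L)) (θ : ℝ) : ℝ :=
  ∫ t : ℝ, variance
    (fun A : Selection L => (L : ℝ) * sectionLength θ t (⋃ q ∈ A, square [q])) 𝔛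

/-! ### The random fractal

`x w` is the selection used inside the square with address `w`. -/

/-- The family `𝒮ₙ` of the surviving squares of level `n`, given by their addresses. -/
def level {L : ℕ} (x : List (Digit L) → Selection L) : ℕ → Finset (List (Digit L))
  | 0 => {[]}
  | n + 1 => (level x n).biUnion fun w => (x w).image fun q => w ++ [q]

/-- The union `Sₙ` of the surviving squares of level `n`. -/
def approx {L : ℕ} (x : List (Digit L) → Selection L) (n : ℕ) : Set Plane :=
  ⋃ w ∈ level x n, square w

/-- The limit set `S = ⋂ Sₙ`. -/
def limitSet {L : ℕ} (x : List (Digit L) → Selection L) : Set Plane :=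
  ⋂ n : ℕ, approx x n

/-- `Zₙ = L⁻ⁿ |𝒮ₙ|`. -/
def Zseq {L : ℕ} (x : List (Digit L) → Selection L) (n : ℕ) : ℝ :=
  ((L : ℝ) ^ n)⁻¹ * ((level x n).card : ℝ)

/-- `Z = lim Zₙ` (meaningful when the limit exists). -/
def Z {L : ℕ} (x : List (Digit L) → Selection L) : ℝ :=
  limUnder atTop (Zseq x)

end

end GridFractal

/-! Fix a direction θ and let p_n(t) be the probability that the line at height t meets S_n
(`hitProb`). Conditioning on the first selection gives p_{n+1} = T p_n - E_n. Here T (`transfer`)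
gives the expected number of squares of the first level in which the line survives, and E_n is the
mean of (N - 1)⁺ for that random number N. T preserves integrals and fixes h, the chord length of
the unit square, which has integral 1. To second order E_n is half of a sum over pairs of selected
squares (`pairing`), and the integral of `pairing` at h is exactly V(θ). If p_n were close to a_n h
with a_n = ∫ p_n, then a_{n+1} ≈ a_n - (V/2) a_n², hence n a_n → 2/V. This is Kolmogorov's estimate
for critical branching processes, with the position of the line in its square as the type.

Lower bound (`eventually_lt_mul_meanLength`): functions H_n are built with h² ≤ p_n H_n, whose
integral grows by V/2 + O(a_n) in each generation. Cauchy-Schwarz gives 1 = (∫ h)² ≤ a_n ∫ H_n.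

Upper bound (`eventually_mul_meanLength_lt`): the shape of p_n is controlled through the energy D_n
= ∫ p_n² / b_n, where b_n = h + ε Tⁿ1. It decreases by Jensen's inequality. The Jensen gap bounds
the variation of p_n / b_n between the squares met by one line (`pairing_energy`), so the pair sum
of p_n is an energy tested against a fixed density, up to telescoping errors. The dual of T averages
that density to the constant V (`exists_sharp_mixing`). The part of p_n that is not small compared
with b_n has negligible energy, so the Bonferroni bound is sharp. The result is a decrease of a_n by
about (V/2) D_n ≥ (V/2) a_n² per generation, up to factors close to 1.

The sharp mixing needs h continuous, so it omits the directions parallel to the axes, a null set. A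
weaker mixing, locally uniform in θ, and compactness of [0, π] give n a_n ≤ C and n² (a_n - a_{n+1})
≤ C uniformly (`exists_uniform_bound`); dominated convergence then handles the mean Favard length.
That V > 0 is `V_pos`, the only place where non-degeneracy enters directly.

For the random Favard length, S_{n+k} consists of |𝒮_k| independent small copies of S_n, so by
subadditivity and a second moment bound it is close in mean to (mean Favard length at level n) times
Z_k. With n = k³ the errors are summable, and monotonicity fills the gaps between the levels k³ + k
(`ae_tendsto_mul_favard`). Finally S(r) is compared with levels n close to log_L(1/r)
(`tendsto_logb_mul_favardLength`). -/

open MeasureTheory ProbabilityTheory Filter Topology Set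

namespace GridFractal

noncomputable section

set_option linter.unusedSectionVars false

/-! ### Inequalities of Bonferroni type -/

section Bonferroni

variable {ι : Type*} [DecidableEq ι]

/-- If the elements `q` of `A` are kept independently with probabilities `x q`, this is the expectation
of `(N - 1)⁺`, where `N` is the number of elements kept. -/
def excess (A : Finset ι) (x : ι → ℝ) : ℝ := ∑ q ∈ A, x q - 1 + ∏ q ∈ A, (1 - x q)

/-- The sum of `x q * y q'` over the pairs of different elements of `A`. -/
def pairSum (A : Finset ι) (x y : ι → ℝ) : ℝ :=
  ∑ q ∈ A, ∑ q' ∈ A, if q = q' then 0 else x q * y q'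

lemma pairSum_eq (A : Finset ι) (x y : ι → ℝ) :
    pairSum A x y = (∑ q ∈ A, x q) * (∑ q ∈ A, y q) - ∑ q ∈ A, x q * y q := by
  unfold pairSum
  rw [Finset.sum_mul, ← Finset.sum_sub_distrib]
  refine Finset.sum_congr rfl fun q hq => ?_
  rw [Finset.mul_sum, ← Finset.sum_erase_add _ _ hq, ← Finset.sum_erase_add A (fun i => x q * y i) hq]
  simp only [if_true, add_zero, add_sub_cancel_right]
  refine Finset.sum_congr rfl fun q' hq' => ?_
  rw [if_neg (Finset.ne_of_mem_erase hq').symm]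

lemma pairSum_insert {A : Finset ι} {a : ι} (ha : a ∉ A) (x : ι → ℝ) :
    pairSum (insert a A) x x = pairSum A x x + 2 * (x a * ∑ q ∈ A, x q) := by
  simp only [pairSum_eq, Finset.sum_insert ha]
  ring

/-- A new element raises (N - 1)⁺ exactly when it is kept and something else is kept as well. The
properties of `excess` below are inductions on this identity. -/
lemma excess_insert {A : Finset ι} {a : ι} (ha : a ∉ A) (x : ι → ℝ) :
    excess (insert a A) x = excess A x + x a * (1 - ∏ q ∈ A, (1 - x q)) := by
  simp only [excess, Finset.sum_insert ha, Finset.prod_insert ha]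
  ring

@[simp] lemma excess_empty (x : ι → ℝ) : excess (∅ : Finset ι) x = 0 := by simp [excess]

@[simp] lemma pairSum_empty (x y : ι → ℝ) : pairSum (∅ : Finset ι) x y = 0 := by simp [pairSum]

lemma prod_one_sub_nonneg {A : Finset ι} {x : ι → ℝ} (h1 : ∀ q, x q ≤ 1) :
    0 ≤ ∏ q ∈ A, (1 - x q) :=
  Finset.prod_nonneg fun q _ => sub_nonneg.2 (h1 q)

lemma prod_one_sub_le_one {A : Finset ι} {x : ι → ℝ} (h0 : ∀ q, 0 ≤ x q) (h1 : ∀ q, x q ≤ 1) :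
    ∏ q ∈ A, (1 - x q) ≤ 1 :=
  Finset.prod_le_one (fun q _ => sub_nonneg.2 (h1 q)) fun q _ => by linarith [h0 q]

lemma excess_nonneg (A : Finset ι) {x : ι → ℝ} (h0 : ∀ q, 0 ≤ x q) (h1 : ∀ q, x q ≤ 1) :
    0 ≤ excess A x := by
  induction A using Finset.induction_on with
  | empty => simp
  | insert a A ha ih =>
    rw [excess_insert ha]
    have := prod_one_sub_le_one (A := A) h0 h1
    have := mul_nonneg (h0 a) (sub_nonneg.2 this)
    linarith

lemma excess_mono (A : Finset ι) {x y : ι → ℝ} (h0 : ∀ q, 0 ≤ x q) (hxy : ∀ q, x q ≤ y q)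
    (h1 : ∀ q, y q ≤ 1) : excess A x ≤ excess A y := by
  induction A using Finset.induction_on with
  | empty => simp
  | insert a A ha ih =>
    rw [excess_insert ha, excess_insert ha]
    have h2 : ∏ q ∈ A, (1 - y q) ≤ ∏ q ∈ A, (1 - x q) :=
      Finset.prod_le_prod (fun q _ => sub_nonneg.2 (h1 q)) fun q _ => by linarith [hxy q]
    have h3 := prod_one_sub_le_one (A := A) h0 (fun q => (hxy q).trans (h1 q))
    have h4 : x a * (1 - ∏ q ∈ A, (1 - x q)) ≤ y a * (1 - ∏ q ∈ A, (1 - y q)) :=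
      mul_le_mul (hxy a) (by linarith) (by linarith) ((h0 a).trans (hxy a))
    linarith

lemma excess_mono_set {A A' : Finset ι} (h : A ⊆ A') {x : ι → ℝ} (h0 : ∀ q, 0 ≤ x q)
    (h1 : ∀ q, x q ≤ 1) : excess A x ≤ excess A' x := by
  induction A' using Finset.induction_on generalizing A with
  | empty => rw [Finset.subset_empty.1 h]
  | insert a A' ha ih =>
    rw [excess_insert ha]
    have h3 := prod_one_sub_le_one (A := A') h0 h1
    have h4 : 0 ≤ x a * (1 - ∏ q ∈ A', (1 - x q)) := mul_nonneg (h0 a) (by linarith)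
    by_cases haA : a ∈ A
    · have h5 := ih (A := A.erase a) (by rwa [← Finset.subset_insert_iff])
      rw [← Finset.insert_erase haA, excess_insert (Finset.notMem_erase a A)]
      have h6 : ∏ q ∈ A', (1 - x q) ≤ ∏ q ∈ A.erase a, (1 - x q) := by
        refine Finset.prod_le_prod_of_subset_of_le_one (by rwa [← Finset.subset_insert_iff])
          (fun q _ => sub_nonneg.2 (h1 q)) fun q _ _ => by linarith [h0 q]
      have := mul_le_mul_of_nonneg_left h6 (h0 a)
      nlinarith
    · have h5 := ih (A := A) ((Finset.subset_insert_iff_of_notMem haA).1 h)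
      linarith

/-- The excess of a two-element set is the product of the weights, and the excess grows with the
set. -/
lemma mul_le_excess {A : Finset ι} {x : ι → ℝ} (h0 : ∀ q, 0 ≤ x q) (h1 : ∀ q, x q ≤ 1) {q q' : ι}
    (hq : q ∈ A) (hq' : q' ∈ A) (hne : q ≠ q') : x q * x q' ≤ excess A x := by
  have h : excess {q, q'} x = x q * x q' := by
    rw [excess, Finset.sum_pair hne, Finset.prod_pair hne]; ring
  rw [← h]
  exact excess_mono_set (by intro a; simp; rintro (rfl | rfl) <;> assumption) h0 h1

/-- Bonferroni: (N - 1)⁺ is at most the number of unordered pairs of kept elements, whose mean is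
half of `pairSum`. -/
lemma excess_le_pairSum (A : Finset ι) {x : ι → ℝ} (h0 : ∀ q, 0 ≤ x q) (h1 : ∀ q, x q ≤ 1) :
    excess A x ≤ pairSum A x x / 2 := by
  induction A using Finset.induction_on with
  | empty => simp
  | insert a A ha ih =>
    rw [excess_insert ha, pairSum_insert ha]
    have h3 := excess_nonneg A h0 h1
    have h4 : 1 - ∏ q ∈ A, (1 - x q) ≤ ∑ q ∈ A, x q := by unfold excess at h3; linarith
    have := mul_le_mul_of_nonneg_left h4 (h0 a)
    linarith

/-- The upper bound `excess_le_pairSum` shows that something is kept with probability at least Σ -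
Σ²/2, where Σ is the total weight. Fed into `excess_insert`, this makes the upper bound sharp when Σ
is small. -/
lemma pairSum_le_excess (A : Finset ι) {x : ι → ℝ} (h0 : ∀ q, 0 ≤ x q) (h1 : ∀ q, x q ≤ 1) {s : ℝ}
    (hs : ∑ q ∈ A, x q ≤ s) : (1 - s) * (pairSum A x x / 2) ≤ excess A x := by
  induction A using Finset.induction_on with
  | empty => simp
  | insert a A ha ih =>
    rw [excess_insert ha, pairSum_insert ha]
    rw [Finset.sum_insert ha] at hs
    have ih := ih (by linarith [h0 a])
    have h3 := excess_le_pairSum A h0 h1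
    have h5 : 0 ≤ ∑ q ∈ A, x q := Finset.sum_nonneg fun q _ => h0 q
    have h6 : pairSum A x x ≤ (∑ q ∈ A, x q) * (∑ q ∈ A, x q) := by
      rw [pairSum_eq]
      have : 0 ≤ ∑ q ∈ A, x q * x q := Finset.sum_nonneg fun q _ => mul_self_nonneg _
      linarith
    have h7 : (1 - s) * ∑ q ∈ A, x q ≤ 1 - ∏ q ∈ A, (1 - x q) := by
      unfold excess at h3
      nlinarith [h0 a]
    have := mul_le_mul_of_nonneg_left h7 (h0 a)
    nlinarith

/-- A crude converse that needs no small weights: each pair product is below the whole excess. It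
yields the a priori loss in `survive_le_transfer_sub`. -/
lemma pairSum_le_card_mul_excess (A : Finset ι) {x : ι → ℝ} (h0 : ∀ q, 0 ≤ x q)
    (h1 : ∀ q, x q ≤ 1) : pairSum A x x ≤ (A.card : ℝ) ^ 2 * excess A x := by
  have h : pairSum A x x ≤ ∑ q ∈ A, ∑ q' ∈ A, excess A x := by
    refine Finset.sum_le_sum fun q hq => Finset.sum_le_sum fun q' hq' => ?_
    split_ifs with hne
    · exact excess_nonneg A h0 h1
    · exact mul_le_excess h0 h1 hq hq' hne
  refine h.trans (le_of_eq ?_)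
  simp [sq, mul_assoc]

/-- The identity behind the variance bound for weighted sums. -/
lemma sum_sum_mul_mul_sub_sq (s : Finset ι) (h u : ι → ℝ) :
    ∑ q ∈ s, ∑ q' ∈ s, h q * h q' * (u q - u q') ^ 2 =
      2 * ((∑ q ∈ s, h q * u q ^ 2) * (∑ q ∈ s, h q) - (∑ q ∈ s, h q * u q) ^ 2) := by
  have : ∀ q q', h q * h q' * (u q - u q') ^ 2 =
      (h q * u q ^ 2) * h q' + h q * (h q' * u q' ^ 2) - 2 * ((h q * u q) * (h q' * u q')) := by
    intro q q'; ring
  simp only [this, Finset.sum_add_distrib, Finset.sum_sub_distrib, ← Finset.mul_sum,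
    ← Finset.sum_mul]
  ring

end Bonferroni

/-! ### The one step operators -/

section Operators

variable {L : ℕ}

/-- The probability that `q ≠ q'` are both selected, where `m A` is the probability of `A`. -/
def pairProb (m : Selection L → ℝ) (q q' : Digit L) : ℝ :=
  if q = q' then 0 else ∑ A, if q ∈ A ∧ q' ∈ A then m A else 0

/-- The mean operator: the relative positions of the line at height `t` in the squares of the first
level are the numbers `L t - κ q`. -/
def transfer (κ : Digit L → ℝ) (p : ℝ → ℝ) (t : ℝ) : ℝ := (L : ℝ)⁻¹ * ∑ q, p (L * t - κ q)

/-- The adjoint of `transfer`. -/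
def cotransfer (κ : Digit L → ℝ) (g : ℝ → ℝ) (τ : ℝ) : ℝ :=
  ((L : ℝ) ^ 2)⁻¹ * ∑ q, g ((τ + κ q) / L)

/-- If a line at relative position `t` survives with probability `p t`, then `survive m κ p t` is
the probability of survival of a line one generation earlier. -/
def survive (m : Selection L → ℝ) (κ : Digit L → ℝ) (p : ℝ → ℝ) (t : ℝ) : ℝ :=
  ∑ A, m A * (1 - ∏ q ∈ A, (1 - p (L * t - κ q)))

/-- The mean of the sum of `p r` over pairs of different selected squares. -/
def pairing (m : Selection L → ℝ) (κ : Digit L → ℝ) (p r : ℝ → ℝ) (t : ℝ) : ℝ :=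
  ∑ q, ∑ q', pairProb m q q' * (p (L * t - κ q) * r (L * t - κ q'))

/-- The probability weights of a uniform grid model. -/
structure IsUniformWeight (m : Selection L → ℝ) : Prop where
  nonneg : ∀ A, 0 ≤ m A
  sum_one : ∑ A, m A = 1
  marginal : ∀ q : Digit L, ∑ A, (if q ∈ A then m A else 0) = (L : ℝ)⁻¹

variable {m : Selection L → ℝ} {κ : Digit L → ℝ} {p r : ℝ → ℝ}

lemma pairProb_comm (q q' : Digit L) : pairProb m q q' = pairProb m q' q := by
  simp only [pairProb, eq_comm (a := q), and_comm]

lemma pairProb_nonneg (hm : IsUniformWeight m) (q q' : Digit L) : 0 ≤ pairProb m q q' := by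
  unfold pairProb
  split_ifs
  · exact le_rfl
  · exact Finset.sum_nonneg fun A _ => by split_ifs <;> simp [hm.nonneg]

lemma pairProb_le (hm : IsUniformWeight m) (q q' : Digit L) : pairProb m q q' ≤ (L : ℝ)⁻¹ := by
  unfold pairProb
  split_ifs
  · positivity
  · rw [← hm.marginal q]
    refine Finset.sum_le_sum fun A _ => ?_
    split_ifs with h1 h2 h2
    · exact le_rfl
    · exact absurd h1.1 h2
    · exact hm.nonneg A
    · exact le_rfl

lemma pairProb_le_one (hm : IsUniformWeight m) (q q' : Digit L) : pairProb m q q' ≤ 1 := by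
  refine (pairProb_le hm q q').trans ?_
  rcases Nat.eq_zero_or_pos L with h | h
  · simp [h]
  · exact inv_le_one_of_one_le₀ (by exact_mod_cast h)

lemma sum_mul_pairSum (x y : Digit L → ℝ) :
    ∑ A, m A * pairSum A x y = ∑ q, ∑ q', pairProb m q q' * (x q * y q') := by
  have h1 : ∀ A : Selection L, m A * pairSum A x y =
      ∑ q, ∑ q', (if q = q' then 0 else if q ∈ A ∧ q' ∈ A then m A else 0) * (x q * y q') := by
    intro A
    rw [pairSum, Finset.mul_sum, ← Finset.sum_filter_add_sum_filter_not Finset.univ (fun q => q ∈ A)]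
    rw [Finset.sum_eq_zero (s := Finset.univ.filter fun q => ¬ q ∈ A), add_zero]
    · refine Finset.sum_congr (by ext; simp) fun q hq => ?_
      simp only [Finset.mem_filter, Finset.mem_univ, true_and] at hq
      rw [Finset.mul_sum,
        ← Finset.sum_filter_add_sum_filter_not Finset.univ (fun q => q ∈ A),
        Finset.sum_eq_zero (s := Finset.univ.filter fun q => ¬ q ∈ A), add_zero]
      · refine Finset.sum_congr (by ext; simp) fun q' hq' => ?_
        simp only [Finset.mem_filter, Finset.mem_univ, true_and] at hq'
        simp only [hq, hq', and_self, if_true]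
        split_ifs <;> simp
      · intro q' hq'
        simp only [Finset.mem_filter, Finset.mem_univ, true_and] at hq'
        simp [hq']
    · intro q hq
      simp only [Finset.mem_filter, Finset.mem_univ, true_and] at hq
      simp [hq]
  simp only [h1]
  rw [Finset.sum_comm]
  refine Finset.sum_congr rfl fun q _ => ?_
  rw [Finset.sum_comm]
  refine Finset.sum_congr rfl fun q' _ => ?_
  rw [← Finset.sum_mul, pairProb]
  split_ifs <;> simp

lemma pairing_eq_sum (t : ℝ) :
    pairing m κ p r t =
      ∑ A, m A * pairSum A (fun q => p (L * t - κ q)) (fun q => r (L * t - κ q)) := by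
  rw [sum_mul_pairSum, pairing]

lemma sum_mul_sum (hm : IsUniformWeight m) (x : Digit L → ℝ) :
    ∑ A, m A * ∑ q ∈ A, x q = (L : ℝ)⁻¹ * ∑ q, x q := by
  have : ∀ A : Selection L, m A * ∑ q ∈ A, x q = ∑ q, (if q ∈ A then m A else 0) * x q := by
    intro A
    rw [Finset.mul_sum]
    simp only [ite_mul, zero_mul, Finset.sum_ite_mem, Finset.univ_inter]
  simp only [this]
  rw [Finset.sum_comm, Finset.mul_sum]
  refine Finset.sum_congr rfl fun q _ => ?_
  rw [← Finset.sum_mul, hm.marginal]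

/-- By uniformity `transfer` is the mean number of surviving squares, while `survive` is the
probability that there is at least one. The difference is the mean of (N - 1)⁺. -/
lemma transfer_sub_survive (hm : IsUniformWeight m) (t : ℝ) :
    transfer κ p t - survive m κ p t = ∑ A, m A * excess A (fun q => p (L * t - κ q)) := by
  rw [transfer, ← sum_mul_sum hm, survive, ← Finset.sum_sub_distrib]
  refine Finset.sum_congr rfl fun A _ => ?_
  rw [excess]; ring

lemma survive_nonneg (hm : IsUniformWeight m) (h0 : ∀ t, 0 ≤ p t) (h1 : ∀ t, p t ≤ 1) (t : ℝ) :
    0 ≤ survive m κ p t :=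
  Finset.sum_nonneg fun A _ => mul_nonneg (hm.nonneg A)
    (sub_nonneg.2 (prod_one_sub_le_one (fun _ => h0 _) fun _ => h1 _))

lemma survive_le_one (hm : IsUniformWeight m) (h1 : ∀ t, p t ≤ 1) (t : ℝ) :
    survive m κ p t ≤ 1 := by
  rw [← hm.sum_one]
  refine Finset.sum_le_sum fun A _ => ?_
  have := prod_one_sub_nonneg (A := A) (x := fun q => p (L * t - κ q)) fun _ => h1 _
  nlinarith [hm.nonneg A]

lemma survive_mono (hm : IsUniformWeight m) {p' : ℝ → ℝ} (h : ∀ t, p t ≤ p' t)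
    (h1 : ∀ t, p' t ≤ 1) (t : ℝ) : survive m κ p t ≤ survive m κ p' t := by
  refine Finset.sum_le_sum fun A _ => mul_le_mul_of_nonneg_left ?_ (hm.nonneg A)
  have : ∏ q ∈ A, (1 - p' (L * t - κ q)) ≤ ∏ q ∈ A, (1 - p (L * t - κ q)) :=
    Finset.prod_le_prod (fun q _ => sub_nonneg.2 (h1 _)) fun q _ => by linarith [h (L * t - κ q)]
  linarith

lemma survive_le_transfer_sub (hm : IsUniformWeight m) (hL : 0 < L)
    (h0 : ∀ t, 0 ≤ p t) (h1 : ∀ t, p t ≤ 1) (t : ℝ) :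
    survive m κ p t ≤ transfer κ p t - ((L : ℝ) ^ 4)⁻¹ * pairing m κ p p t := by
  have h := transfer_sub_survive (κ := κ) (p := p) hm t
  have : ((L : ℝ) ^ 4)⁻¹ * pairing m κ p p t ≤
      ∑ A, m A * excess A (fun q => p (L * t - κ q)) := by
    rw [pairing_eq_sum, Finset.mul_sum]
    refine Finset.sum_le_sum fun A _ => ?_
    rw [mul_left_comm]
    refine mul_le_mul_of_nonneg_left ?_ (hm.nonneg A)
    rw [inv_mul_le_iff₀ (by positivity)]
    refine (pairSum_le_card_mul_excess A (fun _ => h0 _) fun _ => h1 _).trans ?_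
    refine mul_le_mul_of_nonneg_right ?_ (excess_nonneg A (fun _ => h0 _) fun _ => h1 _)
    have : (A.card : ℝ) ≤ (L : ℝ) ^ 2 := by
      have := Finset.card_le_univ A
      simp only [Fintype.card_prod, Fintype.card_fin] at this
      rw [sq]; exact_mod_cast this
    calc (A.card : ℝ) ^ 2 ≤ ((L : ℝ) ^ 2) ^ 2 := by gcongr
      _ = (L : ℝ) ^ 4 := by ring
  linarith

lemma survive_le_transfer (hm : IsUniformWeight m) (h0 : ∀ t, 0 ≤ p t) (h1 : ∀ t, p t ≤ 1) (t : ℝ) :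
    survive m κ p t ≤ transfer κ p t := by
  have h := transfer_sub_survive (κ := κ) (p := p) hm t
  have : 0 ≤ ∑ A, m A * excess A (fun q => p (L * t - κ q)) :=
    Finset.sum_nonneg fun A _ => mul_nonneg (hm.nonneg A)
      (excess_nonneg A (fun _ => h0 _) fun _ => h1 _)
  linarith

lemma transfer_sub_survive_le (hm : IsUniformWeight m) (h0 : ∀ t, 0 ≤ p t) (h1 : ∀ t, p t ≤ 1)
    (t : ℝ) : transfer κ p t - survive m κ p t ≤ pairing m κ p p t / 2 := by
  rw [transfer_sub_survive hm, pairing_eq_sum, Finset.sum_div]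
  refine Finset.sum_le_sum fun A _ => ?_
  rw [mul_div_assoc]
  exact mul_le_mul_of_nonneg_left (excess_le_pairSum A (fun _ => h0 _) fun _ => h1 _) (hm.nonneg A)

/-- Truncated version of the second Bonferroni inequality. -/
lemma pairing_le_transfer_sub_survive (hm : IsUniformWeight m) {l : ℝ → ℝ} {b : ℝ}
    (hl0 : ∀ t, 0 ≤ l t) (hlp : ∀ t, l t ≤ p t) (h1 : ∀ t, p t ≤ 1) (hlb : ∀ t, l t ≤ b) (t : ℝ) :
    (1 - (L : ℝ) ^ 2 * b) * (pairing m κ l l t / 2) ≤ transfer κ p t - survive m κ p t := by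
  have hb : 0 ≤ b := (hl0 0).trans (hlb 0)
  rw [transfer_sub_survive hm, pairing_eq_sum, Finset.sum_div, Finset.mul_sum]
  refine Finset.sum_le_sum fun A _ => ?_
  rw [mul_div_assoc, mul_left_comm]
  refine mul_le_mul_of_nonneg_left ?_ (hm.nonneg A)
  -- The truncated weights have total at most `L ^ 2 * b`, so the sharp bound applies to `l`;
  -- monotonicity of the excess then passes to `p`.
  refine (pairSum_le_excess A (fun _ => hl0 _) (fun _ => (hlp _).trans (h1 _)) ?_).trans
    (excess_mono A (fun _ => hl0 _) (fun _ => hlp _) fun _ => h1 _)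
  calc ∑ q ∈ A, l (L * t - κ q) ≤ ∑ q ∈ A, b := Finset.sum_le_sum fun _ _ => hlb _
    _ = A.card * b := by simp
    _ ≤ _ := by
      refine mul_le_mul_of_nonneg_right ?_ hb
      have := Finset.card_le_univ A
      simp only [Fintype.card_prod, Fintype.card_fin] at this
      rw [sq]; exact_mod_cast this

lemma transfer_nonneg (h0 : ∀ t, 0 ≤ p t) (t : ℝ) : 0 ≤ transfer κ p t :=
  mul_nonneg (by positivity) (Finset.sum_nonneg fun _ _ => h0 _)

lemma transfer_mono {p' : ℝ → ℝ} (h : ∀ t, p t ≤ p' t) (t : ℝ) :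
    transfer κ p t ≤ transfer κ p' t :=
  mul_le_mul_of_nonneg_left (Finset.sum_le_sum fun _ _ => h _) (by positivity)

lemma transfer_add (t : ℝ) :
    transfer κ (fun t => p t + r t) t = transfer κ p t + transfer κ r t := by
  simp only [transfer, Finset.sum_add_distrib, mul_add]

lemma transfer_const_mul (c t : ℝ) :
    transfer κ (fun t => c * p t) t = c * transfer κ p t := by
  simp only [transfer, ← Finset.mul_sum]; ring

lemma pairing_nonneg (hm : IsUniformWeight m) (hp : ∀ t, 0 ≤ p t) (hr : ∀ t, 0 ≤ r t) (t : ℝ) :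
    0 ≤ pairing m κ p r t :=
  Finset.sum_nonneg fun _ _ => Finset.sum_nonneg fun _ _ =>
    mul_nonneg (pairProb_nonneg hm _ _) (mul_nonneg (hp _) (hr _))

lemma pairing_mono (hm : IsUniformWeight m) {p' r' : ℝ → ℝ} (hp : ∀ t, 0 ≤ p t) (hr : ∀ t, 0 ≤ r t)
    (hpp : ∀ t, p t ≤ p' t) (hrr : ∀ t, r t ≤ r' t) (t : ℝ) :
    pairing m κ p r t ≤ pairing m κ p' r' t :=
  Finset.sum_le_sum fun _ _ => Finset.sum_le_sum fun _ _ =>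
    mul_le_mul_of_nonneg_left (mul_le_mul (hpp _) (hrr _) (hr _) ((hp _).trans (hpp _)))
      (pairProb_nonneg hm _ _)

/-- Jensen's inequality for the mean operator. -/
lemma transfer_sq_le {h : ℝ → ℝ} (hp : ∀ t, h t = 0 → p t = 0) (hh : ∀ t, 0 ≤ h t) (t : ℝ) :
    transfer κ p t ^ 2 ≤ transfer κ (fun t => p t ^ 2 / h t) t * transfer κ h t := by
  unfold transfer
  rw [mul_pow, mul_mul_mul_comm, ← sq]
  refine mul_le_mul_of_nonneg_left ?_ (by positivity)
  refine Finset.sum_sq_le_sum_mul_sum_of_sq_le_mul _ (fun q _ => div_nonneg (sq_nonneg _) (hh _))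
    (fun q _ => hh _) fun q _ => le_of_eq ?_
  by_cases h0 : h (L * t - κ q) = 0
  · simp [h0, hp _ h0]
  · rw [div_mul_cancel₀ _ h0]

lemma transfer_sq_div_le {h : ℝ → ℝ} (hp : ∀ t, h t = 0 → p t = 0) (hh : ∀ t, 0 ≤ h t) (t : ℝ) :
    transfer κ p t ^ 2 / transfer κ h t ≤ transfer κ (fun t => p t ^ 2 / h t) t := by
  have h2 : 0 ≤ transfer κ (fun t => p t ^ 2 / h t) t :=
    transfer_nonneg (fun t => div_nonneg (sq_nonneg _) (hh t)) t
  rcases (transfer_nonneg (κ := κ) hh t).eq_or_lt with h0 | h0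
  · rw [← h0, div_zero]; exact h2
  · rw [div_le_iff₀ h0]; exact transfer_sq_le hp hh t

/-- Energy inequality, with an auxiliary truncation: `l / h` is a contraction of `w / h`. -/
lemma pairing_energy (hm : IsUniformWeight m) {l w h : ℝ → ℝ} {K : ℝ}
    (hh : ∀ t, 0 ≤ h t) (hw : ∀ t, h t = 0 → w t = 0)
    (hlw : ∀ t, h t = 0 → l t = 0) (hK : ∀ t, transfer κ h t ≤ K)
    (hlip : ∀ s t, |l s / h s - l t / h t| ≤ |w s / h s - w t / h t|) (t : ℝ) :
    pairing m κ (fun t => l t ^ 2 / h t) h t - (L : ℝ) ^ 2 * K *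
      (transfer κ (fun t => w t ^ 2 / h t) t - transfer κ w t ^ 2 / transfer κ h t) ≤
      pairing m κ l l t := by
  rcases Nat.eq_zero_or_pos L with hL | hL
  · subst hL
    have : IsEmpty (Digit 0) := ⟨fun q => q.1.elim0⟩
    simp [pairing, transfer]
  set H : Digit L → ℝ := fun q => h (L * t - κ q) with hH
  set U : Digit L → ℝ := fun q => w (L * t - κ q) / h (L * t - κ q) with hU
  set W : Digit L → ℝ := fun q => l (L * t - κ q) / h (L * t - κ q) with hW
  have e1 : ∀ q, l (L * t - κ q) = H q * W q := by
    intro q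
    by_cases h0 : h (L * t - κ q) = 0
    · simp [hH, h0, hlw _ h0]
    · simp only [hH, hW]; field_simp
  have e2 : ∀ q, w (L * t - κ q) = H q * U q := by
    intro q
    by_cases h0 : h (L * t - κ q) = 0
    · simp [hH, h0, hw _ h0]
    · simp only [hH, hU]; field_simp
  have e3 : ∀ q, l (L * t - κ q) ^ 2 / h (L * t - κ q) = H q * W q ^ 2 := by
    intro q
    by_cases h0 : h (L * t - κ q) = 0
    · simp [hH, h0]
    · simp only [hH, hW]; field_simp
  have e4 : ∀ q, w (L * t - κ q) ^ 2 / h (L * t - κ q) = H q * U q ^ 2 := by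
    intro q
    by_cases h0 : h (L * t - κ q) = 0
    · simp [hH, h0]
    · simp only [hH, hU]; field_simp
  have hL' : (0 : ℝ) < L := by exact_mod_cast hL
  have hH0 : ∀ q, 0 ≤ H q := fun q => hh _
  -- By symmetry of the pair probabilities, replacing the products W q * W q' by W q ^ 2 costs half
  -- the sum of the squared differences.
  have key : pairing m κ (fun t => l t ^ 2 / h t) h t - pairing m κ l l t =
      1 / 2 * ∑ q, ∑ q', pairProb m q q' * (H q * H q' * (W q - W q') ^ 2) := by
    have sw : ∑ q, ∑ q', pairProb m q q' * (H q * W q ^ 2 * H q') =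
        ∑ q, ∑ q', pairProb m q q' * (H q * (H q' * W q' ^ 2)) := by
      rw [Finset.sum_comm]
      refine Finset.sum_congr rfl fun q _ => Finset.sum_congr rfl fun q' _ => ?_
      rw [pairProb_comm]; ring
    have ex : ∑ q, ∑ q', pairProb m q q' * (H q * H q' * (W q - W q') ^ 2) =
        ∑ q, ∑ q', pairProb m q q' * (H q * W q ^ 2 * H q') +
        ∑ q, ∑ q', pairProb m q q' * (H q * (H q' * W q' ^ 2)) -
        2 * ∑ q, ∑ q', pairProb m q q' * (H q * W q * (H q' * W q')) := by
      simp only [Finset.mul_sum, ← Finset.sum_add_distrib, ← Finset.sum_sub_distrib]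
      refine Finset.sum_congr rfl fun q _ => Finset.sum_congr rfl fun q' _ => ?_
      ring
    have p1 : pairing m κ (fun t => l t ^ 2 / h t) h t =
        ∑ q, ∑ q', pairProb m q q' * (H q * W q ^ 2 * H q') := by simp only [pairing, e3, hH]
    have p2 : pairing m κ l l t = ∑ q, ∑ q', pairProb m q q' * (H q * W q * (H q' * W q')) := by
      simp only [pairing, e1]
    rw [ex, ← sw, p1, p2]
    ring
  -- Bounding the pair probabilities by 1 and using the contraction, the differences of `W = l / h`
  -- are replaced by those of `U = w / h`.
  have b1 : ∑ q, ∑ q', pairProb m q q' * (H q * H q' * (W q - W q') ^ 2) ≤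
      ∑ q, ∑ q', H q * H q' * (U q - U q') ^ 2 := by
    refine Finset.sum_le_sum fun q _ => Finset.sum_le_sum fun q' _ => ?_
    have h1 : (W q - W q') ^ 2 ≤ (U q - U q') ^ 2 := sq_le_sq.2 (hlip _ _)
    have h2 : 0 ≤ H q * H q' := mul_nonneg (hH0 q) (hH0 q')
    have h3 : H q * H q' * (W q - W q') ^ 2 ≤ H q * H q' * (U q - U q') ^ 2 :=
      mul_le_mul_of_nonneg_left h1 h2
    have h4 : 0 ≤ H q * H q' * (W q - W q') ^ 2 := mul_nonneg h2 (sq_nonneg _)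
    nlinarith [pairProb_le_one hm q q', pairProb_nonneg hm q q']
  rw [sum_sum_mul_mul_sub_sq] at b1
  have t1 : transfer κ (fun t => w t ^ 2 / h t) t = (L : ℝ)⁻¹ * ∑ q, H q * U q ^ 2 := by
    simp only [transfer, e4]
  have t2 : transfer κ w t = (L : ℝ)⁻¹ * ∑ q, H q * U q := by simp only [transfer, e2]
  have t3 : transfer κ h t = (L : ℝ)⁻¹ * ∑ q, H q := rfl
  -- With all pairs included, the sum of squared differences is a weighted variance of `U`, that is,
  -- the gap in Jensen's inequality times `L ^ 2 * transfer κ h t`.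
  have hvar : (∑ q, H q * U q ^ 2) * (∑ q, H q) - (∑ q, H q * U q) ^ 2 ≤ (L : ℝ) ^ 2 * K *
      (transfer κ (fun t => w t ^ 2 / h t) t - transfer κ w t ^ 2 / transfer κ h t) := by
    have hv : 0 ≤ transfer κ (fun t => w t ^ 2 / h t) t - transfer κ w t ^ 2 / transfer κ h t :=
      sub_nonneg.2 (transfer_sq_div_le hw hh t)
    have hle : (∑ q, H q * U q ^ 2) * (∑ q, H q) - (∑ q, H q * U q) ^ 2 =
        (L : ℝ) ^ 2 * transfer κ h t *
      (transfer κ (fun t => w t ^ 2 / h t) t - transfer κ w t ^ 2 / transfer κ h t) := by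
      rcases (transfer_nonneg (κ := κ) hh t).eq_or_lt with h0 | h0
      · have hs : ∑ q, H q = 0 := by
          rw [t3] at h0
          rcases mul_eq_zero.1 h0.symm with h | h
          · simp [hL'.ne'] at h
          · exact h
        have hz : ∀ q, H q = 0 := fun q =>
          (Finset.sum_eq_zero_iff_of_nonneg fun q _ => hH0 q).1 hs q (Finset.mem_univ q)
        simp [hz, ← h0]
      · have h0' : ∑ q, H q ≠ 0 := by
          intro h; rw [t3, h] at h0; simp at h0
        rw [t1, t2, t3]
        field_simp
    rw [hle]
    refine mul_le_mul_of_nonneg_right ?_ hv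
    exact mul_le_mul_of_nonneg_left (hK t) (by positivity)
  linarith

end Operators

end

end GridFractal

open MeasureTheory ProbabilityTheory Filter Topology Set

namespace GridFractal

noncomputable section

/-! ### Bounded measurable functions supported in a set -/

/-- Bounded measurable functions vanishing outside `I`. -/
structure IsNice (I : Set ℝ) (p : ℝ → ℝ) : Prop where
  measurable : Measurable p
  bounded : ∃ C, ∀ t, |p t| ≤ C
  eq_zero : ∀ t, t ∉ I → p t = 0

namespace IsNice

variable {I : Set ℝ} {p r : ℝ → ℝ}

lemma of_abs_le (hr : IsNice I r) (hp : Measurable p) {c : ℝ} (h : ∀ t, |p t| ≤ c * |r t|) :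
    IsNice I p := by
  obtain ⟨C, hC⟩ := hr.bounded
  refine ⟨hp, ⟨|c| * C, fun t => (h t).trans ?_⟩, fun t ht => ?_⟩
  · calc c * |r t| ≤ |c| * |r t| := mul_le_mul_of_nonneg_right (le_abs_self c) (abs_nonneg _)
      _ ≤ |c| * C := mul_le_mul_of_nonneg_left (hC t) (abs_nonneg c)
  · have := h t
    rw [hr.eq_zero t ht, abs_zero, mul_zero] at this
    exact abs_nonpos_iff.1 this

lemma of_le (hr : IsNice I r) (hp : Measurable p) (h0 : ∀ t, 0 ≤ p t) {c : ℝ}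
    (h : ∀ t, p t ≤ c * r t) : IsNice I p := by
  refine (hr.of_abs_le (c := |c|) hp) fun t => ?_
  rw [abs_of_nonneg (h0 t), ← abs_mul]
  exact (h t).trans (le_abs_self _)

lemma integrable {lo hi : ℝ} (hp : IsNice (Icc lo hi) p) : Integrable p := by
  obtain ⟨C, hC⟩ := hp.bounded
  have h1 : IntegrableOn p (Icc lo hi) :=
    Measure.integrableOn_of_bounded (M := C) (by simp) hp.measurable.aestronglyMeasurable
      (Eventually.of_forall fun _ => by simpa using hC _)
  refine (integrableOn_iff_integrable_of_support_subset fun t ht => ?_).1 h1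
  by_contra hI
  exact ht (hp.eq_zero t hI)

lemma add (hp : IsNice I p) (hr : IsNice I r) : IsNice I fun t => p t + r t := by
  obtain ⟨C, hC⟩ := hp.bounded
  obtain ⟨C', hC'⟩ := hr.bounded
  exact ⟨hp.measurable.add hr.measurable, ⟨C + C', fun t => (abs_add_le _ _).trans
    (add_le_add (hC t) (hC' t))⟩, fun t ht => by simp [hp.eq_zero t ht, hr.eq_zero t ht]⟩

lemma const_mul (hp : IsNice I p) (c : ℝ) : IsNice I fun t => c * p t :=
  hp.of_abs_le (hp.measurable.const_mul c) (c := |c|) fun _ => (abs_mul _ _).le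

lemma sub (hp : IsNice I p) (hr : IsNice I r) : IsNice I fun t => p t - r t := by
  simpa [sub_eq_add_neg] using hp.add (hr.const_mul (-1))

lemma mul_bounded (hp : IsNice I p) (hr : Measurable r) {C : ℝ} (hC : ∀ t, |r t| ≤ C) :
    IsNice I fun t => p t * r t :=
  hp.of_abs_le (hp.measurable.mul hr) (c := C) fun t => by
    rw [abs_mul, mul_comm]; exact mul_le_mul_of_nonneg_right (hC t) (abs_nonneg _)

lemma mul (hp : IsNice I p) (hr : IsNice I r) : IsNice I fun t => p t * r t := by
  obtain ⟨C, hC⟩ := hr.bounded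
  exact hp.mul_bounded hr.measurable hC

lemma pow_two (hp : IsNice I p) : IsNice I fun t => p t ^ 2 := by
  simpa [sq] using hp.mul hp

lemma sum {α : Type*} (s : Finset α) {f : α → ℝ → ℝ} (h : ∀ a ∈ s, IsNice I (f a)) :
    IsNice I fun t => ∑ a ∈ s, f a t := by
  classical
  induction s using Finset.induction_on with
  | empty => exact ⟨by simp, ⟨0, by simp⟩, by simp⟩
  | insert a s ha ih =>
    simp only [Finset.sum_insert ha]
    exact (h a (Finset.mem_insert_self a s)).add (ih fun b hb => h b (Finset.mem_insert_of_mem hb))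

end IsNice

/-! ### Families of parallel lines -/

/-- The data of a direction, abstractly: `κ q` is the projection of the corner `q`, the lines meeting
the unit square are those at heights in `[lo, hi]`, and `h t` is the length of the part of the line at
height `t` in the unit square. -/
structure LineSystem {L : ℕ} (κ : Digit L → ℝ) (lo hi : ℝ) (h : ℝ → ℝ) : Prop where
  two_le : 2 ≤ L
  width_nonneg : lo ≤ hi
  width_le : hi - lo ≤ 3
  maps : ∀ q t, L * t - κ q ∈ Icc lo hi → t ∈ Icc lo hi
  nice : IsNice (Icc lo hi) h
  nonneg : ∀ t, 0 ≤ h t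
  le_two : ∀ t, h t ≤ 2
  transfer_eq : transfer κ h = h
  integral_eq : ∫ t, h t = 1
  -- The bound 18 comes from nine translates of the unit square, each with chord at most 2.
  iterate_le : ∀ n t, (transfer κ)^[n] ((Icc lo hi).indicator 1) t ≤ 18

/-! ### Duality for the mean operator, and the pair density -/

section Duality

variable {L : ℕ} {m : Selection L → ℝ} {κ : Digit L → ℝ} {lo hi : ℝ} {h p r : ℝ → ℝ}

/-- The function representing `∫ pairing m κ p h` as a functional of `p`. -/
def pairDensity (m : Selection L → ℝ) (κ : Digit L → ℝ) (h : ℝ → ℝ) (τ : ℝ) : ℝ :=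
  (L : ℝ)⁻¹ * ∑ q, ∑ q', pairProb m q q' * h (τ + (κ q - κ q'))

lemma IsNice.comp_child (S : LineSystem κ lo hi h) (hp : IsNice (Icc lo hi) p) (q : Digit L) :
    IsNice (Icc lo hi) fun t => p (L * t - κ q) := by
  obtain ⟨C, hC⟩ := hp.bounded
  exact ⟨hp.measurable.comp (by fun_prop), ⟨C, fun t => hC _⟩, fun t ht =>
    hp.eq_zero _ fun h' => ht (S.maps q t h')⟩

lemma IsNice.transfer (S : LineSystem κ lo hi h) (hp : IsNice (Icc lo hi) p) :
    IsNice (Icc lo hi) (transfer κ p) :=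
  (IsNice.sum _ fun q _ => hp.comp_child S q).const_mul _

lemma IsNice.iterate_transfer (S : LineSystem κ lo hi h) (hp : IsNice (Icc lo hi) p) (n : ℕ) :
    IsNice (Icc lo hi) ((GridFractal.transfer κ)^[n] p) := by
  induction n with
  | zero => exact hp
  | succ n ih => rw [Function.iterate_succ_apply']; exact ih.transfer S

lemma IsNice.pairing (S : LineSystem κ lo hi h) (hp : IsNice (Icc lo hi) p)
    (hr : IsNice (Icc lo hi) r) : IsNice (Icc lo hi) (pairing m κ p r) :=
  IsNice.sum _ fun q _ => IsNice.sum _ fun q' _ =>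
    ((hp.comp_child S q).mul (hr.comp_child S q')).const_mul _

lemma measurable_survive (hp : Measurable p) : Measurable (survive m κ p) := by
  unfold survive
  refine Finset.measurable_sum _ fun A _ => ?_
  refine Measurable.const_mul (measurable_const.sub (Finset.measurable_prod _ fun q _ => ?_)) _
  exact measurable_const.sub (hp.comp (by fun_prop))

lemma LineSystem.pos (S : LineSystem κ lo hi h) : (0 : ℝ) < L := by
  have := S.two_le
  exact_mod_cast (by omega : 0 < L)

lemma integral_comp_child (hL : (0 : ℝ) < L) (f : ℝ → ℝ) (a : ℝ) :
    ∫ t, f (L * t - a) = (L : ℝ)⁻¹ * ∫ t, f t := by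
  rw [Measure.integral_comp_mul_left (fun t => f (t - a)) (L : ℝ), integral_sub_right_eq_self,
    abs_of_pos (inv_pos.2 hL), smul_eq_mul]

lemma card_digit : ((Finset.univ : Finset (Digit L)).card : ℝ) = (L : ℝ) ^ 2 := by
  simp [sq]

lemma integral_transfer (S : LineSystem κ lo hi h) (hp : IsNice (Icc lo hi) p) :
    ∫ t, transfer κ p t = ∫ t, p t := by
  unfold transfer
  rw [integral_const_mul, integral_finsetSum _ fun q _ => (hp.comp_child S q).integrable]
  simp only [integral_comp_child S.pos, Finset.sum_const, nsmul_eq_mul, card_digit]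
  have := S.pos
  field_simp

lemma integral_iterate_transfer (S : LineSystem κ lo hi h) (hp : IsNice (Icc lo hi) p) (n : ℕ) :
    ∫ t, (transfer κ)^[n] p t = ∫ t, p t := by
  induction n with
  | zero => rfl
  | succ n ih =>
    rw [Function.iterate_succ_apply', integral_transfer S (hp.iterate_transfer S n), ih]

lemma measurable_pairDensity (hh : Measurable h) : Measurable (pairDensity m κ h) := by
  unfold pairDensity
  refine (Finset.measurable_sum _ fun q _ => Finset.measurable_sum _ fun q' _ => ?_).const_mul _
  exact (hh.comp (by fun_prop)).const_mul _

lemma pairDensity_nonneg (hm : IsUniformWeight m) (hh : ∀ t, 0 ≤ h t) (t : ℝ) :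
    0 ≤ pairDensity m κ h t :=
  mul_nonneg (by positivity) (Finset.sum_nonneg fun _ _ => Finset.sum_nonneg fun _ _ =>
    mul_nonneg (pairProb_nonneg hm _ _) (hh _))

lemma pairDensity_le (hm : IsUniformWeight m) (S : LineSystem κ lo hi h) (t : ℝ) :
    pairDensity m κ h t ≤ 2 * (L : ℝ) ^ 2 := by
  have hL := S.pos
  calc pairDensity m κ h t ≤ (L : ℝ)⁻¹ * ∑ q : Digit L, ∑ q' : Digit L, (L : ℝ)⁻¹ * 2 := by
        refine mul_le_mul_of_nonneg_left ?_ (by positivity)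
        refine Finset.sum_le_sum fun _ _ => Finset.sum_le_sum fun _ _ => ?_
        exact mul_le_mul (pairProb_le hm _ _) (S.le_two _) (S.nonneg _) (by positivity)
    _ = _ := by
      simp only [Finset.sum_const, nsmul_eq_mul, card_digit]
      field_simp

lemma abs_pairDensity_le (hm : IsUniformWeight m) (S : LineSystem κ lo hi h) (t : ℝ) :
    |pairDensity m κ h t| ≤ 2 * (L : ℝ) ^ 2 := by
  rw [abs_of_nonneg (pairDensity_nonneg hm S.nonneg t)]
  exact pairDensity_le hm S t

/-- The substitution τ = L t - κ q puts the line at height τ in the first square; its height in the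
second is then shifted by κ q - κ q'. -/
lemma integral_pairing (S : LineSystem κ lo hi h) (hp : IsNice (Icc lo hi) p)
    (hr : IsNice (Icc lo hi) r) :
    ∫ t, pairing m κ p r t = ∫ t, p t * pairDensity m κ r t := by
  obtain ⟨C, hC⟩ := hr.bounded
  have e1 : ∀ t, p t * pairDensity m κ r t =
      ∑ q, ∑ q', pairProb m q q' * ((L : ℝ)⁻¹ * (p t * r (t + (κ q - κ q')))) := by
    intro t
    simp only [pairDensity, Finset.mul_sum]
    refine Finset.sum_congr rfl fun q _ => Finset.sum_congr rfl fun q' _ => ?_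
    ring
  have n1 : ∀ q q' : Digit L, IsNice (Icc lo hi) fun t => p t * r (t + (κ q - κ q')) := fun q q' =>
    hp.mul_bounded (hr.measurable.comp (by fun_prop)) fun t => hC _
  have n2 : ∀ q q' : Digit L, IsNice (Icc lo hi) fun t => p (L * t - κ q) * r (L * t - κ q') :=
    fun q q' => (hp.comp_child S q).mul (hr.comp_child S q')
  simp only [e1, pairing]
  rw [integral_finsetSum _ fun q _ =>
      (IsNice.sum _ fun q' _ => (n2 q q').const_mul _).integrable,
    integral_finsetSum _ fun q _ =>
      (IsNice.sum _ fun q' _ => ((n1 q q').const_mul _).const_mul _).integrable]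
  refine Finset.sum_congr rfl fun q _ => ?_
  rw [integral_finsetSum _ fun q' _ => ((n2 q q').const_mul _).integrable,
    integral_finsetSum _ fun q' _ => (((n1 q q').const_mul _).const_mul _).integrable]
  refine Finset.sum_congr rfl fun q' _ => ?_
  rw [integral_const_mul, integral_const_mul, integral_const_mul,
    ← integral_comp_child S.pos (fun τ => p τ * r (τ + (κ q - κ q'))) (κ q)]
  congr 2
  ext t
  congr 2
  ring

lemma measurable_cotransfer {g : ℝ → ℝ} (hg : Measurable g) : Measurable (cotransfer κ g) := by
  unfold cotransfer
  exact (Finset.measurable_sum _ fun q _ => hg.comp (by fun_prop)).const_mul _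

lemma abs_cotransfer_le (hL : (0 : ℝ) < L) {g : ℝ → ℝ} {C : ℝ} (hC : ∀ t, |g t| ≤ C) (t : ℝ) :
    |cotransfer κ g t| ≤ C := by
  unfold cotransfer
  rw [abs_mul, abs_of_pos (by positivity), inv_mul_le_iff₀ (by positivity)]
  refine (Finset.abs_sum_le_sum_abs _ _).trans ?_
  calc ∑ q : Digit L, |g ((t + κ q) / L)| ≤ ∑ q : Digit L, C := Finset.sum_le_sum fun _ _ => hC _
    _ = _ := by simp [sq]

lemma iterate_cotransfer_bounded (hL : (0 : ℝ) < L) {g : ℝ → ℝ} {C : ℝ} (hg : Measurable g)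
    (hC : ∀ t, |g t| ≤ C) (i : ℕ) :
    Measurable ((cotransfer κ)^[i] g) ∧ ∀ t, |(cotransfer κ)^[i] g t| ≤ C := by
  induction i with
  | zero => exact ⟨hg, hC⟩
  | succ i ih =>
    rw [Function.iterate_succ_apply']
    exact ⟨measurable_cotransfer ih.1, abs_cotransfer_le hL ih.2⟩

lemma integral_transfer_mul (S : LineSystem κ lo hi h) (hp : IsNice (Icc lo hi) p) {g : ℝ → ℝ}
    (hg : Measurable g) {C : ℝ} (hC : ∀ t, |g t| ≤ C) :
    ∫ t, transfer κ p t * g t = ∫ t, p t * cotransfer κ g t := by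
  have hL := S.pos
  have e1 : ∀ t, transfer κ p t * g t = ∑ q, (L : ℝ)⁻¹ * (p (L * t - κ q) * g t) := by
    intro t; simp only [transfer, Finset.mul_sum, Finset.sum_mul]
    exact Finset.sum_congr rfl fun q _ => by ring
  have e2 : ∀ t, p t * cotransfer κ g t =
      ∑ q, (L : ℝ)⁻¹ * ((L : ℝ)⁻¹ * (p t * g ((t + κ q) / L))) := by
    intro t; simp only [cotransfer, Finset.mul_sum]
    exact Finset.sum_congr rfl fun q _ => by rw [sq, mul_inv]; ring
  simp only [e1, e2]
  rw [integral_finsetSum _ fun q _ =>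
      (((hp.comp_child S q).mul_bounded hg hC).const_mul _).integrable,
    integral_finsetSum _ fun q _ => (((hp.mul_bounded (r := fun t => g ((t + κ q) / L))
      (hg.comp (by fun_prop)) fun t => hC _).const_mul _).const_mul _).integrable]
  refine Finset.sum_congr rfl fun q _ => ?_
  rw [integral_const_mul, integral_const_mul, integral_const_mul,
    ← integral_comp_child hL (fun τ => p τ * g ((τ + κ q) / L)) (κ q)]
  congr 2
  ext t
  congr 2
  field_simp
  ring

lemma integral_iterate_transfer_mul (S : LineSystem κ lo hi h) (hp : IsNice (Icc lo hi) p)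
    {g : ℝ → ℝ} (hg : Measurable g) {C : ℝ} (hC : ∀ t, |g t| ≤ C) (i : ℕ) :
    ∫ t, (transfer κ)^[i] p t * g t = ∫ t, p t * (cotransfer κ)^[i] g t := by
  induction i generalizing p with
  | zero => rfl
  | succ i ih =>
    rw [Function.iterate_succ_apply, ih (hp.transfer S), Function.iterate_succ_apply',
      integral_transfer_mul S hp (iterate_cotransfer_bounded S.pos hg hC i).1
        (iterate_cotransfer_bounded S.pos hg hC i).2]

lemma iterate_transfer_eq (S : LineSystem κ lo hi h) (n : ℕ) : (transfer κ)^[n] h = h := by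
  induction n with
  | zero => rfl
  | succ n ih => rw [Function.iterate_succ_apply', ih, S.transfer_eq]

end Duality

end

end GridFractal

open MeasureTheory ProbabilityTheory Filter Topology Set

namespace GridFractal

noncomputable section

/-! ### The energy method -/

/-- A sequence of functions `w n` with `w (n + 1) ≤ transfer κ (w n)`, dominated by the orbit `b n` of
the mean operator. -/
structure EnergySeq {L : ℕ} (κ : Digit L → ℝ) (lo hi : ℝ) (b w : ℕ → ℝ → ℝ) (K c : ℝ) : Prop where
  b_nice : ∀ n, IsNice (Icc lo hi) (b n)
  b_nonneg : ∀ n t, 0 ≤ b n t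
  b_le : ∀ n t, b n t ≤ K
  b_succ : ∀ n, b (n + 1) = transfer κ (b n)
  w_meas : ∀ n, Measurable (w n)
  w_nonneg : ∀ n t, 0 ≤ w n t
  w_le : ∀ n t, w n t ≤ c * b n t
  w_succ : ∀ n t, w (n + 1) t ≤ transfer κ (w n) t

/-- The energy density of `w` with respect to `b`. -/
def energy (b w : ℕ → ℝ → ℝ) (n : ℕ) (t : ℝ) : ℝ := w n t ^ 2 / b n t

namespace EnergySeq

variable {L : ℕ} {m : Selection L → ℝ} {κ : Digit L → ℝ} {lo hi : ℝ} {h : ℝ → ℝ}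
  {b w : ℕ → ℝ → ℝ} {K c : ℝ}

lemma w_nice (W : EnergySeq κ lo hi b w K c) (n : ℕ) : IsNice (Icc lo hi) (w n) :=
  (W.b_nice n).of_le (W.w_meas n) (W.w_nonneg n) (W.w_le n)

lemma w_eq_zero (W : EnergySeq κ lo hi b w K c) {n : ℕ} {t : ℝ} (h : b n t = 0) : w n t = 0 :=
  le_antisymm (by simpa [h] using W.w_le n t) (W.w_nonneg n t)

lemma energy_nonneg (W : EnergySeq κ lo hi b w K c) (n : ℕ) (t : ℝ) : 0 ≤ energy b w n t :=
  div_nonneg (sq_nonneg _) (W.b_nonneg n t)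

lemma energy_le (W : EnergySeq κ lo hi b w K c) (n : ℕ) (t : ℝ) :
    energy b w n t ≤ c * w n t := by
  rcases (W.b_nonneg n t).eq_or_lt with h0 | h0
  · simp [energy, ← h0, W.w_eq_zero h0.symm]
  · rw [energy, div_le_iff₀ h0]
    nlinarith [W.w_le n t, W.w_nonneg n t]

lemma sq_le_energy (W : EnergySeq κ lo hi b w K c) (n : ℕ) (t : ℝ) :
    w n t ^ 2 ≤ K * energy b w n t := by
  rcases (W.b_nonneg n t).eq_or_lt with h0 | h0
  · simp [energy, ← h0, W.w_eq_zero h0.symm]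
  · rw [energy, mul_div_assoc', le_div_iff₀ h0]
    nlinarith [W.b_le n t, sq_nonneg (w n t)]

lemma energy_nice (W : EnergySeq κ lo hi b w K c) (n : ℕ) : IsNice (Icc lo hi) (energy b w n) :=
  (W.w_nice n).of_le (((W.w_meas n).pow_const 2).div (W.b_nice n).measurable) (W.energy_nonneg n)
    (W.energy_le n)

lemma energy_succ_le' (W : EnergySeq κ lo hi b w K c) (n : ℕ) (t : ℝ) :
    energy b w (n + 1) t ≤ transfer κ (w n) t ^ 2 / transfer κ (b n) t := by
  unfold energy
  rw [W.b_succ n]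
  exact div_le_div_of_nonneg_right (pow_le_pow_left₀ (W.w_nonneg _ _) (W.w_succ n t) 2)
    (transfer_nonneg (W.b_nonneg n) t)

/-- Jensen's inequality for the convex homogeneous function w² / b: `b` evolves exactly by the mean
operator, and `w` stays below its own mean. -/
lemma energy_succ_le (W : EnergySeq κ lo hi b w K c) (n : ℕ) (t : ℝ) :
    energy b w (n + 1) t ≤ transfer κ (energy b w n) t :=
  (W.energy_succ_le' n t).trans
    (transfer_sq_div_le (fun _ h => W.w_eq_zero h) (W.b_nonneg n) t)

lemma energy_add_le (W : EnergySeq κ lo hi b w K c) (n i : ℕ) (t : ℝ) :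
    energy b w (n + i) t ≤ (transfer κ)^[i] (energy b w n) t := by
  induction i generalizing t with
  | zero => exact le_rfl
  | succ i ih =>
    rw [Function.iterate_succ_apply']
    exact (W.energy_succ_le (n + i) t).trans (transfer_mono ih t)

lemma integral_energy_antitone (W : EnergySeq κ lo hi b w K c) (S : LineSystem κ lo hi h) :
    Antitone fun n => ∫ t, energy b w n t := by
  refine antitone_nat_of_succ_le fun n => ?_
  rw [← integral_transfer S (W.energy_nice n)]
  exact integral_mono (W.energy_nice _).integrable ((W.energy_nice n).transfer S).integrable
    (W.energy_succ_le n)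

lemma integral_energy_nonneg (W : EnergySeq κ lo hi b w K c) (n : ℕ) :
    0 ≤ ∫ t, energy b w n t := integral_nonneg (W.energy_nonneg n)

/-- The energy density at time n + i lies below its i-fold transport from time n. Testing the
transport against `g` gives at least `c₀` times the energy, since the dual iterates of `g` are at
least `c₀`. The two densities being ordered, the error is at most `G` times the energy lost in
between. -/
lemma integral_energy_mul_ge (W : EnergySeq κ lo hi b w K c) (S : LineSystem κ lo hi h) {g : ℝ → ℝ}
    (hg : Measurable g) (hg0 : ∀ t, 0 ≤ g t) {G c₀ : ℝ} (hG : ∀ t, g t ≤ G) {i : ℕ}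
    (hc₀ : ∀ t ∈ Icc lo hi, c₀ ≤ (cotransfer κ)^[i] g t) (n : ℕ) :
    c₀ * (∫ t, energy b w n t) - G * ((∫ t, energy b w n t) - ∫ t, energy b w (n + i) t) ≤
      ∫ t, energy b w (n + i) t * g t := by
  have hG' : ∀ t, |g t| ≤ G := fun t => by rw [abs_of_nonneg (hg0 t)]; exact hG t
  have e0 := W.energy_nice n
  have ei := W.energy_nice (n + i)
  have eT := e0.iterate_transfer S i
  have h1 : c₀ * (∫ t, energy b w n t) ≤ ∫ t, (transfer κ)^[i] (energy b w n) t * g t := by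
    rw [integral_iterate_transfer_mul S e0 hg hG', ← integral_const_mul]
    refine integral_mono (e0.const_mul c₀).integrable
      (e0.mul_bounded (iterate_cotransfer_bounded S.pos hg hG' i).1
        (iterate_cotransfer_bounded S.pos hg hG' i).2).integrable fun t => ?_
    by_cases ht : t ∈ Icc lo hi
    · simp only
      rw [mul_comm]
      exact mul_le_mul_of_nonneg_left (hc₀ t ht) (W.energy_nonneg n t)
    · simp [e0.eq_zero t ht]
  have h2 : (∫ t, (transfer κ)^[i] (energy b w n) t * g t) - ∫ t, energy b w (n + i) t * g t ≤
      G * ((∫ t, energy b w n t) - ∫ t, energy b w (n + i) t) := by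
    rw [← integral_iterate_transfer S e0 i,
      ← integral_sub (eT.mul_bounded hg hG').integrable (ei.mul_bounded hg hG').integrable,
      ← integral_sub eT.integrable ei.integrable, ← integral_const_mul]
    refine integral_mono ((eT.mul_bounded hg hG').sub (ei.mul_bounded hg hG')).integrable
      ((eT.sub ei).const_mul G).integrable fun t => ?_
    have := W.energy_add_le n i t
    simp only
    nlinarith [hG t, hg0 t]
  linarith

/-- The integrated form of `pairing_energy` with `l = w`. Since the mean operator preserves
integrals, the Jensen gap becomes a bound by the decrease of the energy. -/
lemma integral_pairing_ge (W : EnergySeq κ lo hi b w K c) (S : LineSystem κ lo hi h)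
    (hm : IsUniformWeight m) (hb : ∀ n t, h t ≤ b n t) (n : ℕ) :
    (∫ t, energy b w n t * pairDensity m κ h t) - (L : ℝ) ^ 2 * K *
      ((∫ t, energy b w n t) - ∫ t, energy b w (n + 1) t) ≤ ∫ t, pairing m κ (w n) (w n) t := by
  have e0 := W.energy_nice n
  have e1 := W.energy_nice (n + 1)
  rw [← integral_pairing S e0 S.nice, ← integral_transfer S e0,
    ← integral_sub (e0.transfer S).integrable e1.integrable, ← integral_const_mul,
    ← integral_sub (e0.pairing S S.nice).integrable
      (((e0.transfer S).sub e1).const_mul _).integrable]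
  refine integral_mono ((e0.pairing S S.nice).sub (((e0.transfer S).sub e1).const_mul _)).integrable
    ((W.w_nice n).pairing S (W.w_nice n)).integrable fun t => ?_
  have hK : ∀ t, transfer κ (b n) t ≤ K := fun t => by rw [← W.b_succ]; exact W.b_le _ t
  have key := pairing_energy hm (κ := κ) (W.b_nonneg n) (fun _ => W.w_eq_zero)
    (fun _ => W.w_eq_zero) hK (l := w n) (w := w n) (fun _ _ => le_rfl) t
  have h1 : pairing m κ (energy b w n) h t ≤ pairing m κ (energy b w n) (b n) t :=
    pairing_mono hm (W.energy_nonneg n) S.nonneg (fun _ => le_rfl) (hb n) t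
  have h2 := W.energy_succ_le' n t
  have hK0 : 0 ≤ (L : ℝ) ^ 2 * K := mul_nonneg (by positivity)
    ((W.b_nonneg n 0).trans (W.b_le n 0))
  have h3 := mul_le_mul_of_nonneg_left h2 hK0
  rw [show (fun t => w n t ^ 2 / b n t) = energy b w n from rfl] at key
  simp only
  linarith

/-- Summability of the energies, with the constant depending on a few parameters only. -/
lemma sum_energy_le (W : EnergySeq κ lo hi b w K c) (S : LineSystem κ lo hi h)
    (hm : IsUniformWeight m) (hb : ∀ n t, h t ≤ b n t) (hc : 0 ≤ c) {c₀ : ℝ} {i : ℕ} (hc₀ : 0 < c₀)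
    (hc₀i : ∀ t ∈ Icc lo hi, c₀ ≤ (cotransfer κ)^[i] (pairDensity m κ h) t)
    (hloss : ∀ n t, w (n + 1) t ≤
      transfer κ (w n) t - ((L : ℝ) ^ 4)⁻¹ * pairing m κ (w n) (w n) t) (M N : ℕ) :
    ∑ n ∈ Finset.Ico M N, ∫ t, energy b w n t ≤
      ((L : ℝ) ^ 4 + (2 * (L : ℝ) ^ 2 + (L : ℝ) ^ 2 * K) * (i + 1) * c) / c₀ * ∫ t, w M t := by
  have hL := S.pos
  set D : ℕ → ℝ := fun n => ∫ t, energy b w n t with hD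
  set A : ℕ → ℝ := fun n => ∫ t, w n t with hA
  set C : ℝ := 2 * (L : ℝ) ^ 2 + (L : ℝ) ^ 2 * K with hC
  have hK0 : 0 ≤ K := (W.b_nonneg 0 0).trans (W.b_le 0 0)
  have hC0 : 0 ≤ C := by positivity
  have hanti : Antitone D := W.integral_energy_antitone S
  have hAsucc : ∀ n, ((L : ℝ) ^ 4)⁻¹ * (∫ t, pairing m κ (w n) (w n) t) ≤ A n - A (n + 1) := by
    intro n
    have n0 := W.w_nice n
    simp only [hA]
    rw [← integral_transfer S n0, ← integral_sub (n0.transfer S).integrable (W.w_nice _).integrable,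
      ← integral_const_mul]
    refine integral_mono ((n0.pairing S n0).const_mul _).integrable
      ((n0.transfer S).sub (W.w_nice _)).integrable fun t => ?_
    have := hloss n t
    simp only
    linarith
  -- The energy at time n is paid for by the length lost at time n + i, after the density has been
  -- mixed for i generations, and by a telescoping loss of energy.
  have hstep : ∀ n, c₀ * D n ≤ (L : ℝ) ^ 4 * (A (n + i) - A (n + i + 1)) +
      C * (D n - D (n + (i + 1))) := by
    intro n
    have h1 := hAsucc (n + i)
    rw [inv_mul_le_iff₀ (by positivity)] at h1
    have h2 := W.integral_pairing_ge S hm hb (n + i)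
    have h3 := W.integral_energy_mul_ge S (measurable_pairDensity S.nice.measurable)
      (pairDensity_nonneg hm S.nonneg) (pairDensity_le hm S) hc₀i n
    have h4 : D (n + i) ≤ D n := hanti (Nat.le_add_right _ _)
    have h5 : D (n + (i + 1)) ≤ D (n + i) := hanti (by omega)
    have h6 : (L : ℝ) ^ 2 * K * (D (n + i) - D (n + i + 1)) ≤
        (L : ℝ) ^ 2 * K * (D n - D (n + (i + 1))) :=
      mul_le_mul_of_nonneg_left (by rw [add_assoc]; linarith) (by positivity)
    have h7 : 2 * (L : ℝ) ^ 2 * (D n - D (n + i)) ≤ 2 * (L : ℝ) ^ 2 * (D n - D (n + (i + 1))) :=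
      mul_le_mul_of_nonneg_left (by linarith) (by positivity)
    simp only [hC]
    simp only [hD] at h4 h5 h6 h7 ⊢
    nlinarith
  have hA0 : ∀ n, 0 ≤ A n := fun n => integral_nonneg (W.w_nonneg n)
  have hAanti : Antitone A := antitone_nat_of_succ_le fun n => by
    have h1 := hAsucc n
    have h2 : 0 ≤ ∫ t, pairing m κ (w n) (w n) t :=
      integral_nonneg (pairing_nonneg hm (W.w_nonneg n) (W.w_nonneg n))
    have := mul_nonneg (by positivity : 0 ≤ ((L : ℝ) ^ 4)⁻¹) h2
    linarith
  -- Differences at distance j are j telescoping sums of step one, each at most `D M`.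
  have lag : ∀ N, M ≤ N → ∀ j, ∑ n ∈ Finset.Ico M N, (D n - D (n + j)) ≤ j * D M := by
    intro N hN j
    induction j with
    | zero => simp
    | succ j ih =>
      have e : ∀ n, D n - D (n + (j + 1)) = (D n - D (n + j)) + (D (n + j) - D (n + 1 + j)) := by
        intro n; rw [show n + (j + 1) = n + 1 + j by ring]; ring
      simp only [e, Finset.sum_add_distrib]
      have tele : ∑ n ∈ Finset.Ico M N, (D (n + j) - D (n + 1 + j)) = D (M + j) - D (N + j) := by
        have := Finset.sum_Ico_sub (fun n => -D (n + j)) hN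
        simp only [sub_neg_eq_add] at this
        rw [← sub_eq_neg_add] at this
        rw [← this]
        exact Finset.sum_congr rfl fun n _ => by ring
      rw [tele]
      have h1 : D (M + j) ≤ D M := hanti (Nat.le_add_right _ _)
      have h2 : 0 ≤ D (N + j) := W.integral_energy_nonneg _
      push_cast
      linarith
  have teleA : ∀ N, M ≤ N → ∑ n ∈ Finset.Ico M N, (A (n + i) - A (n + i + 1)) ≤ A M := by
    intro N hN
    have := Finset.sum_Ico_sub (fun n => -A (n + i)) hN
    have e : ∑ n ∈ Finset.Ico M N, (A (n + i) - A (n + i + 1)) = A (M + i) - A (N + i) := by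
      simp only [sub_neg_eq_add] at this
      rw [← sub_eq_neg_add] at this
      rw [← this]
      refine Finset.sum_congr rfl fun n _ => ?_
      rw [show n + i + 1 = n + 1 + i by ring]; ring
    rw [e]
    have h1 : A (M + i) ≤ A M := hAanti (Nat.le_add_right _ _)
    linarith [hA0 (N + i)]
  have hDA : D M ≤ c * A M := by
    simp only [hD, hA]
    rw [← integral_const_mul]
    exact integral_mono (W.energy_nice M).integrable ((W.w_nice M).const_mul c).integrable
      (W.energy_le M)
  rcases lt_or_ge N M with hMN | hMN
  · rw [Finset.Ico_eq_empty (by omega), Finset.sum_empty]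
    have := hA0 M
    positivity
  · have hsum : c₀ * ∑ n ∈ Finset.Ico M N, D n ≤
        (L : ℝ) ^ 4 * A M + C * ((i + 1 : ℕ) * D M) := by
      rw [Finset.mul_sum]
      refine (Finset.sum_le_sum fun n _ => hstep n).trans ?_
      rw [Finset.sum_add_distrib, ← Finset.mul_sum, ← Finset.mul_sum]
      exact add_le_add (mul_le_mul_of_nonneg_left (teleA N hMN) (by positivity))
        (mul_le_mul_of_nonneg_left (lag N hMN (i + 1)) hC0)
    have h8 : C * ((i + 1 : ℕ) * D M) ≤ C * ((i + 1 : ℕ) * (c * A M)) := by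
      refine mul_le_mul_of_nonneg_left (mul_le_mul_of_nonneg_left hDA (by positivity)) hC0
    rw [div_mul_eq_mul_div, le_div_iff₀ hc₀, mul_comm _ c₀]
    push_cast at hsum h8
    simp only [hD, hA] at hsum h8 ⊢
    linarith

end EnergySeq

end

end GridFractal

open MeasureTheory ProbabilityTheory Filter Topology Set

namespace GridFractal

noncomputable section

/-! ### Survival probabilities of lines -/

section Survival

variable {L : ℕ} {m : Selection L → ℝ} {κ : Digit L → ℝ} {lo hi : ℝ} {h : ℝ → ℝ}

/-- The probability that the line at height `t` meets a surviving square of level `n`. -/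
def hitProb (m : Selection L → ℝ) (κ : Digit L → ℝ) (lo hi : ℝ) (n : ℕ) : ℝ → ℝ :=
  (survive m κ)^[n] ((Icc lo hi).indicator 1)

/-- A perturbation of the eigenfunction `h` of the mean operator which dominates a multiple of the
survival probabilities. -/
def bulk (κ : Digit L → ℝ) (lo hi : ℝ) (h : ℝ → ℝ) (ε : ℝ) (n : ℕ) (t : ℝ) : ℝ :=
  h t + ε * (transfer κ)^[n] ((Icc lo hi).indicator 1) t

lemma hitProb_succ (n : ℕ) :
    hitProb m κ lo hi (n + 1) = survive m κ (hitProb m κ lo hi n) :=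
  Function.iterate_succ_apply' _ _ _

lemma hitProb_mem (hm : IsUniformWeight m) (n : ℕ) (t : ℝ) :
    0 ≤ hitProb m κ lo hi n t ∧ hitProb m κ lo hi n t ≤ 1 := by
  induction n generalizing t with
  | zero =>
    simp only [hitProb, Function.iterate_zero, id_eq, indicator, Pi.one_apply]
    split_ifs <;> norm_num
  | succ n ih =>
    rw [hitProb_succ]
    exact ⟨survive_nonneg hm (fun t => (ih t).1) (fun t => (ih t).2) t,
      survive_le_one hm (fun t => (ih t).2) t⟩

lemma hitProb_succ_le (hm : IsUniformWeight m) (n : ℕ) (t : ℝ) :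
    hitProb m κ lo hi (n + 1) t ≤ transfer κ (hitProb m κ lo hi n) t := by
  rw [hitProb_succ]
  exact survive_le_transfer hm (fun t => (hitProb_mem hm n t).1) (fun t => (hitProb_mem hm n t).2) t

lemma hitProb_le_iterate (hm : IsUniformWeight m) (n : ℕ) (t : ℝ) :
    hitProb m κ lo hi n t ≤ (transfer κ)^[n] ((Icc lo hi).indicator 1) t := by
  induction n generalizing t with
  | zero => exact le_rfl
  | succ n ih =>
    rw [Function.iterate_succ_apply']
    exact (hitProb_succ_le hm n t).trans (transfer_mono ih t)

lemma measurable_hitProb (n : ℕ) : Measurable (hitProb m κ lo hi n) := by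
  induction n with
  | zero => exact measurable_one.indicator measurableSet_Icc
  | succ n ih => rw [hitProb_succ]; exact measurable_survive ih

lemma isNice_indicator : IsNice (Icc lo hi) ((Icc lo hi).indicator 1) :=
  ⟨measurable_one.indicator measurableSet_Icc, ⟨1, fun t => by
    simp only [indicator, Pi.one_apply]; split_ifs <;> simp⟩, fun t ht => by simp [ht]⟩

lemma indicator_one_nonneg (t : ℝ) : 0 ≤ (Icc lo hi).indicator (1 : ℝ → ℝ) t :=
  indicator_nonneg (fun _ _ => zero_le_one) t

lemma iterate_transfer_nonneg {p : ℝ → ℝ} (hp : ∀ t, 0 ≤ p t) (n : ℕ) (t : ℝ) :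
    0 ≤ (transfer κ)^[n] p t := by
  induction n generalizing t with
  | zero => exact hp t
  | succ n ih => rw [Function.iterate_succ_apply']; exact transfer_nonneg ih t

lemma bulk_succ (S : LineSystem κ lo hi h) (ε : ℝ) (n : ℕ) :
    bulk κ lo hi h ε (n + 1) = transfer κ (bulk κ lo hi h ε n) := by
  ext t
  unfold bulk
  rw [transfer_add, transfer_const_mul, S.transfer_eq, Function.iterate_succ_apply']

lemma le_bulk {ε : ℝ} (hε : 0 ≤ ε) (n : ℕ) (t : ℝ) : h t ≤ bulk κ lo hi h ε n t :=
  le_add_of_nonneg_right (mul_nonneg hε (iterate_transfer_nonneg indicator_one_nonneg n t))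

/-- The constant 20 is the chord bound 2 plus the bound 18 on the iterates, with ε at most 1. -/
lemma bulk_le (S : LineSystem κ lo hi h) {ε : ℝ} (hε : 0 ≤ ε) (hε1 : ε ≤ 1) (n : ℕ) (t : ℝ) :
    bulk κ lo hi h ε n t ≤ 20 := by
  have h1 := S.iterate_le n t
  have h2 := S.le_two t
  have h3 := iterate_transfer_nonneg (κ := κ) (indicator_one_nonneg (lo := lo) (hi := hi)) n t
  unfold bulk
  nlinarith

lemma bulk_nice (S : LineSystem κ lo hi h) (ε : ℝ) (n : ℕ) :
    IsNice (Icc lo hi) (bulk κ lo hi h ε n) :=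
  S.nice.add ((isNice_indicator.iterate_transfer S n).const_mul ε)

lemma integral_bulk (S : LineSystem κ lo hi h) (ε : ℝ) (n : ℕ) :
    ∫ t, bulk κ lo hi h ε n t = 1 + ε * (hi - lo) := by
  have hI := (isNice_indicator (lo := lo) (hi := hi)).iterate_transfer S n
  unfold bulk
  rw [integral_add S.nice.integrable (hI.const_mul ε).integrable, integral_const_mul,
    integral_iterate_transfer S isNice_indicator, S.integral_eq, integral_indicator_one
      measurableSet_Icc, Real.volume_real_Icc_of_le S.width_nonneg]

lemma hitProb_le_bulk (S : LineSystem κ lo hi h) (hm : IsUniformWeight m) {ε : ℝ} (hε : 0 < ε)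
    (n : ℕ) (t : ℝ) : hitProb m κ lo hi n t ≤ ε⁻¹ * bulk κ lo hi h ε n t := by
  rw [le_inv_mul_iff₀ hε]
  have := mul_le_mul_of_nonneg_left (hitProb_le_iterate (κ := κ) (lo := lo) (hi := hi) hm n t) hε.le
  unfold bulk
  linarith [S.nonneg t]

lemma energySeq_hitProb (S : LineSystem κ lo hi h) (hm : IsUniformWeight m) {ε : ℝ} (hε : 0 < ε)
    (hε1 : ε ≤ 1) :
    EnergySeq κ lo hi (bulk κ lo hi h ε) (hitProb m κ lo hi) 20 ε⁻¹ where
  b_nice := bulk_nice S ε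
  b_nonneg n t := (S.nonneg t).trans (le_bulk hε.le n t)
  b_le := bulk_le S hε.le hε1
  b_succ := bulk_succ S ε
  w_meas := measurable_hitProb
  w_nonneg n t := (hitProb_mem hm n t).1
  w_le := hitProb_le_bulk S hm hε
  w_succ := hitProb_succ_le hm

lemma hitProb_nice (S : LineSystem κ lo hi h) (hm : IsUniformWeight m) (n : ℕ) :
    IsNice (Icc lo hi) (hitProb m κ lo hi n) :=
  (energySeq_hitProb S hm one_pos le_rfl).w_nice n

/-- The length of the projection of a level `n` approximation, in the mean. -/
def meanLength (m : Selection L → ℝ) (κ : Digit L → ℝ) (lo hi : ℝ) (n : ℕ) : ℝ :=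
  ∫ t, hitProb m κ lo hi n t

lemma meanLength_nonneg (hm : IsUniformWeight m) (n : ℕ) : 0 ≤ meanLength m κ lo hi n :=
  integral_nonneg fun t => (hitProb_mem hm n t).1

lemma meanLength_antitone (S : LineSystem κ lo hi h) (hm : IsUniformWeight m) :
    Antitone (meanLength m κ lo hi) := antitone_nat_of_succ_le fun n => by
  unfold meanLength
  rw [← integral_transfer S (hitProb_nice S hm n)]
  exact integral_mono (hitProb_nice S hm _).integrable ((hitProb_nice S hm n).transfer S).integrable
    (hitProb_succ_le hm n)

lemma meanLength_zero (S : LineSystem κ lo hi h) : meanLength m κ lo hi 0 = hi - lo := by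
  simp only [meanLength, hitProb, Function.iterate_zero, id_eq]
  rw [integral_indicator_one measurableSet_Icc, Real.volume_real_Icc_of_le S.width_nonneg]

lemma hitProb_loss (S : LineSystem κ lo hi h) (hm : IsUniformWeight m) (n : ℕ) (t : ℝ) :
    hitProb m κ lo hi (n + 1) t ≤ transfer κ (hitProb m κ lo hi n) t -
      ((L : ℝ) ^ 4)⁻¹ * pairing m κ (hitProb m κ lo hi n) (hitProb m κ lo hi n) t := by
  rw [hitProb_succ]
  exact survive_le_transfer_sub hm (by exact_mod_cast S.pos) (fun t => (hitProb_mem hm n t).1)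
    (fun t => (hitProb_mem hm n t).2) t

/-- Cauchy-Schwarz without square roots: the quadratic polynomial ∫ (x² k - 2 x f + g) in x is
nonnegative, so its discriminant is not positive. -/
lemma sq_integral_le_of_sq_le {lo hi : ℝ} {f g k : ℝ → ℝ}
    (hf : IsNice (Icc lo hi) f) (hg : IsNice (Icc lo hi) g) (hk : IsNice (Icc lo hi) k)
    (hg0 : ∀ t, 0 ≤ g t) (hk0 : ∀ t, 0 ≤ k t) (h : ∀ t, f t ^ 2 ≤ g t * k t) :
    (∫ t, f t) ^ 2 ≤ (∫ t, g t) * ∫ t, k t := by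
  have key : ∀ x : ℝ, 0 ≤ (∫ t, k t) * (x * x) + (-2 * ∫ t, f t) * x + ∫ t, g t := by
    intro x
    have e : (∫ t, k t) * (x * x) + (-2 * ∫ t, f t) * x + ∫ t, g t =
        ∫ t, ((x * x) * k t + ((-2 * x) * f t + g t)) := by
      rw [integral_add (hk.const_mul _).integrable ((hf.const_mul _).add hg).integrable,
        integral_add (hf.const_mul _).integrable hg.integrable, integral_const_mul,
        integral_const_mul]
      ring
    rw [e]
    refine integral_nonneg fun t => ?_
    have h1 := h t
    have h2 : 0 ≤ (x * x) * k t := mul_nonneg (mul_self_nonneg x) (hk0 t)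
    have h3 : (2 * x * f t) ^ 2 ≤ (x * x * k t + g t) ^ 2 := by
      nlinarith [mul_le_mul_of_nonneg_left h1 (mul_self_nonneg x), sq_nonneg (x * x * k t - g t)]
    have h4 := abs_le_of_sq_le_sq h3 (add_nonneg h2 (hg0 t))
    simp only [Pi.zero_apply]
    linarith [(abs_le.1 h4).2]
  have := discrim_le_zero key
  unfold discrim at this
  nlinarith

/-- Cauchy-Schwarz against the bulk, whose integral tends to 1 with ε. Thus the square of the mean
length is dominated by the energy asymptotically without loss of constant. -/
lemma sq_meanLength_le (S : LineSystem κ lo hi h) (hm : IsUniformWeight m) {ε : ℝ} (hε : 0 < ε)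
    (hε1 : ε ≤ 1) (n : ℕ) : meanLength m κ lo hi n ^ 2 ≤
      (∫ t, energy (bulk κ lo hi h ε) (hitProb m κ lo hi) n t) * (1 + ε * (hi - lo)) := by
  have W := energySeq_hitProb S hm hε hε1
  rw [← integral_bulk S ε n]
  refine sq_integral_le_of_sq_le (W.w_nice n) (W.energy_nice n) (W.b_nice n)
    (W.energy_nonneg n) (W.b_nonneg n) fun t => ?_
  by_cases h0 : bulk κ lo hi h ε n t = 0
  · simp [h0, W.w_eq_zero h0]
  · rw [energy, div_mul_cancel₀ _ h0]

/-- The a priori bounds on the mean lengths and energies. The constant depends only on `L` and on the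
quality of the mixing. -/
theorem exists_meanLength_bound (L i : ℕ) {c₀ : ℝ} (hc₀ : 0 < c₀) : ∃ C : ℝ, 0 < C ∧
    ∀ (m : Selection L → ℝ) (κ : Digit L → ℝ) (lo hi : ℝ) (h : ℝ → ℝ),
      LineSystem κ lo hi h → IsUniformWeight m →
      (∀ t ∈ Icc lo hi, c₀ ≤ (cotransfer κ)^[i] (pairDensity m κ h) t) →
      ∀ n : ℕ, n * meanLength m κ lo hi n ≤ C ∧
        (n : ℝ) ^ 2 * (∫ t, energy (bulk κ lo hi h 1) (hitProb m κ lo hi) n t) ≤ C := by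
  set C₃ : ℝ := ((L : ℝ) ^ 4 + (2 * (L : ℝ) ^ 2 + (L : ℝ) ^ 2 * 20) * (i + 1) * 1) / c₀ with hC₃
  have hC₃0 : 0 ≤ C₃ := by positivity
  -- Chosen so that the induction from n / 2 to n closes: it yields (n a n)² ≤ 24 C₃ C₁ ≤ C₁². The
  -- summand 3 covers n < 2, since the width of the projection is at most 3.
  set C₁ : ℝ := 24 * C₃ + 3 with hC₁
  have hC₁0 : 0 < C₁ := by positivity
  refine ⟨C₁ + 6 * C₃ * C₁, by positivity, fun m κ lo hi h S hm hmix n => ?_⟩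
  have W := energySeq_hitProb S hm one_pos le_rfl
  rw [inv_one] at W
  have sum_le := W.sum_energy_le S hm (fun n t => le_bulk zero_le_one n t) zero_le_one hc₀ hmix
    (hitProb_loss S hm)
  set a := meanLength m κ lo hi with ha
  set D : ℕ → ℝ := fun n => ∫ t, energy (bulk κ lo hi h 1) (hitProb m κ lo hi) n t with hD
  have hD0 : ∀ n, 0 ≤ D n := W.integral_energy_nonneg
  have hDanti : Antitone D := W.integral_energy_antitone S
  have haanti : Antitone a := meanLength_antitone S hm
  have ha0 : ∀ n, 0 ≤ a n := meanLength_nonneg hm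
  have haD : ∀ n, a n ^ 2 ≤ 4 * D n := fun n => by
    have := sq_meanLength_le S hm one_pos le_rfl n
    have h3 := S.width_le
    have : a n ^ 2 ≤ D n * (1 + 1 * (hi - lo)) := this
    nlinarith [hD0 n]
  -- The energies decrease, so the sum over a block is at least its length times the last energy.
  have hblock : ∀ M N : ℕ, M ≤ N → ((N : ℝ) - M) * D N ≤ C₃ * a M := by
    intro M N hMN
    refine le_trans ?_ (sum_le M N)
    calc ((N : ℝ) - M) * D N = ∑ n ∈ Finset.Ico M N, D N := by
          simp [Nat.cast_sub hMN]
      _ ≤ _ := Finset.sum_le_sum fun n hn => hDanti (Finset.mem_Ico.1 hn).2.le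
  have half : ∀ n : ℕ, 2 ≤ n → 1 ≤ n / 2 ∧ n / 2 < n ∧ (n : ℝ) ≤ 3 * ((n / 2 : ℕ) : ℝ) ∧
      (n : ℝ) ≤ 2 * ((n : ℝ) - ((n / 2 : ℕ) : ℝ)) := by
    intro n hn
    refine ⟨by omega, by omega, by exact_mod_cast (by omega : n ≤ 3 * (n / 2)), ?_⟩
    have : 2 * ((n / 2 : ℕ) : ℝ) ≤ n := by exact_mod_cast (by omega : 2 * (n / 2) ≤ n)
    linarith
  have ha1 : ∀ n : ℕ, n * a n ≤ C₁ := by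
    intro n
    induction n using Nat.strong_induction_on with
    | _ n ih =>
      rcases lt_or_ge n 2 with hn | hn
      · have h0 : a n ≤ 3 := (haanti (Nat.zero_le n)).trans
          (by rw [ha, meanLength_zero S]; exact S.width_le)
        have h1 : (n : ℝ) ≤ 1 := by exact_mod_cast (by omega : n ≤ 1)
        nlinarith [ha0 n]
      · obtain ⟨h1, h2, h3, h4⟩ := half n hn
        have ihM := ih (n / 2) h2
        have hb := hblock (n / 2) n h2.le
        set M : ℝ := ((n / 2 : ℕ) : ℝ)
        have hn0 : (0 : ℝ) < n := by exact_mod_cast (by omega : 0 < n)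
        have hb1 : n * D n ≤ 2 * (C₃ * a (n / 2)) := by nlinarith [hD0 n]
        have hb2 : n * a (n / 2) ≤ 3 * C₁ := by nlinarith [ha0 (n / 2)]
        have hb3 : (n * a n) ^ 2 ≤ C₁ ^ 2 := by
          have e1 : (n * a n) ^ 2 ≤ n * (4 * (n * D n)) := by
            have := haD n
            have : (n : ℝ) ^ 2 * a n ^ 2 ≤ n ^ 2 * (4 * D n) := by gcongr
            nlinarith
          have e2 : n * (4 * (n * D n)) ≤ n * (4 * (2 * (C₃ * a (n / 2)))) := by gcongr
          have e3 : C₃ * (n * a (n / 2)) ≤ C₃ * (3 * C₁) := mul_le_mul_of_nonneg_left hb2 hC₃0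
          have e4 : 24 * C₃ * C₁ ≤ C₁ * C₁ := mul_le_mul_of_nonneg_right (by linarith) hC₁0.le
          nlinarith
        exact le_of_sq_le_sq hb3 hC₁0.le
  refine ⟨(ha1 n).trans (by nlinarith [mul_nonneg hC₃0 hC₁0.le]), ?_⟩
  rcases lt_or_ge n 2 with hn | hn
  · have h1 : (n : ℝ) ≤ 1 := by exact_mod_cast (by omega : n ≤ 1)
    have h1' : (n : ℝ) ^ 2 ≤ 1 := by nlinarith [Nat.cast_nonneg (α := ℝ) n]
    have h2 : D n ≤ 3 := by
      have e1 : D n ≤ D 0 := hDanti (Nat.zero_le n)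
      have e2 : D 0 ≤ 1 * a 0 := by
        simp only [hD, ha, meanLength]
        rw [← integral_const_mul]
        exact integral_mono (W.energy_nice 0).integrable ((W.w_nice 0).const_mul 1).integrable
          (W.energy_le 0)
      have e3 : a 0 ≤ 3 := by rw [ha, meanLength_zero S]; exact S.width_le
      linarith
    have := hD0 n
    change (n : ℝ) ^ 2 * D n ≤ _
    nlinarith [mul_nonneg hC₃0 hC₁0.le]
  · obtain ⟨h1, h2, h3, h4⟩ := half n hn
    have hb := hblock (n / 2) n h2.le
    have ihM := ha1 (n / 2)
    set M : ℝ := ((n / 2 : ℕ) : ℝ)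
    have hn0 : (0 : ℝ) < n := by exact_mod_cast (by omega : 0 < n)
    have hb1 : n * D n ≤ 2 * (C₃ * a (n / 2)) := by nlinarith [hD0 n]
    have hb2 : n * a (n / 2) ≤ 3 * C₁ := by nlinarith [ha0 (n / 2)]
    have e2 : n * (n * D n) ≤ n * (2 * (C₃ * a (n / 2))) := by gcongr
    have e3 : C₃ * (n * a (n / 2)) ≤ C₃ * (3 * C₁) := mul_le_mul_of_nonneg_left hb2 hC₃0
    change (n : ℝ) ^ 2 * D n ≤ _
    nlinarith

/-- The decrease of the mean length in one generation is controlled by the energy. -/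
lemma meanLength_sub_succ_le (S : LineSystem κ lo hi h) (hm : IsUniformWeight m) (n : ℕ) :
    meanLength m κ lo hi n - meanLength m κ lo hi (n + 1) ≤
      10 * (L : ℝ) ^ 3 * ∫ t, energy (bulk κ lo hi h 1) (hitProb m κ lo hi) n t := by
  have W := energySeq_hitProb S hm one_pos le_rfl
  have n0 := W.w_nice n
  have hL := S.pos
  unfold meanLength
  have hsq := (n0.pow_two.transfer S).const_mul ((L : ℝ) ^ 3 / 2)
  calc (∫ t, hitProb m κ lo hi n t) - ∫ t, hitProb m κ lo hi (n + 1) t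
      = ∫ t, (transfer κ (hitProb m κ lo hi n) t - hitProb m κ lo hi (n + 1) t) := by
        rw [integral_sub (n0.transfer S).integrable (W.w_nice _).integrable, integral_transfer S n0]
    -- Bonferroni, then Cauchy-Schwarz over the L² squares; half of L² times the sum of squares is
    -- L³ / 2 times the mean operator at the square.
    _ ≤ ∫ t, (L : ℝ) ^ 3 / 2 * transfer κ (fun t => hitProb m κ lo hi n t ^ 2) t := by
        refine integral_mono ((n0.transfer S).sub (W.w_nice _)).integrable hsq.integrable
          fun t => ?_
        simp only
        rw [hitProb_succ]
        refine (transfer_sub_survive_le hm (fun t => (hitProb_mem hm n t).1)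
          (fun t => (hitProb_mem hm n t).2) t).trans ?_
        set x : Digit L → ℝ := fun q => hitProb m κ lo hi n (L * t - κ q) with hx
        have e1 : pairing m κ (hitProb m κ lo hi n) (hitProb m κ lo hi n) t ≤
            (∑ q, x q) ^ 2 := by
          rw [sq, Finset.sum_mul_sum]
          refine Finset.sum_le_sum fun q _ => Finset.sum_le_sum fun q' _ => ?_
          have h0 : 0 ≤ x q * x q' := mul_nonneg (hitProb_mem hm n _).1 (hitProb_mem hm n _).1
          exact mul_le_of_le_one_left h0 (pairProb_le_one hm q q')
        have e2 : (∑ q, x q) ^ 2 ≤ (L : ℝ) ^ 2 * ∑ q, x q ^ 2 := by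
          rw [← card_digit]; exact sq_sum_le_card_mul_sum_sq
        have e3 : (L : ℝ) ^ 3 / 2 * transfer κ (fun t => hitProb m κ lo hi n t ^ 2) t =
            (L : ℝ) ^ 2 * (∑ q, x q ^ 2) / 2 := by
          simp only [transfer, hx]; field_simp
        rw [e3]; linarith
    _ = (L : ℝ) ^ 3 / 2 * ∫ t, hitProb m κ lo hi n t ^ 2 := by
        rw [integral_const_mul, integral_transfer S n0.pow_two]
    _ ≤ (L : ℝ) ^ 3 / 2 * ∫ t, 20 * energy (bulk κ lo hi h 1) (hitProb m κ lo hi) n t := by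
        refine mul_le_mul_of_nonneg_left ?_ (by positivity)
        exact integral_mono n0.pow_two.integrable ((W.energy_nice n).const_mul 20).integrable
          (W.sq_le_energy n)
    _ = _ := by rw [integral_const_mul]; ring

end Survival

end

end GridFractal

open MeasureTheory ProbabilityTheory Filter Topology Set

namespace GridFractal

noncomputable section

/-! ### The lower bound for the mean lengths -/

section Lower

variable {L : ℕ} {m : Selection L → ℝ} {κ : Digit L → ℝ} {lo hi : ℝ} {h : ℝ → ℝ}

lemma sum_pairProb_symm (a b : Digit L → Digit L → ℝ) (hab : ∀ q q', a q q' + a q' q = b q q') :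
    ∑ q, ∑ q', pairProb m q q' * a q q' = (∑ q, ∑ q', pairProb m q q' * b q q') / 2 := by
  have sw : ∑ q, ∑ q', pairProb m q q' * a q q' = ∑ q, ∑ q', pairProb m q q' * a q' q := by
    rw [Finset.sum_comm]
    refine Finset.sum_congr rfl fun q _ => Finset.sum_congr rfl fun q' _ => ?_
    rw [pairProb_comm]
  have : ∑ q, ∑ q', pairProb m q q' * b q q' =
      ∑ q, ∑ q', pairProb m q q' * a q q' + ∑ q, ∑ q', pairProb m q q' * a q' q := by
    simp only [← Finset.sum_add_distrib, ← mul_add, hab]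
  rw [this, ← sw]; ring

/-- The survival of one of finitely many particles, with competing weights `F`. -/
lemma sq_sum_le_of_clock (hm : IsUniformWeight m) (hL : 0 < L) {η F : Digit L → ℝ}
    (hη : ∀ q, 0 ≤ η q) (hη2 : ∀ q, η q ≤ 2) (hF : ∀ q, 4 * (L : ℝ) ^ 2 ≤ F q) :
    ((L : ℝ)⁻¹ * ∑ q, η q) ^ 2 ≤
      ((L : ℝ)⁻¹ * ∑ q, η q / F q -
        (∑ q, ∑ q', pairProb m q q' * (η q / F q * (η q' / F q'))) / 2) *
      ((L : ℝ)⁻¹ * ∑ q, η q * F q + (∑ q, ∑ q', pairProb m q q' * (η q * η q')) / 2 +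
        8 * (L : ℝ) ^ 4 * ((L : ℝ)⁻¹ * ∑ q, η q / F q)) := by
  have hL' : (0 : ℝ) < L := by exact_mod_cast hL
  have hF0 : ∀ q, 0 < F q := fun q => lt_of_lt_of_le (by positivity) (hF q)
  -- Each pair term is shared between its two members in the proportions F / (F + F') and F' / (F +
  -- F'), which add up to 1. Symmetrizing therefore turns the discount by `G` into the pair sum of η
  -- / F in the first factor (`e1`) and into that of η in the second (`e2`).
  set G : Digit L → ℝ := fun q => L * ∑ q', pairProb m q q' * (η q' / (F q + F q')) with hG
  have hG0 : ∀ q, 0 ≤ G q := fun q => mul_nonneg hL'.le (Finset.sum_nonneg fun q' _ =>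
    mul_nonneg (pairProb_nonneg hm _ _) (div_nonneg (hη q') (add_pos (hF0 q) (hF0 q')).le))
  have hGF : ∀ q, G q * F q ≤ 2 * (L : ℝ) ^ 2 := by
    intro q
    have h1 : ∀ q', pairProb m q q' * (η q' / (F q + F q')) ≤ (L : ℝ)⁻¹ * (2 / F q) := by
      intro q'
      refine mul_le_mul (pairProb_le hm _ _) ?_
        (div_nonneg (hη q') (add_pos (hF0 q) (hF0 q')).le) (by positivity)
      exact div_le_div₀ (by norm_num) (hη2 q') (hF0 q) (by linarith [hF0 q'])
    have h2 : G q ≤ L * ∑ q' : Digit L, (L : ℝ)⁻¹ * (2 / F q) :=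
      mul_le_mul_of_nonneg_left (Finset.sum_le_sum fun q' _ => h1 q') hL'.le
    rw [Finset.sum_const, nsmul_eq_mul, card_digit] at h2
    calc G q * F q ≤ (L * ((L : ℝ) ^ 2 * ((L : ℝ)⁻¹ * (2 / F q)))) * F q :=
          mul_le_mul_of_nonneg_right h2 (hF0 q).le
      _ = _ := by have := (hF0 q).ne'; field_simp
  have hGhalf : ∀ q, G q ≤ 1 / 2 := by
    intro q
    have h1 := hGF q
    have h2 := mul_le_mul_of_nonneg_left (hF q) (hG0 q)
    have : 0 < (L : ℝ) ^ 2 := by positivity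
    nlinarith
  -- Here η is split as the geometric mean of (η / F)(1 - G) and η F / (1 - G). The hypothesis F ≥ 4
  -- L² serves to keep G at most 1/2.
  have CS : (∑ q, η q) ^ 2 ≤ (∑ q, η q / F q * (1 - G q)) * ∑ q, η q * F q / (1 - G q) := by
    refine Finset.sum_sq_le_sum_mul_sum_of_sq_le_mul _ (fun q _ => ?_) (fun q _ => ?_)
      fun q _ => le_of_eq ?_
    · exact mul_nonneg (div_nonneg (hη q) (hF0 q).le) (by linarith [hGhalf q])
    · exact div_nonneg (mul_nonneg (hη q) (hF0 q).le) (by linarith [hGhalf q])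
    · have h1 : 1 - G q ≠ 0 := by linarith [hGhalf q]
      have h2 := (hF0 q).ne'
      field_simp
  have e1 : (L : ℝ)⁻¹ * ∑ q, η q / F q * (1 - G q) = (L : ℝ)⁻¹ * ∑ q, η q / F q -
      (∑ q, ∑ q', pairProb m q q' * (η q / F q * (η q' / F q'))) / 2 := by
    rw [← sum_pairProb_symm (fun q q' => η q / F q * (η q' / (F q + F q')))]
    · simp only [mul_sub, mul_one, Finset.sum_sub_distrib]
      congr 1
      rw [Finset.mul_sum]
      refine Finset.sum_congr rfl fun q _ => ?_
      simp only [hG]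
      rw [Finset.mul_sum, Finset.mul_sum, Finset.mul_sum]
      refine Finset.sum_congr rfl fun q' _ => ?_
      field_simp
    · intro q q'
      have h1 := (hF0 q).ne'
      have h2 := (hF0 q').ne'
      have h3 := (add_pos (hF0 q) (hF0 q')).ne'
      have h4 := (add_pos (hF0 q') (hF0 q)).ne'
      field_simp
      ring
  have e2 : (L : ℝ)⁻¹ * ∑ q, η q * F q * G q =
      (∑ q, ∑ q', pairProb m q q' * (η q * η q')) / 2 := by
    rw [← sum_pairProb_symm (fun q q' => η q * F q * (η q' / (F q + F q')))]
    · rw [Finset.mul_sum]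
      refine Finset.sum_congr rfl fun q _ => ?_
      simp only [hG]
      rw [Finset.mul_sum, Finset.mul_sum, Finset.mul_sum]
      refine Finset.sum_congr rfl fun q' _ => ?_
      field_simp
    · intro q q'
      have h3 := (add_pos (hF0 q) (hF0 q')).ne'
      have h4 := (add_pos (hF0 q') (hF0 q)).ne'
      field_simp
      ring
  -- For 0 ≤ G ≤ 1/2 one has 1 / (1 - G) ≤ 1 + G + 2 G². The quadratic term is an error of size η /
  -- F because G F ≤ 2 L², and 2 (2 L²)² = 8 L⁴.
  have e3 : ∀ q, η q * F q / (1 - G q) ≤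
      η q * F q + η q * F q * G q + 8 * (L : ℝ) ^ 4 * (η q / F q) := by
    intro q
    have h0 : 0 ≤ η q * F q := mul_nonneg (hη q) (hF0 q).le
    have h1 : (1 - G q)⁻¹ ≤ 1 + G q + 2 * G q ^ 2 := by
      rw [inv_le_iff_one_le_mul₀ (by linarith [hGhalf q])]
      nlinarith [hGhalf q, hG0 q, sq_nonneg (G q), mul_nonneg (sq_nonneg (G q))
        (sub_nonneg.2 (hGhalf q))]
    have h2 : η q * F q * (2 * G q ^ 2) ≤ 8 * (L : ℝ) ^ 4 * (η q / F q) := by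
      have h3 : (G q * F q) ^ 2 ≤ (2 * (L : ℝ) ^ 2) ^ 2 :=
        pow_le_pow_left₀ (mul_nonneg (hG0 q) (hF0 q).le) (hGF q) 2
      have h4 : η q * F q * (2 * G q ^ 2) = 2 * (G q * F q) ^ 2 * (η q / F q) := by
        have := (hF0 q).ne'
        field_simp
      rw [h4]
      refine mul_le_mul_of_nonneg_right ?_ (div_nonneg (hη q) (hF0 q).le)
      nlinarith
    rw [div_eq_mul_inv]
    have := mul_le_mul_of_nonneg_left h1 h0
    linarith
  have e4 : (L : ℝ)⁻¹ * ∑ q, η q * F q / (1 - G q) ≤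
      (L : ℝ)⁻¹ * ∑ q, η q * F q + (∑ q, ∑ q', pairProb m q q' * (η q * η q')) / 2 +
        8 * (L : ℝ) ^ 4 * ((L : ℝ)⁻¹ * ∑ q, η q / F q) := by
    rw [← e2]
    have := mul_le_mul_of_nonneg_left (Finset.sum_le_sum fun q (_ : q ∈ Finset.univ) => e3 q)
      (inv_nonneg.2 hL'.le)
    simp only [Finset.sum_add_distrib, ← Finset.mul_sum] at this
    linarith
  rw [← e1]
  refine le_trans ?_ (mul_le_mul_of_nonneg_left e4 ?_)
  · calc ((L : ℝ)⁻¹ * ∑ q, η q) ^ 2 = (L : ℝ)⁻¹ * (L : ℝ)⁻¹ * (∑ q, η q) ^ 2 := by ring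
      _ ≤ (L : ℝ)⁻¹ * (L : ℝ)⁻¹ *
          ((∑ q, η q / F q * (1 - G q)) * ∑ q, η q * F q / (1 - G q)) :=
        mul_le_mul_of_nonneg_left CS (by positivity)
      _ = _ := by ring
  · exact mul_nonneg (by positivity) (Finset.sum_nonneg fun q _ =>
      mul_nonneg (div_nonneg (hη q) (hF0 q).le) (by linarith [hGhalf q]))

/-- A sequence of functions `H n` with `h ^ 2 / H n` a lower bound for the survival probability. -/
def reciprocalBound (m : Selection L → ℝ) (κ : Digit L → ℝ) (h : ℝ → ℝ) : ℕ → ℝ → ℝ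
  | 0 => fun t => 4 * (L : ℝ) ^ 2 * h t
  | n + 1 => fun t => transfer κ (reciprocalBound m κ h n) t + pairing m κ h h t / 2 +
      8 * (L : ℝ) ^ 4 * transfer κ (fun t => h t ^ 2 / reciprocalBound m κ h n t) t

lemma le_reciprocalBound (S : LineSystem κ lo hi h) (hm : IsUniformWeight m) (n : ℕ) (t : ℝ) :
    4 * (L : ℝ) ^ 2 * h t ≤ reciprocalBound m κ h n t := by
  induction n generalizing t with
  | zero => exact le_rfl
  | succ n ih =>
    have h1 := transfer_mono (κ := κ) ih t
    rw [transfer_const_mul, S.transfer_eq] at h1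
    have h2 := pairing_nonneg (κ := κ) hm S.nonneg S.nonneg t
    have h3 : 0 ≤ transfer κ (fun t => h t ^ 2 / reciprocalBound m κ h n t) t :=
      transfer_nonneg (fun t => div_nonneg (sq_nonneg _)
        (le_trans (mul_nonneg (by positivity) (S.nonneg t)) (ih t))) t
    have h4 : 0 ≤ 8 * (L : ℝ) ^ 4 * transfer κ (fun t => h t ^ 2 / reciprocalBound m κ h n t) t :=
      mul_nonneg (by positivity) h3
    simp only [reciprocalBound]
    linarith

lemma reciprocalBound_nonneg (S : LineSystem κ lo hi h) (hm : IsUniformWeight m) (n : ℕ) (t : ℝ) :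
    0 ≤ reciprocalBound m κ h n t :=
  le_trans (mul_nonneg (by positivity) (S.nonneg t)) (le_reciprocalBound S hm n t)

lemma sq_div_reciprocalBound_le (S : LineSystem κ lo hi h) (hm : IsUniformWeight m) (n : ℕ)
    (t : ℝ) : h t ^ 2 / reciprocalBound m κ h n t ≤ (4 * (L : ℝ) ^ 2)⁻¹ * h t := by
  have hL := S.pos
  rcases (S.nonneg t).eq_or_lt with h0 | h0
  · simp [← h0]
  · have h1 := le_reciprocalBound S hm n t
    rw [div_le_iff₀ (lt_of_lt_of_le (by positivity) h1)]
    calc h t ^ 2 = (4 * (L : ℝ) ^ 2)⁻¹ * h t * (4 * (L : ℝ) ^ 2 * h t) := by field_simp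
      _ ≤ _ := by gcongr

lemma reciprocalBound_nice (S : LineSystem κ lo hi h) (hm : IsUniformWeight m) (n : ℕ) :
    IsNice (Icc lo hi) (reciprocalBound m κ h n) ∧
      IsNice (Icc lo hi) fun t => h t ^ 2 / reciprocalBound m κ h n t := by
  have aux : ∀ n, IsNice (Icc lo hi) (reciprocalBound m κ h n) →
      IsNice (Icc lo hi) fun t => h t ^ 2 / reciprocalBound m κ h n t := fun n hn =>
    S.nice.of_le ((S.nice.measurable.pow_const 2).div hn.measurable)
      (fun t => div_nonneg (sq_nonneg _) (reciprocalBound_nonneg S hm n t))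
      (sq_div_reciprocalBound_le S hm n)
  induction n with
  | zero => exact ⟨S.nice.const_mul _, aux 0 (S.nice.const_mul _)⟩
  | succ n ih =>
    have : IsNice (Icc lo hi) (reciprocalBound m κ h (n + 1)) := by
      simp only [reciprocalBound, div_eq_inv_mul (pairing _ _ _ _ _)]
      exact ((ih.1.transfer S).add ((S.nice.pairing S S.nice).const_mul _)).add
        ((ih.2.transfer S).const_mul _)
    exact ⟨this, aux _ this⟩

/-- By induction h² / H_n is a lower bound for p_n, which may replace p_n inside the monotone
`survive`. Then `sq_sum_le_of_clock`, with η the chords in the squares of the first level and F =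
H_n / h there, is exactly the next step of the recursion for H_n. -/
lemma sq_le_hitProb_mul (S : LineSystem κ lo hi h) (hm : IsUniformWeight m) (n : ℕ) (t : ℝ) :
    h t ^ 2 ≤ hitProb m κ lo hi n t * reciprocalBound m κ h n t := by
  have hL := S.pos
  induction n generalizing t with
  | zero =>
    by_cases ht : t ∈ Icc lo hi
    · simp only [hitProb, Function.iterate_zero, id_eq, indicator_of_mem ht, Pi.one_apply, one_mul,
        reciprocalBound]
      have h1 := S.le_two t
      have h2 := S.nonneg t
      have h3 : (1 : ℝ) ≤ L := by exact_mod_cast (by have := S.two_le; omega : 1 ≤ L)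
      nlinarith [mul_nonneg h2 (by nlinarith : 0 ≤ (L : ℝ) ^ 2 - 1)]
    · have h1 : h t = 0 := S.nice.eq_zero t ht
      rw [h1, reciprocalBound]
      simp [h1]
  | succ n ih =>
    set H := reciprocalBound m κ h n with hH
    have hH0 : ∀ t, 0 ≤ H t := reciprocalBound_nonneg S hm n
    set y : ℝ → ℝ := fun t => h t ^ 2 / H t with hy
    have hy0 : ∀ t, 0 ≤ y t := fun t => div_nonneg (sq_nonneg _) (hH0 t)
    have hyp : ∀ t, y t ≤ hitProb m κ lo hi n t := by
      intro t
      rcases (hH0 t).eq_or_lt with h0 | h0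
      · simp only [hy, ← h0, div_zero]; exact (hitProb_mem hm n t).1
      · simp only [hy]; rw [div_le_iff₀ h0]; exact ih t
    have hy1 : ∀ t, y t ≤ 1 := fun t => (hyp t).trans (hitProb_mem hm n t).2
    set η : Digit L → ℝ := fun q => h (L * t - κ q) with hη
    -- Where the chord vanishes, η F and η / F are zero whatever F is; the value 4 L² only preserves
    -- the lower bound on F.
    set F : Digit L → ℝ := fun q => if η q = 0 then 4 * (L : ℝ) ^ 2 else H (L * t - κ q) / η q
      with hF
    have hη0 : ∀ q, 0 ≤ η q := fun q => S.nonneg _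
    have hηy : ∀ q, η q / F q = y (L * t - κ q) := by
      intro q
      by_cases h0 : η q = 0
      · have h0' : h (L * t - κ q) = 0 := h0
        simp [hy, h0, h0']
      · simp only [hF, if_neg h0, hy]
        rw [div_div_eq_mul_div, ← sq]
    have hηF : ∀ q, η q * F q ≤ H (L * t - κ q) := by
      intro q
      by_cases h0 : η q = 0
      · rw [h0, zero_mul]; exact hH0 _
      · simp only [hF, if_neg h0]; rw [mul_div_cancel₀ _ h0]
    have hFge : ∀ q, 4 * (L : ℝ) ^ 2 ≤ F q := by
      intro q
      by_cases h0 : η q = 0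
      · simp [hF, h0]
      · simp only [hF, if_neg h0]
        rw [le_div_iff₀ (lt_of_le_of_ne (hη0 q) (Ne.symm h0))]
        exact le_reciprocalBound S hm n _
    have key := sq_sum_le_of_clock hm (by exact_mod_cast hL : 0 < L) hη0 (fun q => S.le_two _) hFge
    have hht : h t = (L : ℝ)⁻¹ * ∑ q, η q := by
      conv_lhs => rw [← S.transfer_eq]
      rfl
    rw [← hht] at key
    simp only [hηy] at key
    have hX : (L : ℝ)⁻¹ * ∑ q, y (L * t - κ q) - (∑ q, ∑ q', pairProb m q q' *
        (y (L * t - κ q) * y (L * t - κ q'))) / 2 ≤ hitProb m κ lo hi (n + 1) t := by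
      rw [hitProb_succ]
      refine le_trans ?_ (survive_mono hm hyp (fun t => (hitProb_mem hm n t).2) t)
      have := transfer_sub_survive_le (κ := κ) hm hy0 hy1 t
      unfold transfer pairing at this
      linarith
    refine key.trans (mul_le_mul hX ?_ ?_ (hitProb_mem hm _ _).1)
    · simp only [reciprocalBound]
      refine add_le_add (add_le_add ?_ le_rfl) le_rfl
      exact mul_le_mul_of_nonneg_left (Finset.sum_le_sum fun q _ => hηF q) (by positivity)
    · have h1 : 0 ≤ ∑ q, ∑ q', pairProb m q q' * (η q * η q') :=
        Finset.sum_nonneg fun _ _ => Finset.sum_nonneg fun _ _ =>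
          mul_nonneg (pairProb_nonneg hm _ _) (mul_nonneg (hη0 _) (hη0 _))
      have h2 : 0 ≤ ∑ q, η q * F q := Finset.sum_nonneg fun q _ =>
        mul_nonneg (hη0 q) (le_trans (by positivity) (hFge q))
      have h3 : 0 ≤ ∑ q, y (L * t - κ q) := Finset.sum_nonneg fun q _ => hy0 _
      positivity

/-- The mean operator preserves the integral, so a generation adds half of the integrated pairing
and an error, which is at most a multiple of the mean length because h² / H_n ≤ p_n. -/
lemma integral_reciprocalBound_le (S : LineSystem κ lo hi h) (hm : IsUniformWeight m) (n : ℕ) :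
    ∫ t, reciprocalBound m κ h n t ≤ 4 * (L : ℝ) ^ 2 + n * ((∫ t, pairing m κ h h t) / 2) +
      8 * (L : ℝ) ^ 4 * ∑ k ∈ Finset.range n, meanLength m κ lo hi k := by
  have hL := S.pos
  induction n with
  | zero => simp [reciprocalBound, integral_const_mul, S.integral_eq]
  | succ n ih =>
    obtain ⟨n1, n2⟩ := reciprocalBound_nice S hm n
    have n3 := (S.nice.pairing (m := m) S S.nice).const_mul 2⁻¹
    have e : ∫ t, reciprocalBound m κ h (n + 1) t = (∫ t, reciprocalBound m κ h n t) +
        (∫ t, pairing m κ h h t) / 2 +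
        8 * (L : ℝ) ^ 4 * ∫ t, h t ^ 2 / reciprocalBound m κ h n t := by
      simp only [reciprocalBound, div_eq_inv_mul (pairing _ _ _ _ _)]
      rw [integral_add ((n1.transfer S).add n3).integrable ((n2.transfer S).const_mul _).integrable,
        integral_add (n1.transfer S).integrable n3.integrable, integral_const_mul,
        integral_const_mul, integral_transfer S n1, integral_transfer S n2]
      ring
    have h1 : ∫ t, h t ^ 2 / reciprocalBound m κ h n t ≤ meanLength m κ lo hi n := by
      refine integral_mono n2.integrable (hitProb_nice S hm n).integrable fun t => ?_
      rcases (reciprocalBound_nonneg S hm n t).eq_or_lt with h0 | h0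
      · simp only [← h0, div_zero]; exact (hitProb_mem hm n t).1
      · simp only; rw [div_le_iff₀ h0]; exact sq_le_hitProb_mul S hm n t
    have h2 := mul_le_mul_of_nonneg_left h1 (by positivity : 0 ≤ 8 * (L : ℝ) ^ 4)
    rw [e, Finset.sum_range_succ]
    push_cast
    linarith

lemma one_le_meanLength_mul (S : LineSystem κ lo hi h) (hm : IsUniformWeight m) (n : ℕ) :
    1 ≤ meanLength m κ lo hi n * (4 * (L : ℝ) ^ 2 + n * ((∫ t, pairing m κ h h t) / 2) +
      8 * (L : ℝ) ^ 4 * ∑ k ∈ Finset.range n, meanLength m κ lo hi k) := by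
  have h1 := sq_integral_le_of_sq_le S.nice (hitProb_nice S hm n) (reciprocalBound_nice S hm n).1
    (fun t => (hitProb_mem hm n t).1) (reciprocalBound_nonneg S hm n) (sq_le_hitProb_mul S hm n)
  rw [S.integral_eq, one_pow] at h1
  exact h1.trans (mul_le_mul_of_nonneg_left (integral_reciprocalBound_le S hm n)
    (meanLength_nonneg hm n))

/-- Lower bound for the decay of the mean lengths. -/
theorem eventually_lt_mul_meanLength (S : LineSystem κ lo hi h) (hm : IsUniformWeight m)
    (hV : 0 < ∫ t, pairing m κ h h t) {C : ℝ} (hC : ∀ n : ℕ, n * meanLength m κ lo hi n ≤ C) {x : ℝ}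
    (hx : x < 2 / ∫ t, pairing m κ h h t) : ∀ᶠ n : ℕ in atTop, x < n * meanLength m κ lo hi n := by
  set V := ∫ t, pairing m κ h h t with hVdef
  set a := meanLength m κ lo hi with ha
  have ha0 : Tendsto a atTop (𝓝 0) := by
    refine tendsto_of_tendsto_of_tendsto_of_le_of_le' tendsto_const_nhds
      (tendsto_const_div_atTop_nhds_zero_nat C) (Eventually.of_forall (meanLength_nonneg hm)) ?_
    filter_upwards [eventually_gt_atTop 0] with n hn
    rw [le_div_iff₀ (by exact_mod_cast hn), mul_comm]
    exact hC n
  -- The accumulated error is n times a Cesàro mean of the mean lengths, which tend to 0.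
  have h1 : Tendsto (fun n : ℕ => 4 * (L : ℝ) ^ 2 / n + V / 2 + 8 * (L : ℝ) ^ 4 *
      ((n : ℝ)⁻¹ * ∑ k ∈ Finset.range n, a k)) atTop (𝓝 (0 + V / 2 + 8 * (L : ℝ) ^ 4 * 0)) :=
    ((tendsto_const_div_atTop_nhds_zero_nat _).add tendsto_const_nhds).add (ha0.cesaro.const_mul _)
  have h2 := h1.inv₀ (by positivity)
  have h3 : x < (0 + V / 2 + 8 * (L : ℝ) ^ 4 * 0)⁻¹ := by
    convert hx using 1; rw [zero_add, mul_zero, add_zero, inv_div]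
  filter_upwards [h2.eventually_const_lt h3, eventually_gt_atTop 0] with n hn hn0
  refine hn.trans_le ?_
  have hn0' : (0 : ℝ) < n := by exact_mod_cast hn0
  have hs : 0 ≤ ∑ k ∈ Finset.range n, a k := Finset.sum_nonneg fun k _ => meanLength_nonneg hm k
  have hpos : 0 < 4 * (L : ℝ) ^ 2 / n + V / 2 + 8 * (L : ℝ) ^ 4 *
      ((n : ℝ)⁻¹ * ∑ k ∈ Finset.range n, a k) := by positivity
  rw [inv_le_iff_one_le_mul₀ hpos]
  refine (one_le_meanLength_mul S hm n).trans (le_of_eq ?_)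
  rw [← ha, ← hVdef]
  field_simp

end Lower

end

end GridFractal

open MeasureTheory ProbabilityTheory Filter Topology Set

namespace GridFractal

noncomputable section

/-! ### The upper bound for the mean lengths -/

/-- A discrete form of a' ≤ -v a². Let A be the limsup of n a n, take N + i nearly attaining it, and
compare with M ≈ N / l for fixed l > 1. After multiplication by N the hypothesis becomes A + β (1 -
1/l) A² ≤ A l, that is β A ≤ l; the error C' / M² is negligible against 1 / N. Then l → 1 and β → v.
-/
lemma limit_le_of_quadratic_decrease {a : ℕ → ℝ} (ha0 : ∀ n, 0 ≤ a n) (hanti : Antitone a) {C v : ℝ}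
    (hv : 0 < v) (hC : ∀ n : ℕ, n * a n ≤ C)
    (hdec : ∀ β, 0 < β → β < v → ∃ (i : ℕ) (C' : ℝ), ∀ M N : ℕ, 1 ≤ M → M ≤ N →
      a (N + i) + β * (((N : ℝ) - M) * a N ^ 2) - C' / (M : ℝ) ^ 2 ≤ a M) {x : ℝ}
    (hx : 1 / v < x) : ∀ᶠ n : ℕ in atTop, n * a n < x := by
  set u : ℕ → ℝ := fun n => n * a n with hu
  have hu0 : ∀ n, 0 ≤ u n := fun n => mul_nonneg (Nat.cast_nonneg n) (ha0 n)
  have hbdd : IsBoundedUnder (· ≤ ·) atTop u := isBoundedUnder_of ⟨C, hC⟩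
  have hbdd' : IsCoboundedUnder (· ≤ ·) atTop u :=
    (isBoundedUnder_of ⟨0, hu0⟩ : IsBoundedUnder (· ≥ ·) atTop u).isCoboundedUnder_le
  set A := limsup u atTop with hA
  suffices hAv : A ≤ 1 / v from eventually_lt_of_limsup_lt (hAv.trans_lt hx) hbdd
  rcases le_or_gt A 0 with hA0 | hA0
  · exact hA0.trans (by positivity)
  have main : ∀ β, 0 < β → β < v → ∀ l : ℝ, 1 < l → β * A ≤ l := by
    intro β hβ hβv l hl
    obtain ⟨i, C', hC'⟩ := hdec β hβ hβv
    have hl0 : 0 < l := by linarith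
    have step : ∀ e, 0 < e → e < A →
        0 ≤ (A + e) * l - ((A - e) + β * ((1 - l⁻¹) * (A - e) ^ 2)) := by
      intro e he heA
      have ev : ∀ᶠ n in atTop, u n < A + e :=
        eventually_lt_of_limsup_lt (by linarith) hbdd
      -- Near maximality is needed at N + i, where the hypothesis evaluates the smaller term; since
      -- `a` decreases, the same lower bound holds for `a N`.
      have fr : ∃ᶠ n in atTop, A - e < u (n + i) := by
        have := frequently_lt_of_lt_limsup hbdd' (by linarith : A - e < limsup u atTop)
        rw [← map_add_atTop_eq_nat i, frequently_map] at this
        exact this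
      set M : ℕ → ℕ := fun N => ⌊(N : ℝ) / l⌋₊ with hM
      have hNl : Tendsto (fun N : ℕ => (N : ℝ) / l) atTop atTop :=
        tendsto_natCast_atTop_atTop.atTop_div_const hl0
      have hMtop : Tendsto M atTop atTop := tendsto_nat_floor_atTop.comp hNl
      have r1 : Tendsto (fun N : ℕ => (N : ℝ) / (M N : ℝ)) atTop (𝓝 l) := by
        have h1 := (tendsto_nat_floor_div_atTop (R := ℝ)).comp hNl
        have h2 := (h1.inv₀ one_ne_zero).mul_const l
        simp only [inv_one, one_mul] at h2
        refine h2.congr fun N => ?_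
        simp only [Function.comp, hM]
        rw [inv_div, div_mul_eq_mul_div, div_mul_cancel₀ _ hl0.ne']
      have r2 : Tendsto (fun N : ℕ => (N : ℝ) / ((N : ℝ) + i)) atTop (𝓝 1) :=
        tendsto_natCast_div_add_atTop (i : ℝ)
      have r3 : Tendsto (fun N : ℕ => ((M N : ℝ))⁻¹) atTop (𝓝 0) :=
        tendsto_inv_atTop_zero.comp (tendsto_natCast_atTop_atTop.comp hMtop)
      have lim : Tendsto (fun N : ℕ => (A + e) * ((N : ℝ) / M N) - ((A - e) * ((N : ℝ) / (N + i)) +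
          β * ((1 - l⁻¹) * ((A - e) * ((N : ℝ) / (N + i))) ^ 2)) +
            C' * (((N : ℝ) / M N) * (M N : ℝ)⁻¹)) atTop
          (𝓝 ((A + e) * l - ((A - e) * 1 + β * ((1 - l⁻¹) * ((A - e) * 1) ^ 2)) +
            C' * (l * 0))) :=
        ((r1.const_mul _).sub ((r2.const_mul _).add
          ((((r2.const_mul _).pow 2).const_mul _).const_mul _))).add ((r1.mul r3).const_mul _)
      have hfin := ge_of_tendsto_of_frequently lim (b := 0) ?_
      · simpa using hfin
      · refine (fr.and_eventually ((hMtop.eventually ev).and ((hMtop.eventually_ge_atTop 1).and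
          (eventually_ge_atTop 1)))).mono fun N hN => ?_
        obtain ⟨h1, h2, h3, h4⟩ := hN
        have hN0 : (0 : ℝ) < N := by exact_mod_cast h4
        have hM0 : (0 : ℝ) < M N := by exact_mod_cast h3
        have hMle : (M N : ℝ) ≤ N / l := Nat.floor_le (by positivity)
        have hMN : M N ≤ N := by
          have : (N : ℝ) / l ≤ N := div_le_self hN0.le hl.le
          exact_mod_cast hMle.trans this
        have key := hC' (M N) N h3 hMN
        have hNi : (0 : ℝ) < (N : ℝ) + i := by positivity
        have b1 : a (M N) ≤ (A + e) / M N := by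
          rw [le_div_iff₀ hM0, mul_comm]; exact h2.le
        have b2 : (A - e) / ((N : ℝ) + i) ≤ a (N + i) := by
          rw [div_le_iff₀ hNi, mul_comm]
          have : u (N + i) = ((N : ℝ) + i) * a (N + i) := by simp [hu]
          rw [← this]; exact h1.le
        have b3 : (A - e) / ((N : ℝ) + i) ≤ a N := b2.trans (hanti (Nat.le_add_right _ _))
        have b4 : ((A - e) / ((N : ℝ) + i)) ^ 2 ≤ a N ^ 2 :=
          pow_le_pow_left₀ (div_nonneg (by linarith) hNi.le) b3 2
        have b5 : (1 - l⁻¹) * N ≤ (N : ℝ) - M N := by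
          have : (N : ℝ) / l = l⁻¹ * N := by rw [div_eq_inv_mul]
          nlinarith
        have hl1 : 0 ≤ 1 - l⁻¹ := sub_nonneg.2 (inv_le_one_of_one_le₀ hl.le)
        have b6 : (1 - l⁻¹) * N * ((A - e) / ((N : ℝ) + i)) ^ 2 ≤ ((N : ℝ) - M N) * a N ^ 2 :=
          mul_le_mul b5 b4 (sq_nonneg _) ((mul_nonneg hl1 hN0.le).trans b5)
        have b7 : (A - e) / ((N : ℝ) + i) +
            β * ((1 - l⁻¹) * N * ((A - e) / ((N : ℝ) + i)) ^ 2) - C' / (M N : ℝ) ^ 2 ≤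
            (A + e) / M N := by
          have := mul_le_mul_of_nonneg_left b6 hβ.le
          linarith
        have b8 := mul_le_mul_of_nonneg_left b7 hN0.le
        have e1 : (N : ℝ) * ((A + e) / M N) = (A + e) * ((N : ℝ) / M N) := by ring
        have e2 : (N : ℝ) * ((A - e) / ((N : ℝ) + i) +
            β * ((1 - l⁻¹) * N * ((A - e) / ((N : ℝ) + i)) ^ 2) - C' / (M N : ℝ) ^ 2) =
            ((A - e) * ((N : ℝ) / (N + i)) +
              β * ((1 - l⁻¹) * ((A - e) * ((N : ℝ) / (N + i))) ^ 2)) -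
              C' * (((N : ℝ) / M N) * (M N : ℝ)⁻¹) := by
          field_simp
        rw [e1, e2] at b8
        linarith
    have lim0 : Tendsto (fun e : ℝ => (A + e) * l - ((A - e) + β * ((1 - l⁻¹) * (A - e) ^ 2)))
        (𝓝[>] 0) (𝓝 ((A + 0) * l - ((A - 0) + β * ((1 - l⁻¹) * (A - 0) ^ 2)))) := by
      have : Continuous fun e : ℝ =>
          (A + e) * l - ((A - e) + β * ((1 - l⁻¹) * (A - e) ^ 2)) := by fun_prop
      exact (this.tendsto 0).mono_left nhdsWithin_le_nhds
    have h0 := ge_of_tendsto lim0 (b := 0) (by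
      filter_upwards [Ioo_mem_nhdsGT hA0] with e he
      exact step e he.1 he.2)
    simp only [add_zero, sub_zero] at h0
    have e1 : A * l - (A + β * ((1 - l⁻¹) * A ^ 2)) = A * ((l - 1) * l⁻¹) * (l - β * A) := by
      field_simp; ring
    rw [e1] at h0
    have : 0 < A * ((l - 1) * l⁻¹) := mul_pos hA0 (mul_pos (by linarith) (by positivity))
    nlinarith
  have main1 : ∀ β, 0 < β → β < v → β * A ≤ 1 := fun β hβ hβv =>
    le_of_forall_gt_imp_ge_of_dense fun l hl => main β hβ hβv l hl
  rw [le_div_iff₀ hv, mul_comm]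
  have lim1 : Tendsto (fun β : ℝ => β * A) (𝓝[<] v) (𝓝 (v * A)) :=
    ((continuous_id.mul continuous_const).tendsto v).mono_left nhdsWithin_le_nhds
  refine le_of_tendsto lim1 ?_
  filter_upwards [Ioo_mem_nhdsLT hv] with β hβ
  exact main1 β hβ.1 hβ.2

/-! ### Truncation of the survival probabilities and the sharp loss -/

section Upper

variable {L : ℕ} {m : Selection L → ℝ} {κ : Digit L → ℝ} {lo hi : ℝ} {h : ℝ → ℝ}

/-- The part of the survival probabilities exceeding `δ` times the bulk. -/
def overshoot (m : Selection L → ℝ) (κ : Digit L → ℝ) (lo hi : ℝ) (h : ℝ → ℝ) (ε δ : ℝ) (n : ℕ)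
    (t : ℝ) : ℝ :=
  hitProb m κ lo hi n t - min (hitProb m κ lo hi n t) (δ * bulk κ lo hi h ε n t)

lemma overshoot_eq (ε δ : ℝ) (n : ℕ) (t : ℝ) : overshoot m κ lo hi h ε δ n t =
    max 0 (hitProb m κ lo hi n t - δ * bulk κ lo hi h ε n t) := by
  rw [overshoot, ← sub_self (hitProb m κ lo hi n t), max_sub_sub_left]

/-- Since δ times the bulk evolves exactly by the mean operator, it can be subtracted from the
recursion, and the loss of `hitProb` dominates the pairing of the smaller overshoot. Where the
overshoot vanishes, the right side is still nonnegative, being above a survival probability. -/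
lemma overshoot_succ_le (S : LineSystem κ lo hi h) (hm : IsUniformWeight m) {ε δ : ℝ} (hε : 0 < ε)
    (hδ : 0 < δ) (n : ℕ) (t : ℝ) :
    overshoot m κ lo hi h ε δ (n + 1) t ≤ transfer κ (overshoot m κ lo hi h ε δ n) t -
      ((L : ℝ) ^ 4)⁻¹ *
        pairing m κ (overshoot m κ lo hi h ε δ n) (overshoot m κ lo hi h ε δ n) t := by
  set w := overshoot m κ lo hi h ε δ n with hw
  have hb0 : ∀ t, 0 ≤ bulk κ lo hi h ε n t := fun t => (S.nonneg t).trans (le_bulk hε.le n t)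
  have hw0 : ∀ t, 0 ≤ w t := fun t => by rw [hw, overshoot_eq]; exact le_max_left _ _
  have hwp : ∀ t, w t ≤ hitProb m κ lo hi n t := fun t => by
    rw [hw, overshoot]
    have : 0 ≤ min (hitProb m κ lo hi n t) (δ * bulk κ lo hi h ε n t) :=
      le_min (hitProb_mem hm n t).1 (mul_nonneg hδ.le (hb0 t))
    linarith
  have hw1 : ∀ t, w t ≤ 1 := fun t => (hwp t).trans (hitProb_mem hm n t).2
  have hL : 0 < L := by exact_mod_cast S.pos
  rw [overshoot_eq]
  refine max_le ?_ ?_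
  · exact (survive_nonneg hm hw0 hw1 t).trans (survive_le_transfer_sub hm hL hw0 hw1 t)
  · have h1 := hitProb_loss S hm n t
    have h2 : ((L : ℝ) ^ 4)⁻¹ * pairing m κ w w t ≤
        ((L : ℝ) ^ 4)⁻¹ * pairing m κ (hitProb m κ lo hi n) (hitProb m κ lo hi n) t :=
      mul_le_mul_of_nonneg_left (pairing_mono hm hw0 hw0 hwp hwp t) (by positivity)
    have h3 : transfer κ (hitProb m κ lo hi n) t ≤
        transfer κ w t + δ * transfer κ (bulk κ lo hi h ε n) t := by
      rw [← transfer_const_mul, ← transfer_add]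
      refine transfer_mono (fun t => ?_) t
      rw [hw, overshoot_eq]
      have := le_max_right 0 (hitProb m κ lo hi n t - δ * bulk κ lo hi h ε n t)
      linarith
    rw [bulk_succ S]
    linarith

lemma energySeq_overshoot (S : LineSystem κ lo hi h) (hm : IsUniformWeight m) {ε δ : ℝ} (hε : 0 < ε)
    (hε1 : ε ≤ 1) (hδ : 0 < δ) :
    EnergySeq κ lo hi (bulk κ lo hi h ε) (overshoot m κ lo hi h ε δ) 20 ε⁻¹ where
  b_nice := bulk_nice S ε
  b_nonneg n t := (S.nonneg t).trans (le_bulk hε.le n t)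
  b_le := bulk_le S hε.le hε1
  b_succ := bulk_succ S ε
  w_meas n := (measurable_hitProb n).sub
    ((measurable_hitProb n).min ((bulk_nice S ε n).measurable.const_mul δ))
  w_nonneg n t := by rw [overshoot_eq]; exact le_max_left _ _
  w_le n t := by
    refine le_trans ?_ (hitProb_le_bulk S hm hε n t)
    have : 0 ≤ min (hitProb m κ lo hi n t) (δ * bulk κ lo hi h ε n t) :=
      le_min (hitProb_mem hm n t).1 (mul_nonneg hδ.le ((S.nonneg t).trans (le_bulk hε.le n t)))
    rw [overshoot]
    linarith
  w_succ n t := by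
    have h0 : ∀ t, 0 ≤ overshoot m κ lo hi h ε δ n t := fun t => by
      rw [overshoot_eq]; exact le_max_left _ _
    have h1 := pairing_nonneg (κ := κ) hm h0 h0 t
    have h2 := overshoot_succ_le S hm hε hδ n t
    have h3 := mul_nonneg (by positivity : (0 : ℝ) ≤ ((L : ℝ) ^ 4)⁻¹) h1
    linarith

/-- The loss of mean length in one generation, from below. -/
lemma energy_le_meanLength_sub (S : LineSystem κ lo hi h) (hm : IsUniformWeight m) {ε δ η : ℝ}
    (hε : 0 < ε) (hε1 : ε ≤ 1) (hδ : 0 < δ) (hδL : 20 * (L : ℝ) ^ 2 * δ ≤ 1) (hη : 0 < η)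
    (hη1 : η ≤ 1) (n : ℕ) :
    (1 - 20 * (L : ℝ) ^ 2 * δ) / 2 *
      ((1 - η) * (∫ t, energy (bulk κ lo hi h ε) (hitProb m κ lo hi) n t * pairDensity m κ h t) -
        20 * (L : ℝ) ^ 2 * η⁻¹ *
          (∫ t, energy (bulk κ lo hi h ε) (overshoot m κ lo hi h ε δ) n t) -
        20 * (L : ℝ) ^ 2 * ((∫ t, energy (bulk κ lo hi h ε) (hitProb m κ lo hi) n t) -
          ∫ t, energy (bulk κ lo hi h ε) (hitProb m κ lo hi) (n + 1) t)) ≤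
      meanLength m κ lo hi n - meanLength m κ lo hi (n + 1) := by
  have W := energySeq_hitProb S hm hε hε1
  have U := energySeq_overshoot S hm hε hε1 hδ
  have hL := S.pos
  set p := hitProb m κ lo hi with hp
  set b := bulk κ lo hi h ε with hb
  set w := overshoot m κ lo hi h ε δ with hw
  set l : ℝ → ℝ := fun t => min (p n t) (δ * b n t) with hl
  have hl0 : ∀ t, 0 ≤ l t := fun t =>
    le_min (W.w_nonneg n t) (mul_nonneg hδ.le (W.b_nonneg n t))
  have hlp : ∀ t, l t ≤ p n t := fun t => min_le_left _ _
  have hlb : ∀ t, l t ≤ 20 * δ := fun t => (min_le_right _ _).trans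
    (by have := W.b_le n t; nlinarith)
  have hwl : ∀ t, w n t = p n t - l t := fun t => rfl
  have hln : IsNice (Icc lo hi) l := (W.w_nice n).of_le
    ((W.w_meas n).min ((W.b_nice n).measurable.const_mul δ)) hl0 (c := 1)
    (fun t => by rw [one_mul]; exact hlp t)
  have hdiv : ∀ t, l t / b n t = min (p n t / b n t) δ := by
    intro t
    rcases (W.b_nonneg n t).eq_or_lt with h0 | h0
    · simp [← h0, hδ.le]
    · simp only [hl]
      rw [← min_div_div_right h0.le, mul_div_assoc, div_self h0.ne', mul_one]
  have hlip : ∀ s t, |l s / b n s - l t / b n t| ≤ |p n s / b n s - p n t / b n t| := by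
    intro s t
    rw [hdiv, hdiv]
    refine (abs_min_sub_min_le_max _ _ _ _).trans ?_
    simp
  have hK : ∀ t, transfer κ (b n) t ≤ 20 := fun t => by rw [← W.b_succ]; exact W.b_le _ t
  have e0 := W.energy_nice n
  have e1 := W.energy_nice (n + 1)
  have f0 := U.energy_nice n
  have pt : ∀ t, (1 - η) * pairing m κ (energy b p n) h t -
      20 * (L : ℝ) ^ 2 * η⁻¹ * transfer κ (energy b w n) t -
      20 * (L : ℝ) ^ 2 * (transfer κ (energy b p n) t - energy b p (n + 1) t) ≤
      pairing m κ l l t := by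
    intro t
    have k1 := pairing_energy hm (κ := κ) (l := l) (w := p n) (W.b_nonneg n)
      (fun _ => W.w_eq_zero) (fun t h0 => by
        simp only [hl, h0, W.w_eq_zero h0, mul_zero, min_self]) hK hlip t
    have k2 : (1 - η) * pairing m κ (energy b p n) h t - η⁻¹ * pairing m κ (energy b w n) (b n) t ≤
        pairing m κ (fun t => l t ^ 2 / b n t) (b n) t := by
      have k3 : pairing m κ (energy b p n) h t ≤ pairing m κ (energy b p n) (b n) t :=
        pairing_mono hm (W.energy_nonneg n) S.nonneg (fun _ => le_rfl) (le_bulk hε.le n) t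
      have k4 : (1 - η) * pairing m κ (energy b p n) (b n) t -
          η⁻¹ * pairing m κ (energy b w n) (b n) t ≤
          pairing m κ (fun t => l t ^ 2 / b n t) (b n) t := by
        simp only [pairing, Finset.mul_sum, ← Finset.sum_sub_distrib]
        refine Finset.sum_le_sum fun q _ => Finset.sum_le_sum fun q' _ => ?_
        -- With l = p - w this is Young's inequality (1 - η) p² - w² / η ≤ (p - w)², divided by the
        -- bulk.
        have k5 : (1 - η) * energy b p n (L * t - κ q) - η⁻¹ * energy b w n (L * t - κ q) ≤
            l (L * t - κ q) ^ 2 / b n (L * t - κ q) := by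
          set s := L * t - κ q
          simp only [energy, mul_div_assoc', ← sub_div]
          refine div_le_div_of_nonneg_right ?_ (W.b_nonneg n s)
          have : l s = p n s - w n s := by rw [hwl]; ring
          rw [this]
          have h5 : 0 ≤ η * p n s ^ 2 - 2 * (p n s * w n s) + η⁻¹ * w n s ^ 2 := by
            have : η * p n s ^ 2 - 2 * (p n s * w n s) + η⁻¹ * w n s ^ 2 =
              η⁻¹ * (η * p n s - w n s) ^ 2 := by field_simp; ring
            rw [this]; positivity
          nlinarith [sq_nonneg (w n s)]
        have k6 : 0 ≤ pairProb m q q' * b n (L * t - κ q') :=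
          mul_nonneg (pairProb_nonneg hm _ _) (W.b_nonneg n _)
        have := mul_le_mul_of_nonneg_left k5 k6
        linarith
      have := mul_le_mul_of_nonneg_left k3 (sub_nonneg.2 hη1)
      linarith
    have k7 : pairing m κ (energy b w n) (b n) t ≤
        20 * (L : ℝ) ^ 2 * transfer κ (energy b w n) t := by
      calc pairing m κ (energy b w n) (b n) t
          ≤ ∑ q, ∑ q' : Digit L, (L : ℝ)⁻¹ * (energy b w n (L * t - κ q) * 20) := by
            refine Finset.sum_le_sum fun q _ => Finset.sum_le_sum fun q' _ => ?_
            refine mul_le_mul (pairProb_le hm _ _) ?_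
              (mul_nonneg (U.energy_nonneg n _) (W.b_nonneg n _)) (by positivity)
            exact mul_le_mul_of_nonneg_left (W.b_le n _) (U.energy_nonneg n _)
        _ = _ := by
            simp only [Finset.sum_const, nsmul_eq_mul, card_digit, transfer, Finset.mul_sum]
            exact Finset.sum_congr rfl fun q _ => by ring
    have k8 := W.energy_succ_le' n t
    have k9 := mul_le_mul_of_nonneg_left k8 (by positivity : 0 ≤ (L : ℝ) ^ 2 * 20)
    have k10 := mul_le_mul_of_nonneg_left k7 (inv_nonneg.2 hη.le)
    rw [show (fun t => p n t ^ 2 / b n t) = energy b p n from rfl] at k1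
    linarith
  have hint : (1 - η) * (∫ t, energy b p n t * pairDensity m κ h t) -
      20 * (L : ℝ) ^ 2 * η⁻¹ * (∫ t, energy b w n t) -
      20 * (L : ℝ) ^ 2 * ((∫ t, energy b p n t) - ∫ t, energy b p (n + 1) t) ≤
      ∫ t, pairing m κ l l t := by
    have g1 := (e0.pairing (m := m) S S.nice).const_mul (1 - η)
    have g2 := (f0.transfer S).const_mul (20 * (L : ℝ) ^ 2 * η⁻¹)
    have g3 := ((e0.transfer S).sub e1).const_mul (20 * (L : ℝ) ^ 2)
    rw [← integral_pairing S e0 S.nice, ← integral_transfer S e0, ← integral_transfer S f0,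
      ← integral_sub (e0.transfer S).integrable e1.integrable, ← integral_const_mul,
      ← integral_const_mul, ← integral_const_mul, ← integral_sub g1.integrable g2.integrable,
      ← integral_sub (g1.sub g2).integrable g3.integrable]
    exact integral_mono ((g1.sub g2).sub g3).integrable (hln.pairing S hln).integrable pt
  have hloss : (1 - 20 * (L : ℝ) ^ 2 * δ) / 2 * (∫ t, pairing m κ l l t) ≤
      meanLength m κ lo hi n - meanLength m κ lo hi (n + 1) := by
    have n0 := W.w_nice n
    unfold meanLength
    rw [← integral_transfer S n0, ← integral_sub (n0.transfer S).integrable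
      (W.w_nice _).integrable, ← integral_const_mul]
    refine integral_mono ((hln.pairing S hln).const_mul _).integrable
      ((n0.transfer S).sub (W.w_nice _)).integrable fun t => ?_
    have := pairing_le_transfer_sub_survive (κ := κ) hm hl0 hlp
      (fun t => (hitProb_mem hm n t).2) hlb t
    simp only
    rw [hp, hitProb_succ]
    refine le_trans (le_of_eq ?_) this
    ring
  refine le_trans (mul_le_mul_of_nonneg_left hint (by linarith)) hloss

/-- Upper bound for the decay of the mean lengths. -/
theorem eventually_mul_meanLength_lt (S : LineSystem κ lo hi h) (hm : IsUniformWeight m)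
    (hV : 0 < ∫ t, pairing m κ h h t)
    (hmix : ∀ δ > 0, ∃ i, ∀ t ∈ Icc lo hi,
      (∫ t, pairing m κ h h t) - δ ≤ (cotransfer κ)^[i] (pairDensity m κ h) t) {x : ℝ}
    (hx : 2 / (∫ t, pairing m κ h h t) < x) :
    ∀ᶠ n : ℕ in atTop, n * meanLength m κ lo hi n < x := by
  set V := ∫ t, pairing m κ h h t with hVdef
  set a := meanLength m κ lo hi with ha
  have hL := S.pos
  obtain ⟨j, hj⟩ := hmix (V / 2) (by positivity)
  have hj' : ∀ t ∈ Icc lo hi, V / 2 ≤ (cotransfer κ)^[j] (pairDensity m κ h) t := fun t ht => by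
    have := hj t ht; linarith
  obtain ⟨C, hC0, hC⟩ := exists_meanLength_bound L j (c₀ := V / 2) (by positivity)
  have hC := hC m κ lo hi h S hm hj'
  refine limit_le_of_quadratic_decrease (v := V / 2) (meanLength_nonneg hm)
    (meanLength_antitone S hm) (by positivity) (fun n => (hC n).1) ?_ (by rwa [one_div_div])
  intro β hβ hβv
  -- A single small parameter serves as weight of the bulk, truncation level, constant in Young's
  -- inequality and mixing error. As it tends to 0 the rate on the right tends to V / 2, which
  -- exceeds β.
  obtain ⟨ρ, hρ0, hρ1, hρL, hρV, hρβ⟩ : ∃ ρ : ℝ, 0 < ρ ∧ ρ ≤ 1 ∧ 20 * (L : ℝ) ^ 2 * ρ ≤ 1 ∧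
      ρ < V ∧ β < (1 - 20 * (L : ℝ) ^ 2 * ρ) / 2 * ((1 - ρ) * (V - ρ)) / (1 + ρ * 3) := by
    have hcont : ContinuousAt (fun ρ : ℝ =>
        (1 - 20 * (L : ℝ) ^ 2 * ρ) / 2 * ((1 - ρ) * (V - ρ)) / (1 + ρ * 3)) 0 :=
      ContinuousAt.div (by fun_prop) (by fun_prop) (by norm_num)
    have h1 := hcont.eventually_const_lt (u := β) (by simp; linarith)
    have h2 : Tendsto (fun ρ : ℝ => 20 * (L : ℝ) ^ 2 * ρ) (𝓝 0) (𝓝 (20 * (L : ℝ) ^ 2 * 0)) :=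
      tendsto_id.const_mul _
    have h3 := h2.eventually_lt_const (u := 1) (by simp)
    have h4 := (h1.and (h3.and ((eventually_lt_nhds one_pos).and (eventually_lt_nhds hV))))
    obtain ⟨ρ, hρ, h0⟩ := ((h4.filter_mono nhdsWithin_le_nhds).and
      (self_mem_nhdsWithin : Ioi (0 : ℝ) ∈ 𝓝[>] 0)).exists
    exact ⟨ρ, h0, hρ.2.2.1.le, hρ.2.1.le, hρ.2.2.2, hρ.1⟩
  obtain ⟨i, hi'⟩ := hmix ρ hρ0
  have W := energySeq_hitProb S hm hρ0 hρ1
  have U := energySeq_overshoot S hm hρ0 hρ1 hρ0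
  set p := hitProb m κ lo hi with hp
  set b := bulk κ lo hi h ρ with hb
  set w := overshoot m κ lo hi h ρ ρ with hw
  set D : ℕ → ℝ := fun n => ∫ t, energy b p n t with hD
  set D' : ℕ → ℝ := fun n => ∫ t, energy b w n t with hD'
  set θ : ℝ := (1 - 20 * (L : ℝ) ^ 2 * ρ) / 2 with hθ
  have hθ0 : 0 ≤ θ := by rw [hθ]; linarith
  have hθ1 : θ ≤ 1 := by
    rw [hθ]; have : 0 ≤ 20 * (L : ℝ) ^ 2 * ρ := by positivity
    linarith
  have hDanti : Antitone D := W.integral_energy_antitone S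
  have hD0 : ∀ n, 0 ≤ D n := W.integral_energy_nonneg
  have hD'0 : ∀ n, 0 ≤ D' n := U.integral_energy_nonneg
  -- the energies are of order `n⁻²`
  have hDn : ∀ n : ℕ, (n : ℝ) ^ 2 * D n ≤ ρ⁻¹ * C := by
    intro n
    have W1 := energySeq_hitProb S hm one_pos le_rfl
    have h1 : D n ≤ ρ⁻¹ * ∫ t, energy (bulk κ lo hi h 1) p n t := by
      rw [← integral_const_mul]
      refine integral_mono (W.energy_nice n).integrable
        ((W1.energy_nice n).const_mul _).integrable fun t => ?_
      simp only [energy]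
      have h2 : ρ * bulk κ lo hi h 1 n t ≤ b n t := by
        simp only [hb, bulk]
        nlinarith [S.nonneg t]
      rcases (W1.b_nonneg n t).eq_or_lt with h0 | h0
      · have : p n t = 0 := W1.w_eq_zero h0.symm
        simp [this]
      · rw [← div_eq_inv_mul, div_div]
        refine div_le_div_of_nonneg_left (sq_nonneg _) (by positivity) (by linarith)
    have h3 := mul_le_mul_of_nonneg_left h1 (sq_nonneg (n : ℝ))
    have h4 := mul_le_mul_of_nonneg_left (hC n).2 (inv_nonneg.2 hρ0.le)
    linarith
  -- The overshoot is positive only where p > ρ b, and there p ≤ p² / (ρ b).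
  have hw_int : ∀ n, ∫ t, w n t ≤ ρ⁻¹ * D n := by
    intro n
    simp only [hD]
    rw [← integral_const_mul]
    refine integral_mono (U.w_nice n).integrable ((W.energy_nice n).const_mul _).integrable
      fun t => ?_
    have h1 : 0 ≤ ρ⁻¹ * energy b p n t := mul_nonneg (by positivity) (W.energy_nonneg n t)
    simp only [hw, overshoot_eq]
    refine max_le h1 ?_
    rcases le_or_gt (hitProb m κ lo hi n t) (ρ * bulk κ lo hi h ρ n t) with h2 | h2
    · linarith
    · rcases (W.b_nonneg n t).eq_or_lt with h0 | h0
      · have h3 : p n t = 0 := W.w_eq_zero h0.symm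
        have h4 : bulk κ lo hi h ρ n t = 0 := h0.symm
        simp only [hp] at h3
        rw [h3, h4]; simpa using h1
      · have h5 : 0 ≤ ρ * bulk κ lo hi h ρ n t := mul_nonneg hρ0.le h0.le
        refine le_trans (by linarith : _ ≤ p n t) ?_
        rw [energy, ← div_eq_inv_mul, div_div, le_div_iff₀ (by positivity)]
        have h6 : 0 ≤ p n t := W.w_nonneg n t
        have h7 : b n t * ρ ≤ p n t := by rw [mul_comm]; exact h2.le
        nlinarith
  set C₃ : ℝ := ((L : ℝ) ^ 4 + (2 * (L : ℝ) ^ 2 + (L : ℝ) ^ 2 * 20) * (j + 1) * ρ⁻¹) / (V / 2)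
    with hC₃
  have hC₃0 : 0 ≤ C₃ := by positivity
  -- The overshoot has an energy sequence of its own, so its total energy from M on is bounded by
  -- its integral at M, hence by a multiple of `D M`.
  have hsumD' : ∀ M N, ∑ n ∈ Finset.Ico M N, D' n ≤ C₃ * (ρ⁻¹ * D M) := by
    intro M N
    refine (U.sum_energy_le S hm (fun n t => le_bulk hρ0.le n t) (by positivity)
      (by positivity : 0 < V / 2) hj' (overshoot_succ_le S hm hρ0 hρ0) M N).trans ?_
    exact mul_le_mul_of_nonneg_left (hw_int M) hC₃0
  -- The sharp loss at time n + i, with the tested energy expressed through the energy at time n by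
  -- i generations of mixing.
  have hstep : ∀ n, θ * ((1 - ρ) * ((V - ρ) * D n) - 2 * (L : ℝ) ^ 2 * (D n - D (n + i)) -
      20 * (L : ℝ) ^ 2 * ρ⁻¹ * D' (n + i) - 20 * (L : ℝ) ^ 2 * (D (n + i) - D (n + i + 1))) ≤
      a (n + i) - a (n + i + 1) := by
    intro n
    refine le_trans (mul_le_mul_of_nonneg_left ?_ hθ0)
      (energy_le_meanLength_sub S hm hρ0 hρ1 hρ0 hρL hρ0 hρ1 (n + i))
    have h1 := W.integral_energy_mul_ge S (measurable_pairDensity S.nice.measurable)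
      (pairDensity_nonneg hm S.nonneg) (pairDensity_le hm S) hi' n
    have h2 := mul_le_mul_of_nonneg_left h1 (sub_nonneg.2 hρ1)
    have h3 : 0 ≤ 2 * (L : ℝ) ^ 2 * (D n - D (n + i)) :=
      mul_nonneg (by positivity) (sub_nonneg.2 (hDanti (Nat.le_add_right _ _)))
    simp only [hD, hD'] at h2 h3 ⊢
    nlinarith
  -- Summed over a block, the errors telescope or are overshoot energies; together they are a
  -- multiple of `D M`, hence O(M⁻²).
  have hsum : ∀ M N : ℕ, M ≤ N → θ * ((1 - ρ) * (V - ρ)) * (∑ n ∈ Finset.Ico M N, D n) -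
      (2 * (L : ℝ) ^ 2 * (i * D M) + 20 * (L : ℝ) ^ 2 * ρ⁻¹ * (C₃ * (ρ⁻¹ * D M)) +
        20 * (L : ℝ) ^ 2 * D M) ≤ a M - a (N + i) := by
    intro M N hMN
    have tele : ∀ f : ℕ → ℝ, ∑ n ∈ Finset.Ico M N, (f n - f (n + 1)) = f M - f N := by
      intro f
      have := Finset.sum_Ico_sub (fun n => -f n) hMN
      simp only [sub_neg_eq_add] at this
      rw [← sub_eq_neg_add] at this
      rw [← this]
      exact Finset.sum_congr rfl fun n _ => by ring
    have t1 : ∑ n ∈ Finset.Ico M N, (a (n + i) - a (n + i + 1)) ≤ a M - a (N + i) := by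
      have := tele fun n => a (n + i)
      simp only [add_right_comm _ 1 i] at this
      rw [this]
      have : a (M + i) ≤ a M := meanLength_antitone S hm (Nat.le_add_right _ _)
      linarith
    have t2 : ∑ n ∈ Finset.Ico M N, (D (n + i) - D (n + i + 1)) ≤ D M := by
      have := tele fun n => D (n + i)
      simp only [add_right_comm _ 1 i] at this
      rw [this]
      have : D (M + i) ≤ D M := hDanti (Nat.le_add_right _ _)
      linarith [hD0 (N + i)]
    have t3 : ∀ k : ℕ, ∑ n ∈ Finset.Ico M N, (D n - D (n + k)) ≤ k * D M := by
      intro k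
      induction k with
      | zero => simp
      | succ k ih =>
        have e : ∀ n, D n - D (n + (k + 1)) = (D n - D (n + k)) + (D (n + k) - D (n + 1 + k)) := by
          intro n; rw [show n + (k + 1) = n + 1 + k by ring]; ring
        simp only [e, Finset.sum_add_distrib]
        rw [tele fun n => D (n + k)]
        have h1 : D (M + k) ≤ D M := hDanti (Nat.le_add_right _ _)
        have h2 := hD0 (N + k)
        push_cast
        linarith
    have t4 : ∑ n ∈ Finset.Ico M N, D' (n + i) ≤ C₃ * (ρ⁻¹ * D M) := by
      rw [Finset.sum_Ico_add']
      refine (hsumD' (M + i) (N + i)).trans ?_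
      have : D (M + i) ≤ D M := hDanti (Nat.le_add_right _ _)
      gcongr
    have key := (Finset.sum_le_sum fun n (_ : n ∈ Finset.Ico M N) => hstep n).trans t1
    simp only [← Finset.mul_sum, Finset.sum_sub_distrib] at key
    simp only [Finset.sum_sub_distrib] at t2 t3
    have t3 := t3 i
    have u1 := mul_le_mul_of_nonneg_left t3 (by positivity : 0 ≤ 2 * (L : ℝ) ^ 2)
    have u2 := mul_le_mul_of_nonneg_left t4 (by positivity : 0 ≤ 20 * (L : ℝ) ^ 2 * ρ⁻¹)
    have u3 := mul_le_mul_of_nonneg_left t2 (by positivity : 0 ≤ 20 * (L : ℝ) ^ 2)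
    set R := 2 * (L : ℝ) ^ 2 * (i * D M) + 20 * (L : ℝ) ^ 2 * ρ⁻¹ * (C₃ * (ρ⁻¹ * D M)) +
        20 * (L : ℝ) ^ 2 * D M
    have hR0 : 0 ≤ R := by
      have := hD0 M
      positivity
    have u4 : θ * R ≤ R := mul_le_of_le_one_left hR0 hθ1
    refine le_trans ?_ key
    have u5 : θ * (2 * (L : ℝ) ^ 2 * (∑ n ∈ Finset.Ico M N, D n - ∑ n ∈ Finset.Ico M N, D (n + i)) +
        20 * (L : ℝ) ^ 2 * ρ⁻¹ * ∑ n ∈ Finset.Ico M N, D' (n + i) + 20 * (L : ℝ) ^ 2 *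
        (∑ n ∈ Finset.Ico M N, D (n + i) - ∑ n ∈ Finset.Ico M N, D (n + i + 1))) ≤ θ * R :=
      mul_le_mul_of_nonneg_left (by linarith) hθ0
    linarith
  set R : ℝ := 2 * (L : ℝ) ^ 2 * i + 20 * (L : ℝ) ^ 2 * ρ⁻¹ * (C₃ * ρ⁻¹) + 20 * (L : ℝ) ^ 2
    with hR
  have hR0 : 0 ≤ R := by positivity
  refine ⟨i, R * (ρ⁻¹ * C), fun M N hM hMN => ?_⟩
  have h1 := hsum M N hMN
  have hM0 : (0 : ℝ) < (M : ℝ) ^ 2 := by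
    have : (0 : ℝ) < M := by exact_mod_cast hM
    positivity
  have h2 : R * D M ≤ R * (ρ⁻¹ * C) / (M : ℝ) ^ 2 := by
    rw [le_div_iff₀ hM0]
    have := mul_le_mul_of_nonneg_left (hDn M) hR0
    linarith
  -- The lengths decrease, so the block sum of the energies dominates (N - M) a(N)², up to the
  -- factor 1 + 3ρ which bounds the integral of the bulk.
  have h3 : β * (((N : ℝ) - M) * a N ^ 2) ≤
      θ * ((1 - ρ) * (V - ρ)) * (∑ n ∈ Finset.Ico M N, D n) := by
    have d1 : ∀ n, a n ^ 2 ≤ D n * (1 + ρ * 3) := fun n => by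
      refine (sq_meanLength_le S hm hρ0 hρ1 n).trans ?_
      refine mul_le_mul_of_nonneg_left ?_ (hD0 n)
      have := S.width_le
      nlinarith
    have d2 : ((N : ℝ) - M) * a N ^ 2 ≤ (1 + ρ * 3) * ∑ n ∈ Finset.Ico M N, D n := by
      calc ((N : ℝ) - M) * a N ^ 2 = ∑ n ∈ Finset.Ico M N, a N ^ 2 := by simp [Nat.cast_sub hMN]
        _ ≤ ∑ n ∈ Finset.Ico M N, D n * (1 + ρ * 3) := by
            refine Finset.sum_le_sum fun n hn => le_trans ?_ (d1 n)
            exact pow_le_pow_left₀ (meanLength_nonneg hm N)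
              (meanLength_antitone S hm (Finset.mem_Ico.1 hn).2.le) 2
        _ = _ := by rw [← Finset.sum_mul, mul_comm]
    have hs : 0 ≤ ∑ n ∈ Finset.Ico M N, D n := Finset.sum_nonneg fun n _ => hD0 n
    have d3 := mul_le_mul_of_nonneg_left d2 hβ.le
    have d4 : β * (1 + ρ * 3) ≤ θ * ((1 - ρ) * (V - ρ)) := by
      rw [lt_div_iff₀ (by positivity)] at hρβ
      exact hρβ.le
    have d5 := mul_le_mul_of_nonneg_right d4 hs
    linarith
  have h4 : R * D M = 2 * (L : ℝ) ^ 2 * (i * D M) + 20 * (L : ℝ) ^ 2 * ρ⁻¹ * (C₃ * (ρ⁻¹ * D M)) +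
        20 * (L : ℝ) ^ 2 * D M := by rw [hR]; ring
  linarith

end Upper

end

end GridFractal

open MeasureTheory ProbabilityTheory Filter Topology Set

namespace GridFractal

noncomputable section

/-! ### Lines meeting the unit square -/

section Chord

variable {L : ℕ} {θ : ℝ}

/-- First coordinate of `linePoint θ t s`. -/
def lineX (θ t s : ℝ) : ℝ := t * (-Real.sin θ) + s * Real.cos θ

/-- Second coordinate of `linePoint θ t s`. -/
def lineY (θ t s : ℝ) : ℝ := t * Real.cos θ + s * Real.sin θ

/-- Projection of the point `(a, b)`. -/
def projXY (θ a b : ℝ) : ℝ := -Real.sin θ * a + Real.cos θ * b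

/-- Projection of the corner of a square of the grid, in units of `1 / L`. -/
def digitProj (θ : ℝ) (q : Digit L) : ℝ := projXY θ (q.1 : ℕ) (q.2 : ℕ)

/-- Left end point of the projection of the unit square. -/
def projLo (θ : ℝ) : ℝ := min 0 (-Real.sin θ) + min 0 (Real.cos θ)

/-- Right end point of the projection of the unit square. -/
def projHi (θ : ℝ) : ℝ := max 0 (-Real.sin θ) + max 0 (Real.cos θ)

/-- Indicator function of `[0, 1)`. -/
def unitInd : ℝ → ℝ := (Ico (0 : ℝ) 1).indicator 1

/-- The length of the part of the line `ℓ(θ, t)` in the half-open unit square. -/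
def chord (θ t : ℝ) : ℝ := ∫ s, unitInd (lineX θ t s) * unitInd (lineY θ t s)

lemma sin_mul_lineX (θ t s : ℝ) : projXY θ (lineX θ t s) (lineY θ t s) = t := by
  unfold projXY lineX lineY
  linear_combination t * Real.sin_sq_add_cos_sq θ

lemma cos_mul_lineX (θ t s : ℝ) :
    Real.cos θ * lineX θ t s + Real.sin θ * lineY θ t s = s := by
  unfold lineX lineY
  linear_combination s * Real.sin_sq_add_cos_sq θ

lemma lineX_projXY (θ a b t s : ℝ) :
    lineX θ (t + projXY θ a b) (s + (Real.cos θ * a + Real.sin θ * b)) = lineX θ t s + a := by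
  unfold projXY lineX
  linear_combination a * Real.sin_sq_add_cos_sq θ

lemma lineY_projXY (θ a b t s : ℝ) :
    lineY θ (t + projXY θ a b) (s + (Real.cos θ * a + Real.sin θ * b)) = lineY θ t s + b := by
  unfold projXY lineY
  linear_combination b * Real.sin_sq_add_cos_sq θ

lemma lineX_mul (θ c t s : ℝ) : lineX θ (c * t) (c * s) = c * lineX θ t s := by
  unfold lineX; ring

lemma lineY_mul (θ c t s : ℝ) : lineY θ (c * t) (c * s) = c * lineY θ t s := by
  unfold lineY; ring

lemma measurable_unitInd : Measurable unitInd :=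
  (measurable_one.indicator measurableSet_Ico)

lemma unitInd_nonneg (x : ℝ) : 0 ≤ unitInd x := indicator_nonneg (fun _ _ => zero_le_one) x

lemma unitInd_le_one (x : ℝ) : unitInd x ≤ 1 :=
  indicator_le_self' (f := fun _ => (1 : ℝ)) (fun _ _ => zero_le_one) x

lemma unitInd_of_mem {x : ℝ} (hx : x ∈ Ico (0 : ℝ) 1) : unitInd x = 1 := indicator_of_mem hx _

lemma unitInd_of_notMem {x : ℝ} (hx : x ∉ Ico (0 : ℝ) 1) : unitInd x = 0 :=
  indicator_of_notMem hx _

lemma mul_mem_minmax {a x : ℝ} (hx : x ∈ Icc (0 : ℝ) 1) : a * x ∈ Icc (min 0 a) (max 0 a) := by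
  obtain ⟨h0, h1⟩ := hx
  rcases le_total 0 a with h | h
  · rw [min_eq_left h, max_eq_right h]; constructor <;> nlinarith
  · rw [min_eq_right h, max_eq_left h]; constructor <;> nlinarith

lemma projXY_mem {a b : ℝ} (ha : a ∈ Icc (0 : ℝ) 1) (hb : b ∈ Icc (0 : ℝ) 1) :
    projXY θ a b ∈ Icc (projLo θ) (projHi θ) := by
  have h1 := mul_mem_minmax (a := -Real.sin θ) ha
  have h2 := mul_mem_minmax (a := Real.cos θ) hb
  exact ⟨add_le_add h1.1 h2.1, add_le_add h1.2 h2.2⟩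

lemma exists_mul_eq (a l : ℝ) (hl : l ∈ Icc (0 : ℝ) 1) :
    ∃ x ∈ Icc (0 : ℝ) 1, a * x = min 0 a + l * |a| := by
  obtain ⟨h0, h1⟩ := hl
  rcases le_total 0 a with h | h
  · exact ⟨l, ⟨h0, h1⟩, by rw [min_eq_left h, abs_of_nonneg h]; ring⟩
  · exact ⟨1 - l, ⟨by linarith, by linarith⟩, by rw [min_eq_right h, abs_of_nonpos h]; ring⟩

lemma max_zero_sub_min_zero (a : ℝ) : max 0 a - min 0 a = |a| := by
  rw [max_sub_min_eq_abs, sub_zero]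

lemma projHi_sub_projLo (θ : ℝ) : projHi θ - projLo θ = |Real.sin θ| + |Real.cos θ| := by
  have h1 := max_zero_sub_min_zero (-Real.sin θ)
  have h2 := max_zero_sub_min_zero (Real.cos θ)
  rw [abs_neg] at h1
  unfold projHi projLo
  linarith

lemma abs_sin_add_abs_cos_pos (θ : ℝ) : 0 < |Real.sin θ| + |Real.cos θ| := by
  have h := Real.sin_sq_add_cos_sq θ
  by_contra hc
  have h1 : |Real.sin θ| = 0 := by linarith [abs_nonneg (Real.sin θ), abs_nonneg (Real.cos θ)]
  have h2 : |Real.cos θ| = 0 := by linarith [abs_nonneg (Real.sin θ), abs_nonneg (Real.cos θ)]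
  rw [abs_eq_zero] at h1 h2
  rw [h1, h2] at h
  norm_num at h

lemma projLo_lt_projHi (θ : ℝ) : projLo θ < projHi θ := by
  linarith [projHi_sub_projLo θ, abs_sin_add_abs_cos_pos θ]

lemma projHi_sub_projLo_le (θ : ℝ) : projHi θ - projLo θ ≤ 2 := by
  linarith [projHi_sub_projLo θ, Real.abs_sin_le_one θ, Real.abs_cos_le_one θ]

lemma exists_projXY_eq {t : ℝ} (ht : t ∈ Icc (projLo θ) (projHi θ)) :
    ∃ a ∈ Icc (0 : ℝ) 1, ∃ b ∈ Icc (0 : ℝ) 1, projXY θ a b = t := by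
  have hp := abs_sin_add_abs_cos_pos θ
  have hw := projHi_sub_projLo θ
  set l := (t - projLo θ) / (|Real.sin θ| + |Real.cos θ|) with hl
  have hl' : l * (|Real.sin θ| + |Real.cos θ|) = t - projLo θ := div_mul_cancel₀ _ hp.ne'
  have hlm : l ∈ Icc (0 : ℝ) 1 :=
    ⟨div_nonneg (by linarith [ht.1]) hp.le, (div_le_one hp).2 (by linarith [ht.2])⟩
  obtain ⟨a, ha, ha'⟩ := exists_mul_eq (-Real.sin θ) l hlm
  obtain ⟨b, hb, hb'⟩ := exists_mul_eq (Real.cos θ) l hlm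
  refine ⟨a, ha, b, hb, ?_⟩
  rw [projXY, ha', hb', abs_neg]
  unfold projLo at hl'
  linarith

lemma measurable_lineX : Measurable fun z : (ℝ × ℝ) × ℝ => lineX z.1.1 z.1.2 z.2 := by
  unfold lineX; fun_prop

lemma measurable_lineY : Measurable fun z : (ℝ × ℝ) × ℝ => lineY z.1.1 z.1.2 z.2 := by
  unfold lineY; fun_prop

lemma measurable_unitBox : Measurable fun z : (ℝ × ℝ) × ℝ =>
    unitInd (lineX z.1.1 z.1.2 z.2) * unitInd (lineY z.1.1 z.1.2 z.2) :=
  (measurable_unitInd.comp measurable_lineX).mul (measurable_unitInd.comp measurable_lineY)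

lemma measurable_chord : Measurable fun z : ℝ × ℝ => chord z.1 z.2 :=
  (measurable_unitBox.stronglyMeasurable.integral_prod_right).measurable

lemma measurable_unitBox_right (θ t : ℝ) :
    Measurable fun s => unitInd (lineX θ t s) * unitInd (lineY θ t s) :=
  measurable_unitBox.comp ((measurable_const (a := (θ, t))).prodMk measurable_id)

lemma unitBox_nonneg (θ t s : ℝ) : 0 ≤ unitInd (lineX θ t s) * unitInd (lineY θ t s) :=
  mul_nonneg (unitInd_nonneg _) (unitInd_nonneg _)

lemma unitBox_le (x y : ℝ) : unitInd x * unitInd y ≤ 1 :=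
  mul_le_one₀ (unitInd_le_one _) (unitInd_nonneg _) (unitInd_le_one _)

lemma unitBox_eq_zero {x y : ℝ} (h : ¬ (x ∈ Ico (0 : ℝ) 1 ∧ y ∈ Ico (0 : ℝ) 1)) :
    unitInd x * unitInd y = 0 := by
  by_cases hx : x ∈ Ico (0 : ℝ) 1
  · rw [unitInd_of_notMem fun hy => h ⟨hx, hy⟩, mul_zero]
  · rw [unitInd_of_notMem hx, zero_mul]

/-- Points of the unit square have bounded position along their line. -/
lemma mem_of_lineX_mem {t s : ℝ} (hx : lineX θ t s ∈ Icc (0 : ℝ) 1)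
    (hy : lineY θ t s ∈ Icc (0 : ℝ) 1) :
    s ∈ Icc (min 0 (Real.cos θ) + min 0 (Real.sin θ))
      (max 0 (Real.cos θ) + max 0 (Real.sin θ)) := by
  have h1 := mul_mem_minmax (a := Real.cos θ) hx
  have h2 := mul_mem_minmax (a := Real.sin θ) hy
  have h3 := cos_mul_lineX θ t s
  exact ⟨by linarith [h1.1, h2.1], by linarith [h1.2, h2.2]⟩

lemma unitBox_le_indicator (θ t s : ℝ) : unitInd (lineX θ t s) * unitInd (lineY θ t s) ≤
    (Icc (min 0 (Real.cos θ) + min 0 (Real.sin θ))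
      (max 0 (Real.cos θ) + max 0 (Real.sin θ))).indicator (fun _ => (1 : ℝ)) s := by
  by_cases h : lineX θ t s ∈ Ico (0 : ℝ) 1 ∧ lineY θ t s ∈ Ico (0 : ℝ) 1
  · rw [indicator_of_mem (mem_of_lineX_mem (Ico_subset_Icc_self h.1) (Ico_subset_Icc_self h.2))]
    exact unitBox_le _ _
  · rw [unitBox_eq_zero h]
    exact indicator_nonneg (fun _ _ => zero_le_one) _

lemma integrable_indicator_Icc (a b : ℝ) :
    Integrable ((Icc a b).indicator fun _ : ℝ => (1 : ℝ)) :=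
  (integrable_indicator_iff measurableSet_Icc).2 (integrableOn_const (by simp))

lemma integrable_unitBox (θ t : ℝ) :
    Integrable fun s => unitInd (lineX θ t s) * unitInd (lineY θ t s) := by
  refine (integrable_indicator_Icc (min 0 (Real.cos θ) + min 0 (Real.sin θ))
    (max 0 (Real.cos θ) + max 0 (Real.sin θ))).mono'
    (measurable_unitBox_right θ t).aestronglyMeasurable (Eventually.of_forall fun s => ?_)
  rw [Real.norm_of_nonneg (unitBox_nonneg θ t s)]
  exact unitBox_le_indicator θ t s

lemma chord_nonneg (θ t : ℝ) : 0 ≤ chord θ t := integral_nonneg fun s => unitBox_nonneg θ t s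

lemma chord_le_two (θ t : ℝ) : chord θ t ≤ 2 := by
  refine (integral_mono (integrable_unitBox θ t) (integrable_indicator_Icc _ _)
    fun s => unitBox_le_indicator θ t s).trans ?_
  rw [integral_indicator_const _ measurableSet_Icc, smul_eq_mul, mul_one, Real.volume_real_Icc]
  have h1 := max_zero_sub_min_zero (Real.sin θ)
  have h2 := max_zero_sub_min_zero (Real.cos θ)
  exact max_le (by linarith [Real.abs_sin_le_one θ, Real.abs_cos_le_one θ]) (by norm_num)

lemma chord_eq_zero {t : ℝ} (ht : t ∉ Icc (projLo θ) (projHi θ)) : chord θ t = 0 := by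
  unfold chord
  rw [← integral_zero (α := ℝ) (μ := volume) ℝ]
  congr 1
  ext s
  refine unitBox_eq_zero fun h => ht ?_
  rw [← sin_mul_lineX θ t s]
  exact projXY_mem (Ico_subset_Icc_self h.1) (Ico_subset_Icc_self h.2)

lemma isNice_chord (θ : ℝ) : IsNice (Icc (projLo θ) (projHi θ)) (chord θ) :=
  ⟨measurable_chord.comp (measurable_const.prodMk measurable_id),
    ⟨2, fun t => by rw [abs_of_nonneg (chord_nonneg θ t)]; exact chord_le_two θ t⟩,
    fun _ ht => chord_eq_zero ht⟩

/-- Half-open intervals tile without overlap. This makes `transfer_chord` an identity at every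
height, with no exceptional set. -/
lemma sum_unitInd (hL : 0 < L) (x : ℝ) : ∑ i : Fin L, unitInd (L * x - (i : ℕ)) = unitInd x := by
  have hL' : (0 : ℝ) < L := by exact_mod_cast hL
  by_cases hx : x ∈ Ico (0 : ℝ) 1
  · have hfl : ⌊L * x⌋₊ < L := by
      rw [Nat.floor_lt (by nlinarith [hx.1])]
      nlinarith [hx.2]
    rw [unitInd_of_mem hx, Finset.sum_eq_single (⟨⌊L * x⌋₊, hfl⟩ : Fin L)]
    · refine unitInd_of_mem ⟨?_, ?_⟩
      · have := Nat.floor_le (by nlinarith [hx.1] : 0 ≤ L * x)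
        simp only
        linarith
      · have := Nat.lt_floor_add_one (L * x)
        simp only
        linarith
    · intro i _ hi
      refine unitInd_of_notMem fun hm => hi ?_
      ext
      simp only
      symm
      rw [Nat.floor_eq_iff (by nlinarith [hx.1])]
      exact ⟨by linarith [hm.1], by linarith [hm.2]⟩
    · simp
  · rw [unitInd_of_notMem hx]
    refine Finset.sum_eq_zero fun i _ => unitInd_of_notMem fun hm => hx ?_
    have hi : ((i : ℕ) : ℝ) + 1 ≤ L := by exact_mod_cast i.2
    have hi0 : (0 : ℝ) ≤ (i : ℕ) := Nat.cast_nonneg _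
    exact ⟨by nlinarith [hm.1], by nlinarith [hm.2]⟩

lemma chord_add_projXY (θ a b t : ℝ) : chord θ (t + projXY θ a b) =
    ∫ s, unitInd (lineX θ t s + a) * unitInd (lineY θ t s + b) := by
  unfold chord
  rw [← integral_add_right_eq_self _ (Real.cos θ * a + Real.sin θ * b)]
  simp only [lineX_projXY, lineY_projXY]

lemma chord_child (hL : 0 < L) (θ : ℝ) (q : Digit L) (t : ℝ) :
    (L : ℝ)⁻¹ * chord θ (L * t - digitProj θ q) =
      ∫ s, unitInd (L * lineX θ t s - (q.1 : ℕ)) * unitInd (L * lineY θ t s - (q.2 : ℕ)) := by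
  have hL' : (0 : ℝ) < L := by exact_mod_cast hL
  have h1 : (L : ℝ) * t - digitProj θ q = L * t + projXY θ (-(q.1 : ℕ)) (-(q.2 : ℕ)) := by
    unfold digitProj projXY; ring
  rw [h1, chord_add_projXY, ← sub_zero ((L : ℝ)⁻¹ * _), sub_zero]
  rw [← integral_comp_child hL' (fun s => unitInd (lineX θ (L * t) s + -((q.1 : ℕ) : ℝ)) *
    unitInd (lineY θ (L * t) s + -((q.2 : ℕ) : ℝ))) 0]
  simp only [lineX_mul, lineY_mul, sub_eq_add_neg, neg_zero, add_zero]

lemma integrable_child (hL : 0 < L) (θ t : ℝ) (q : Digit L) : Integrable fun s =>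
    unitInd (L * lineX θ t s - (q.1 : ℕ)) * unitInd (L * lineY θ t s - (q.2 : ℕ)) := by
  refine (integrable_unitBox θ t).mono' (Measurable.aestronglyMeasurable ?_)
    (Eventually.of_forall fun s => ?_)
  · have h1 : Measurable fun s => lineX θ t s := by unfold lineX; fun_prop
    have h2 : Measurable fun s => lineY θ t s := by unfold lineY; fun_prop
    exact (measurable_unitInd.comp ((h1.const_mul _).sub_const _)).mul
      (measurable_unitInd.comp ((h2.const_mul _).sub_const _))
  · rw [Real.norm_of_nonneg (mul_nonneg (unitInd_nonneg _) (unitInd_nonneg _)),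
      ← sum_unitInd hL (lineX θ t s), ← sum_unitInd hL (lineY θ t s)]
    exact mul_le_mul (Finset.single_le_sum (f := fun i : Fin L =>
        unitInd (L * lineX θ t s - (i : ℕ))) (fun i _ => unitInd_nonneg _) (Finset.mem_univ q.1))
      (Finset.single_le_sum (f := fun i : Fin L =>
        unitInd (L * lineY θ t s - (i : ℕ))) (fun i _ => unitInd_nonneg _) (Finset.mem_univ q.2))
      (unitInd_nonneg _) (Finset.sum_nonneg fun i _ => unitInd_nonneg _)

lemma transfer_chord (hL : 0 < L) (θ : ℝ) :
    transfer (digitProj (L := L) θ) (chord θ) = chord θ := by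
  ext t
  rw [transfer, Finset.mul_sum]
  simp only [chord_child hL]
  rw [← integral_finsetSum _ fun q _ => integrable_child hL θ t q, chord]
  congr 1
  ext s
  rw [← sum_unitInd hL (lineX θ t s), ← sum_unitInd hL (lineY θ t s), Finset.sum_mul_sum,
    Fintype.sum_prod_type]

/-- The pair (t, s) gives orthonormal coordinates of the plane; the change of coordinates is linear
with determinant -1. -/
lemma integral_rotate (θ : ℝ) (F : ℝ × ℝ → ℝ) :
    ∫ z : ℝ × ℝ, F (lineX θ z.1 z.2, lineY θ z.1 z.2) = ∫ z, F z := by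
  set f : ℝ × ℝ →ₗ[ℝ] ℝ × ℝ := Matrix.toLin (Module.Basis.finTwoProd ℝ) (Module.Basis.finTwoProd ℝ)
    !![-Real.sin θ, Real.cos θ; Real.cos θ, Real.sin θ] with hf
  have hdet : LinearMap.det f = -1 := by
    rw [hf, LinearMap.det_toLin, Matrix.det_fin_two_of]
    linear_combination -Real.sin_sq_add_cos_sq θ
  have hmap : Measure.map f volume = volume := by
    rw [Measure.map_linearMap_addHaar_eq_smul_addHaar volume (by rw [hdet]; norm_num), hdet]
    simp
  have happ : ∀ z : ℝ × ℝ, f z = (lineX θ z.1 z.2, lineY θ z.1 z.2) := by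
    intro z
    rw [hf, Matrix.toLin_finTwoProd_apply]
    ext <;> simp [lineX, lineY] <;> ring
  let e : (ℝ × ℝ) ≃ₗ[ℝ] ℝ × ℝ := LinearMap.equivOfDetNeZero f (by rw [hdet]; norm_num)
  have hme : MeasurableEmbedding f :=
    e.toContinuousLinearEquiv.toHomeomorph.measurableEmbedding
  conv_rhs => rw [← hmap, hme.integral_map]
  simp only [happ]

lemma integral_unitInd : ∫ x, unitInd x = 1 := by
  unfold unitInd
  rw [show (1 : ℝ → ℝ) = fun _ => 1 from rfl, integral_indicator_const _ measurableSet_Ico]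
  simp

lemma integrable_unitInd : Integrable unitInd :=
  (integrable_indicator_iff measurableSet_Ico).2 (integrableOn_const (by simp))

lemma integral_chord (θ : ℝ) : ∫ t, chord θ t = 1 := by
  have hI : Integrable fun z : ℝ × ℝ => unitInd z.1 * unitInd z.2 :=
    integrable_unitInd.mul_prod integrable_unitInd
  have h1 : ∫ z : ℝ × ℝ, unitInd (lineX θ z.1 z.2) * unitInd (lineY θ z.1 z.2) = 1 := by
    rw [integral_rotate θ fun z => unitInd z.1 * unitInd z.2, Measure.volume_eq_prod,
      integral_prod_mul, integral_unitInd, one_mul]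
  rw [← h1, Measure.volume_eq_prod, integral_prod]
  · rfl
  -- Integrability is read off from the value: the integral of a non-integrable function is 0 by
  -- convention, whereas this one is 1.
  · by_contra hc
    rw [← Measure.volume_eq_prod] at hc
    rw [integral_undef hc] at h1
    norm_num at h1

/-- The nine translates of the unit square around it. -/
def nine : Finset (ℝ × ℝ) := ({-1, 0, 1} : Finset ℝ) ×ˢ ({-1, 0, 1} : Finset ℝ)

lemma card_nine : nine.card = 9 := by
  have : ({-1, 0, 1} : Finset ℝ).card = 3 := by
    rw [Finset.card_insert_of_notMem, Finset.card_insert_of_notMem, Finset.card_singleton] <;>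
      norm_num
  rw [nine, Finset.card_product, this]

lemma one_le_sum_unitInd {x : ℝ} (hx : x ∈ Ioo (-1 : ℝ) 2) :
    1 ≤ ∑ i ∈ ({-1, 0, 1} : Finset ℝ), unitInd (x + i) := by
  rw [Finset.sum_insert (by norm_num), Finset.sum_insert (by norm_num), Finset.sum_singleton]
  have := unitInd_nonneg (x + -1)
  have := unitInd_nonneg (x + 0)
  have := unitInd_nonneg (x + 1)
  rcases lt_or_ge x 0 with h | h
  · rw [unitInd_of_mem (x := x + 1) ⟨by linarith [hx.1], by linarith⟩]; linarith
  rcases lt_or_ge x 1 with h' | h'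
  · rw [unitInd_of_mem (x := x + 0) ⟨by linarith, by linarith⟩]; linarith
  · rw [unitInd_of_mem (x := x + -1) ⟨by linarith, by linarith [hx.2]⟩]; linarith

/-- The chord alone can be arbitrarily small near the ends of the projection. But a unit segment of
the line starting in the closed square stays in the open 3 × 3 block around it, and the nine
translates cover that segment. -/
lemma indicator_le_sum_chord (θ t : ℝ) : (Icc (projLo θ) (projHi θ)).indicator (1 : ℝ → ℝ) t ≤
    ∑ d ∈ nine, chord θ (t + projXY θ d.1 d.2) := by
  by_cases ht : t ∈ Icc (projLo θ) (projHi θ)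
  · rw [indicator_of_mem ht, Pi.one_apply]
    obtain ⟨a, ha, b, hb, hab⟩ := exists_projXY_eq ht
    set s₀ := Real.cos θ * a + Real.sin θ * b with hs
    have hX : ∀ s, lineX θ t (s + s₀) = s * Real.cos θ + a := fun s => by
      have := lineX_projXY θ a b 0 s
      rw [zero_add, hab] at this
      rw [this, lineX]; ring
    have hY : ∀ s, lineY θ t (s + s₀) = s * Real.sin θ + b := fun s => by
      have := lineY_projXY θ a b 0 s
      rw [zero_add, hab] at this
      rw [this, lineY]; ring
    simp only [chord_add_projXY]
    have hint : ∀ d : ℝ × ℝ, Integrable fun s =>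
        unitInd (lineX θ t s + d.1) * unitInd (lineY θ t s + d.2) := fun d => by
      have := (integrable_unitBox θ (t + projXY θ d.1 d.2)).comp_add_right
        (Real.cos θ * d.1 + Real.sin θ * d.2)
      simpa only [lineX_projXY, lineY_projXY] using this
    rw [← integral_finsetSum _ fun d _ => hint d]
    have h1 : ∫ s, unitInd (s - s₀) = 1 := by rw [integral_sub_right_eq_self, integral_unitInd]
    rw [← h1]
    refine integral_mono (integrable_unitInd.comp_sub_right s₀) (integrable_finsetSum _ fun d _ =>
      hint d) fun s => ?_
    simp only
    by_cases hs' : s - s₀ ∈ Ico (0 : ℝ) 1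
    · rw [unitInd_of_mem hs', nine, Finset.sum_product]
      dsimp only
      rw [← Finset.sum_mul_sum]
      have hX' := hX (s - s₀)
      have hY' := hY (s - s₀)
      rw [sub_add_cancel] at hX' hY'
      have hc := abs_le.1 (Real.abs_cos_le_one θ)
      have hsn := abs_le.1 (Real.abs_sin_le_one θ)
      obtain ⟨h0, h1⟩ := hs'
      refine one_le_mul_of_one_le_of_one_le (one_le_sum_unitInd ?_) (one_le_sum_unitInd ?_)
      · rw [hX']
        exact ⟨by nlinarith [ha.1], by nlinarith [ha.2]⟩
      · rw [hY']
        exact ⟨by nlinarith [hb.1], by nlinarith [hb.2]⟩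
    · rw [unitInd_of_notMem hs']
      exact Finset.sum_nonneg fun d _ => mul_nonneg (unitInd_nonneg _) (unitInd_nonneg _)
  · rw [indicator_of_notMem ht]
    exact Finset.sum_nonneg fun d _ => chord_nonneg _ _

/-- The chord is fixed by the mean operator, so only the nine translation vectors change, shrinking
by the factor L in each step. -/
lemma iterate_transfer_indicator_le (hL : 0 < L) (θ : ℝ) (n : ℕ) (t : ℝ) :
    (transfer (digitProj (L := L) θ))^[n] ((Icc (projLo θ) (projHi θ)).indicator 1) t ≤
      ∑ d ∈ nine, chord θ (t + projXY θ d.1 d.2 / (L : ℝ) ^ n) := by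
  have hL' : (0 : ℝ) < L := by exact_mod_cast hL
  induction n generalizing t with
  | zero => simpa using indicator_le_sum_chord θ t
  | succ n ih =>
    rw [Function.iterate_succ_apply', transfer]
    calc _ ≤ (L : ℝ)⁻¹ * ∑ q : Digit L, ∑ d ∈ nine,
          chord θ (L * t - digitProj θ q + projXY θ d.1 d.2 / (L : ℝ) ^ n) := by
          gcongr with q _
          exact ih _
      _ = ∑ d ∈ nine, transfer (digitProj (L := L) θ) (chord θ)
            (t + projXY θ d.1 d.2 / (L : ℝ) ^ (n + 1)) := by
          unfold transfer
          rw [Finset.sum_comm, Finset.mul_sum]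
          refine Finset.sum_congr rfl fun d _ => ?_
          congr 1
          refine Finset.sum_congr rfl fun q _ => ?_
          congr 1
          rw [pow_succ]
          field_simp
          ring
      _ = _ := by rw [transfer_chord hL]

lemma lineSystem (hL : 2 ≤ L) (θ : ℝ) :
    LineSystem (digitProj (L := L) θ) (projLo θ) (projHi θ) (chord θ) where
  two_le := hL
  width_nonneg := (projLo_lt_projHi θ).le
  width_le := (projHi_sub_projLo_le θ).trans (by norm_num)
  maps := by
    intro q t ht
    have hL' : (0 : ℝ) < L := by exact_mod_cast (by omega : 0 < L)
    obtain ⟨a, ha, b, hb, hab⟩ := exists_projXY_eq ht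
    have hq : ∀ i : Fin L, ∀ x ∈ Icc (0 : ℝ) 1, (x + (i : ℕ)) / L ∈ Icc (0 : ℝ) 1 := by
      intro i x hx
      have hi : ((i : ℕ) : ℝ) + 1 ≤ L := by exact_mod_cast i.2
      exact ⟨div_nonneg (add_nonneg hx.1 (Nat.cast_nonneg _)) hL'.le,
        (div_le_one hL').2 (by linarith [hx.2])⟩
    have h := projXY_mem (θ := θ) (hq q.1 a ha) (hq q.2 b hb)
    convert h using 1
    have h2 : L * t = projXY θ a b + digitProj θ q := by rw [hab]; ring
    rw [← mul_div_cancel_left₀ t hL'.ne', h2, digitProj]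
    unfold projXY
    ring
  nice := isNice_chord θ
  nonneg := chord_nonneg θ
  le_two := chord_le_two θ
  transfer_eq := transfer_chord (by omega) θ
  integral_eq := integral_chord θ
  iterate_le := fun n t => by
    refine (iterate_transfer_indicator_le (by omega) θ n t).trans ?_
    refine (Finset.sum_le_card_nsmul _ _ 2 fun d _ => chord_le_two _ _).trans ?_
    rw [card_nine]; norm_num

end Chord

end

end GridFractal

open MeasureTheory ProbabilityTheory Filter Topology Set

namespace GridFractal

noncomputable section

/-! ### The variance integral -/

section Weight

variable {L : ℕ} {m : Selection L → ℝ} {κ : Digit L → ℝ} {lo hi : ℝ} {h p : ℝ → ℝ}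

/-- The probabilities of the selections under the law `𝔛`. -/
def weight (𝔛 : Measure (Selection L)) (A : Selection L) : ℝ := 𝔛.real {A}

lemma isUniformWeight_weight (𝔛 : Measure (Selection L)) [IsProbabilityMeasure 𝔛]
    (hunif : IsUniform 𝔛) : IsUniformWeight (weight 𝔛) where
  nonneg _ := measureReal_nonneg
  sum_one := by
    simp [weight]
  marginal q := by
    classical
    rw [← Finset.sum_filter]
    have := sum_measureReal_singleton (μ := 𝔛) (Finset.univ.filter fun A : Selection L => q ∈ A)
    unfold weight
    rw [this, Measure.real, Finset.coe_filter]
    simp [hunif q]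

lemma sum_mul_sub_sq (hm : IsUniformWeight m) (t : ℝ) :
    ∑ A, m A * (∑ q ∈ A, p (L * t - κ q) - transfer κ p t) ^ 2 =
      pairing m κ p p t + (transfer κ (fun t => p t ^ 2) t - transfer κ p t ^ 2) := by
  have h1 := sum_mul_sum hm fun q => p (L * t - κ q)
  have h2 := sum_mul_sum hm fun q => p (L * t - κ q) ^ 2
  rw [pairing_eq_sum]
  simp only [pairSum_eq]
  have h3 : ∀ A : Selection L, m A * (∑ q ∈ A, p (L * t - κ q) - transfer κ p t) ^ 2 =
      m A * ((∑ q ∈ A, p (L * t - κ q)) * (∑ q ∈ A, p (L * t - κ q)) -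
        ∑ q ∈ A, p (L * t - κ q) * p (L * t - κ q)) +
      (m A * ∑ q ∈ A, p (L * t - κ q) ^ 2) -
      2 * transfer κ p t * (m A * ∑ q ∈ A, p (L * t - κ q)) + m A * transfer κ p t ^ 2 := by
    intro A
    simp only [← sq]
    ring
  rw [Finset.sum_congr rfl fun A _ => h3 A, Finset.sum_add_distrib, Finset.sum_sub_distrib,
    Finset.sum_add_distrib, ← Finset.mul_sum, ← Finset.sum_mul, hm.sum_one, h1, h2]
  simp only [transfer]
  ring

/-- Expanding the square, the diagonal contributes T(h²) - h², whose integral is 0; only the pairs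
of different squares remain. This identifies the variance integral V with the coefficient in the
recursion for the mean lengths. -/
lemma integral_sum_mul_sub_sq (S : LineSystem κ lo hi h) (hm : IsUniformWeight m) :
    ∫ t, ∑ A, m A * (∑ q ∈ A, h (L * t - κ q) - h t) ^ 2 = ∫ t, pairing m κ h h t := by
  have h1 := fun t => sum_mul_sub_sq (κ := κ) (p := h) hm t
  rw [S.transfer_eq] at h1
  simp only [h1]
  have hn : IsNice (Icc lo hi) fun t => h t ^ 2 := S.nice.pow_two
  rw [integral_add (S.nice.pairing S S.nice).integrable
    ((hn.transfer S).sub hn).integrable,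
    integral_sub (hn.transfer S).integrable hn.integrable, integral_transfer S hn, sub_self,
    add_zero]

lemma variance_eq_sum (𝔛 : Measure (Selection L)) [IsProbabilityMeasure 𝔛]
    (f : Selection L → ℝ) :
    variance f 𝔛 = ∑ A, weight 𝔛 A * (f A - ∑ B, weight 𝔛 B * f B) ^ 2 := by
  rw [variance_eq_integral (Measurable.of_discrete).aemeasurable,
    integral_fintype Integrable.of_finite, integral_fintype Integrable.of_finite]
  rfl

end Weight

/-! ### Sections by lines and positivity of V -/

section Sections

variable {L : ℕ} {θ : ℝ}

lemma ae_ae_ne {u v : ℝ} (huv : u ≠ 0 ∨ v ≠ 0) (a : ℝ) :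
    ∀ᵐ t : ℝ, ∀ᵐ s : ℝ, t * u + s * v ≠ a := by
  by_cases hv : v = 0
  · have hu : u ≠ 0 := huv.resolve_right fun h => h hv
    have : ∀ᵐ t : ℝ, t ≠ a / u := by simp [ae_iff]
    filter_upwards [this] with t ht
    refine Eventually.of_forall fun s hs => ht ?_
    rw [hv, mul_zero, add_zero] at hs
    rw [eq_div_iff hu, hs]
  · refine Eventually.of_forall fun t => ?_
    have : ∀ᵐ s : ℝ, s ≠ (a - t * u) / v := by simp [ae_iff]
    filter_upwards [this] with s hs h
    apply hs
    rw [eq_div_iff hv]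
    linarith

lemma sin_ne_zero_or_cos_ne_zero (θ : ℝ) : Real.sin θ ≠ 0 ∨ Real.cos θ ≠ 0 := by
  by_contra! h
  have := Real.sin_sq_add_cos_sq θ
  rw [h.1, h.2] at this
  norm_num at this

lemma ae_ae_lineX_ne (θ a : ℝ) : ∀ᵐ t : ℝ, ∀ᵐ s : ℝ, lineX θ t s ≠ a :=
  ae_ae_ne (by simpa using sin_ne_zero_or_cos_ne_zero θ) a

lemma ae_ae_lineY_ne (θ a : ℝ) : ∀ᵐ t : ℝ, ∀ᵐ s : ℝ, lineY θ t s ≠ a :=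
  ae_ae_ne (sin_ne_zero_or_cos_ne_zero θ).symm a

lemma linePoint_mem_square (hL : 0 < L) (θ t s : ℝ) (q : Digit L) :
    linePoint θ t s ∈ square [q] ↔ L * lineX θ t s - (q.1 : ℕ) ∈ Icc (0 : ℝ) 1 ∧
      L * lineY θ t s - (q.2 : ℕ) ∈ Icc (0 : ℝ) 1 := by
  have hL' : (0 : ℝ) < L := by exact_mod_cast hL
  have key : ∀ x a : ℝ, x ∈ Icc ((a + 0) / (L : ℝ)) ((a + 0) / L + ((L : ℝ) ^ 1)⁻¹) ↔
      L * x - a ∈ Icc (0 : ℝ) 1 := by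
    intro x a
    rw [add_zero, pow_one, ← one_div, ← add_div, mem_Icc, mem_Icc, div_le_iff₀ hL', le_div_iff₀ hL']
    constructor <;> rintro ⟨h1, h2⟩ <;> constructor <;> linarith
  exact and_congr (key (lineX θ t s) (q.1 : ℕ)) (key (lineY θ t s) (q.2 : ℕ))

/-- Closed and half-open squares differ only on the grid lines. For almost every height these meet
the line in a null set; a direction parallel to an axis has exceptional heights, at which the line
runs inside a grid line. -/
lemma ae_sectionLength (hL : 0 < L) (θ : ℝ) : ∀ᵐ t : ℝ, ∀ A : Selection L,
    (L : ℝ) * sectionLength θ t (⋃ q ∈ A, square [q]) =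
      ∑ q ∈ A, chord θ (L * t - digitProj θ q) := by
  have hL' : (0 : ℝ) < L := by exact_mod_cast hL
  have hX : ∀ᵐ t : ℝ, ∀ i : ℕ, ∀ᵐ s : ℝ, lineX θ t s ≠ (i : ℝ) / L :=
    ae_all_iff.2 fun i => ae_ae_lineX_ne θ _
  have hY : ∀ᵐ t : ℝ, ∀ i : ℕ, ∀ᵐ s : ℝ, lineY θ t s ≠ (i : ℝ) / L :=
    ae_all_iff.2 fun i => ae_ae_lineY_ne θ _
  filter_upwards [hX, hY] with t hXt hYt A
  have hmeas : MeasurableSet {s : ℝ | linePoint θ t s ∈ ⋃ q ∈ A, square [q]} := by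
    have : {s : ℝ | linePoint θ t s ∈ ⋃ q ∈ A, square [q]} =
        ⋃ q ∈ A, {s | L * lineX θ t s - (q.1 : ℕ) ∈ Icc (0 : ℝ) 1 ∧
          L * lineY θ t s - (q.2 : ℕ) ∈ Icc (0 : ℝ) 1} := by
      ext s
      simp only [mem_ofPred_eq, mem_iUnion, linePoint_mem_square hL]
    rw [this]
    refine Finset.measurableSet_biUnion _ fun q _ => ?_
    have h1 : Measurable fun s => L * lineX θ t s - (q.1 : ℕ) := by unfold lineX; fun_prop
    have h2 : Measurable fun s => L * lineY θ t s - (q.2 : ℕ) := by unfold lineY; fun_prop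
    exact (h1 measurableSet_Icc).inter (h2 measurableSet_Icc)
  have h1 : ∑ q ∈ A, chord θ (L * t - digitProj θ q) = (L : ℝ) * ∑ q ∈ A, ∫ s,
      unitInd (L * lineX θ t s - (q.1 : ℕ)) * unitInd (L * lineY θ t s - (q.2 : ℕ)) := by
    rw [Finset.mul_sum]
    refine Finset.sum_congr rfl fun q _ => ?_
    rw [← chord_child hL, mul_inv_cancel_left₀ hL'.ne']
  rw [h1, sectionLength, ← integral_indicator_one hmeas,
    ← integral_finsetSum _ fun q _ => integrable_child hL θ t q]
  congr 1
  refine integral_congr_ae ?_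
  filter_upwards [ae_all_iff.2 hXt, ae_all_iff.2 hYt] with s hXs hYs
  have ne : ∀ x : ℝ, (∀ i : ℕ, x ≠ (i : ℝ) / L) → ∀ i : ℕ,
      (L * x - i ∈ Icc (0 : ℝ) 1 → L * x - i ∈ Ioo (0 : ℝ) 1) := by
    intro x hx i h
    refine ⟨lt_of_le_of_ne h.1 fun he => hx i ?_, lt_of_le_of_ne h.2 fun he => hx (i + 1) ?_⟩
    · rw [eq_div_iff hL'.ne']; linarith
    · rw [eq_div_iff hL'.ne']; push_cast; linarith
  have uniq : ∀ x : ℝ, ∀ i j : Fin L, L * x - (i : ℕ) ∈ Ico (0 : ℝ) 1 →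
      L * x - (j : ℕ) ∈ Ico (0 : ℝ) 1 → i = j := by
    intro x i j hi hj
    ext
    have h1 : ((i : ℕ) : ℝ) < (j : ℕ) + 1 := by linarith [hi.1, hj.2]
    have h2 : ((j : ℕ) : ℝ) < (i : ℕ) + 1 := by linarith [hj.1, hi.2]
    norm_cast at h1 h2
    omega
  by_cases hs : linePoint θ t s ∈ ⋃ q ∈ A, square [q]
  · rw [indicator_of_mem (by exact hs), Pi.one_apply]
    simp only [mem_iUnion, linePoint_mem_square hL] at hs
    obtain ⟨q, hq, hqX, hqY⟩ := hs
    have hqX := Ioo_subset_Ico_self (ne _ hXs _ hqX)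
    have hqY := Ioo_subset_Ico_self (ne _ hYs _ hqY)
    rw [Finset.sum_eq_single q, unitInd_of_mem hqX, unitInd_of_mem hqY, one_mul]
    · intro q' _ hne
      refine unitBox_eq_zero fun h => hne ?_
      exact Prod.ext (uniq _ _ _ h.1 hqX) (uniq _ _ _ h.2 hqY)
    · exact fun h => absurd hq h
  · rw [indicator_of_notMem (by exact hs)]
    symm
    refine Finset.sum_eq_zero fun q hq => unitBox_eq_zero fun h => hs ?_
    simp only [mem_iUnion, linePoint_mem_square hL]
    exact ⟨q, hq, Ico_subset_Icc_self h.1, Ico_subset_Icc_self h.2⟩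

lemma V_eq_integral_sum (hL : 2 ≤ L) (𝔛 : Measure (Selection L)) [IsProbabilityMeasure 𝔛]
    (hunif : IsUniform 𝔛) (θ : ℝ) : V 𝔛 θ = ∫ t, ∑ A, weight 𝔛 A *
      (∑ q ∈ A, chord θ (L * t - digitProj θ q) - chord θ t) ^ 2 := by
  have hm := isUniformWeight_weight 𝔛 hunif
  unfold V
  refine integral_congr_ae ?_
  filter_upwards [ae_sectionLength (L := L) (by omega) θ] with t ht
  rw [variance_eq_sum]
  simp only [ht]
  rw [sum_mul_sum hm fun q => chord θ (L * t - digitProj θ q)]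
  have := congrFun (transfer_chord (L := L) (by omega) θ) t
  unfold transfer at this
  rw [this]

lemma V_eq (hL : 2 ≤ L) (𝔛 : Measure (Selection L)) [IsProbabilityMeasure 𝔛]
    (hunif : IsUniform 𝔛) (θ : ℝ) :
    V 𝔛 θ = ∫ t, pairing (weight 𝔛) (digitProj θ) (chord θ) (chord θ) t := by
  rw [V_eq_integral_sum hL 𝔛 hunif,
    integral_sum_mul_sub_sq (lineSystem hL θ) (isUniformWeight_weight 𝔛 hunif)]

/-- If `V θ ≤ 0` then the selected squares have the same projection as the unit square, with
multiplicity. -/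
lemma ae_sum_chord_eq (hL : 2 ≤ L) (𝔛 : Measure (Selection L)) [IsProbabilityMeasure 𝔛]
    (hunif : IsUniform 𝔛) (hV : V 𝔛 θ ≤ 0) : ∀ᵐ t : ℝ, ∀ A : Selection L, weight 𝔛 A ≠ 0 →
      ∑ q ∈ A, chord θ (L * t - digitProj θ q) = chord θ t := by
  have hm := isUniformWeight_weight 𝔛 hunif
  have S := lineSystem hL θ
  have hnice : IsNice (Icc (projLo θ) (projHi θ)) fun t => ∑ A, weight 𝔛 A *
      (∑ q ∈ A, chord θ (L * t - digitProj θ q) - chord θ t) ^ 2 :=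
    IsNice.sum _ fun A _ => (((IsNice.sum _ fun q _ => S.nice.comp_child S q).sub
      S.nice).pow_two).const_mul _
  have h0 : ∀ t, 0 ≤ ∑ A, weight 𝔛 A *
      (∑ q ∈ A, chord θ (L * t - digitProj θ q) - chord θ t) ^ 2 := fun t =>
    Finset.sum_nonneg fun A _ => mul_nonneg (hm.nonneg A) (sq_nonneg _)
  have hz : ∫ t, ∑ A, weight 𝔛 A *
      (∑ q ∈ A, chord θ (L * t - digitProj θ q) - chord θ t) ^ 2 = 0 := by
    rw [V_eq_integral_sum hL 𝔛 hunif] at hV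
    exact le_antisymm hV (integral_nonneg h0)
  rw [integral_eq_zero_iff_of_nonneg h0 hnice.integrable] at hz
  filter_upwards [hz] with t ht A hA
  have := (Finset.sum_eq_zero_iff_of_nonneg fun A _ => mul_nonneg (hm.nonneg A) (sq_nonneg _)).1 ht
    A (Finset.mem_univ A)
  rcases mul_eq_zero.1 this with h | h
  · exact absurd h hA
  · exact sub_eq_zero.1 (pow_eq_zero_iff two_ne_zero |>.1 h)

lemma exists_mem_Ioo_of_ae {P : ℝ → Prop} (hP : ∀ᵐ t : ℝ, P t) {a b : ℝ} (hab : a < b) :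
    ∃ t ∈ Ioo a b, P t :=
  (Measure.dense_of_ae hP).exists_mem_open isOpen_Ioo (nonempty_Ioo.2 hab) |>.imp fun _ h => ⟨h.2, h.1⟩

/-- At a point inside the i-th interval the sum counts the squares with coordinate i, and such a
point exists in every set of full measure. The sign σ = ±1 is the nonvanishing one of sine and
cosine, up to sign. -/
lemma card_filter_eq_one (hL : 0 < L) {σ : ℝ} (hσ : σ ^ 2 = 1) (A : Selection L)
    (c : Digit L → Fin L)
    (h : ∀ᵐ t : ℝ, ∑ q ∈ A, unitInd (L * (σ * t) - (c q : ℕ)) = unitInd (σ * t)) (i : Fin L) :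
    (A.filter fun q => c q = i).card = 1 := by
  have hL' : (0 : ℝ) < L := by exact_mod_cast hL
  have h' : ∀ᵐ x : ℝ, ∑ q ∈ A, unitInd (L * x - (c q : ℕ)) = unitInd x := by
    have hσ0 : σ ≠ 0 := by rintro rfl; norm_num at hσ
    have hq := (Measure.quasiMeasurePreserving_smul (volume : Measure ℝ) hσ0).ae h
    filter_upwards [hq] with x hx
    have hx' : σ * (σ • x) = x := by
      rw [smul_eq_mul, ← mul_assoc, ← sq, hσ, one_mul]
    rwa [hx'] at hx
  have hi : ((i : ℕ) : ℝ) + 1 ≤ L := by exact_mod_cast i.2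
  obtain ⟨x, hx, hxe⟩ := exists_mem_Ioo_of_ae h'
    (show ((i : ℕ) : ℝ) / L < ((i : ℕ) + 1) / L by gcongr; linarith)
  rw [mem_Ioo, div_lt_iff₀ hL', lt_div_iff₀ hL'] at hx
  have hi0 : (0 : ℝ) ≤ (i : ℕ) := Nat.cast_nonneg _
  rw [unitInd_of_mem (x := x) ⟨by nlinarith, by nlinarith⟩] at hxe
  have : ∀ q : Digit L, unitInd (L * x - (c q : ℕ)) = if c q = i then 1 else 0 := by
    intro q
    split_ifs with hq
    · rw [hq]; exact unitInd_of_mem ⟨by linarith, by linarith⟩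
    · refine unitInd_of_notMem fun hm => hq ?_
      ext
      have h1 : ((c q : ℕ) : ℝ) < (i : ℕ) + 1 := by linarith [hm.1]
      have h2 : ((i : ℕ) : ℝ) < (c q : ℕ) + 1 := by linarith [hm.2]
      norm_cast at h1 h2
      omega
  simp only [this, Finset.sum_boole] at hxe
  exact_mod_cast hxe

lemma integral_unitInd_mul {σ : ℝ} (hσ : σ ^ 2 = 1) : ∫ s, unitInd (s * σ) = 1 := by
  rw [Measure.integral_comp_mul_right, integral_unitInd, smul_eq_mul, mul_one, abs_inv,
    inv_eq_one]
  exact (pow_eq_one_iff_of_nonneg (abs_nonneg σ) two_ne_zero).1 (by rw [sq_abs, hσ])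

lemma chord_of_cos_eq_zero (h : Real.cos θ = 0) (t : ℝ) : chord θ t = unitInd (-Real.sin θ * t) := by
  have hs : Real.sin θ ^ 2 = 1 := by have := Real.sin_sq_add_cos_sq θ; rw [h] at this; linarith
  simp only [chord, lineX, lineY, h, mul_zero, add_zero, zero_add]
  rw [integral_const_mul, integral_unitInd_mul hs, mul_one, mul_comm]

lemma chord_of_sin_eq_zero (h : Real.sin θ = 0) (t : ℝ) : chord θ t = unitInd (Real.cos θ * t) := by
  have hs : Real.cos θ ^ 2 = 1 := by have := Real.sin_sq_add_cos_sq θ; rw [h] at this; linarith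
  simp only [chord, lineX, lineY, h, mul_zero, neg_zero, add_zero, zero_add]
  rw [integral_mul_const, integral_unitInd_mul hs, one_mul, mul_comm]

lemma ae_iff_weight (𝔛 : Measure (Selection L)) [IsProbabilityMeasure 𝔛]
    {P : Selection L → Prop} : (∀ᵐ A ∂𝔛, P A) ↔ ∀ A, weight 𝔛 A ≠ 0 → P A := by
  rw [ae_iff_of_countable]
  simp [weight, Measure.real, ENNReal.toReal_eq_zero_iff]

lemma exists_interior {t : ℝ} (ht : t ∈ Ioo (projLo θ) (projHi θ)) :
    ∃ a ∈ Ioo (0 : ℝ) 1, ∃ b ∈ Ioo (0 : ℝ) 1, projXY θ a b = t := by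
  have hp := abs_sin_add_abs_cos_pos θ
  have hw := projHi_sub_projLo θ
  set l := (t - projLo θ) / (|Real.sin θ| + |Real.cos θ|) with hl
  have hl' : l * (|Real.sin θ| + |Real.cos θ|) = t - projLo θ := div_mul_cancel₀ _ hp.ne'
  have hl0 : 0 < l := div_pos (by linarith [ht.1]) hp
  have hl1 : l < 1 := (div_lt_one hp).2 (by linarith [ht.2])
  have key : ∀ a : ℝ, ∃ x ∈ Ioo (0 : ℝ) 1, a * x = min 0 a + l * |a| := by
    intro a
    rcases le_total 0 a with h | h
    · exact ⟨l, ⟨hl0, hl1⟩, by rw [min_eq_left h, abs_of_nonneg h]; ring⟩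
    · exact ⟨1 - l, ⟨by linarith, by linarith⟩, by rw [min_eq_right h, abs_of_nonpos h]; ring⟩
  obtain ⟨a, ha, ha'⟩ := key (-Real.sin θ)
  obtain ⟨b, hb, hb'⟩ := key (Real.cos θ)
  refine ⟨a, ha, b, hb, ?_⟩
  rw [projXY, ha', hb', abs_neg]
  unfold projLo at hl'
  linarith

/-- Starting from (a, b), the line can be followed for a distance r before it leaves the square. -/
lemma le_chord {a b r : ℝ} (hr : 0 ≤ r) (ha : a ∈ Ioo r (1 - r)) (hb : b ∈ Ioo r (1 - r)) :
    r ≤ chord θ (projXY θ a b) := by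
  have h1 : chord θ (projXY θ a b) =
      ∫ s, unitInd (s * Real.cos θ + a) * unitInd (s * Real.sin θ + b) := by
    have := chord_add_projXY θ a b 0
    simpa [lineX, lineY] using this
  have hi : Integrable fun s => unitInd (s * Real.cos θ + a) * unitInd (s * Real.sin θ + b) := by
    have := (integrable_unitBox θ (projXY θ a b)).comp_add_right
      (Real.cos θ * a + Real.sin θ * b)
    have h2 : ∀ s, lineX θ (projXY θ a b) (s + (Real.cos θ * a + Real.sin θ * b)) =
        s * Real.cos θ + a := fun s => by
      have := lineX_projXY θ a b 0 s
      rw [zero_add] at this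
      rw [this, lineX]; ring
    have h3 : ∀ s, lineY θ (projXY θ a b) (s + (Real.cos θ * a + Real.sin θ * b)) =
        s * Real.sin θ + b := fun s => by
      have := lineY_projXY θ a b 0 s
      rw [zero_add] at this
      rw [this, lineY]; ring
    simpa only [h2, h3] using this
  have h2 : ∫ s, (Icc 0 r).indicator (fun _ => (1 : ℝ)) s = r := by
    rw [integral_indicator_const _ measurableSet_Icc, smul_eq_mul, mul_one,
      Real.volume_real_Icc_of_le hr, sub_zero]
  rw [h1]
  conv_lhs => rw [← h2]
  refine integral_mono (integrable_indicator_Icc _ _) hi fun s => ?_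
  by_cases hs : s ∈ Icc 0 r
  · have hc := abs_le.1 (Real.abs_cos_le_one θ)
    have hsn := abs_le.1 (Real.abs_sin_le_one θ)
    rw [indicator_of_mem hs]
    obtain ⟨hs0, hs1⟩ := hs
    rw [unitInd_of_mem (x := s * Real.cos θ + a) ⟨by nlinarith [ha.1], by nlinarith [ha.2]⟩,
      unitInd_of_mem (x := s * Real.sin θ + b) ⟨by nlinarith [hb.1], by nlinarith [hb.2]⟩, one_mul]
  · rw [indicator_of_notMem hs]
    exact mul_nonneg (unitInd_nonneg _) (unitInd_nonneg _)

lemma chord_pos {t : ℝ} (ht : t ∈ Ioo (projLo θ) (projHi θ)) : 0 < chord θ t := by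
  obtain ⟨a, ha, b, hb, rfl⟩ := exists_interior ht
  have h1 : 0 < min (min a (1 - a)) (min b (1 - b)) := by
    simp only [lt_min_iff, sub_pos]; exact ⟨⟨ha.1, ha.2⟩, hb.1, hb.2⟩
  set r := min (min a (1 - a)) (min b (1 - b)) with hr
  have h2 : r ≤ a ∧ r ≤ 1 - a ∧ r ≤ b ∧ r ≤ 1 - b := by
    refine ⟨?_, ?_, ?_, ?_⟩ <;> simp [hr]
  exact (half_pos h1).trans_le (le_chord (half_pos h1).le
    ⟨by linarith, by linarith⟩ ⟨by linarith, by linarith⟩)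

/-- Applied to both coordinates, this finds the corner square at the lower end of the projection and
the gap that separates it from all other squares. -/
lemma exists_extremal_digit (hL : 0 < L) (a : ℝ) :
    ∃ i : Fin L, a * (i : ℕ) = (L - 1) * min 0 a ∧
      ∀ j : Fin L, j ≠ i → a * (i : ℕ) + |a| ≤ a * (j : ℕ) := by
  rcases le_total 0 a with h | h
  · refine ⟨⟨0, hL⟩, by simp [min_eq_left h], fun j hj => ?_⟩
    have : 1 ≤ (j : ℕ) := by
      rw [Nat.one_le_iff_ne_zero]; intro h0; exact hj (Fin.ext h0)
    have : (1 : ℝ) ≤ (j : ℕ) := by exact_mod_cast this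
    rw [abs_of_nonneg h]
    simp only [Nat.cast_zero]
    nlinarith
  · refine ⟨⟨L - 1, by omega⟩, ?_, fun j hj => ?_⟩
    · rw [min_eq_right h]
      simp only [Nat.cast_sub (show 1 ≤ L by omega), Nat.cast_one]
      ring
    · have h1 : (j : ℕ) + 1 ≤ L - 1 := by
        have := j.2
        have h2 : (j : ℕ) ≠ L - 1 := fun h0 => hj (Fin.ext h0)
        omega
      have h2 : ((j : ℕ) : ℝ) + 1 ≤ ((L - 1 : ℕ) : ℝ) := by exact_mod_cast h1
      rw [abs_of_nonpos h]
      simp only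
      nlinarith

lemma exists_weight_ne_zero_notMem {m : Selection L → ℝ} (hL : 2 ≤ L) (hm : IsUniformWeight m)
    (q : Digit L) : ∃ A, m A ≠ 0 ∧ q ∉ A := by
  by_contra! h
  have h1 : ∀ A, (if q ∈ A then m A else 0) = m A := by
    intro A
    split_ifs with hq
    · rfl
    · by_contra hne
      exact hq (h A fun h0 => hne h0.symm)
  have h2 := hm.marginal q
  simp only [h1, hm.sum_one] at h2
  have h3 : (2 : ℝ) ≤ L := by exact_mod_cast hL
  have h4 : (L : ℝ)⁻¹ < 1 := inv_lt_one_of_one_lt₀ (by linarith)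
  linarith

/-- If V vanished, the chords of the selected squares would almost surely add up to the chord of the
unit square. In an axis-parallel direction the chord is an indicator function, and this says that
every column (or row) has exactly one square, which is degeneracy. In any other direction the
heights just above the lower end of the projection are reached by one corner square only, which is
missing with probability 1 - 1/L > 0. -/
theorem V_pos (hL : 2 ≤ L) (𝔛 : Measure (Selection L)) [IsProbabilityMeasure 𝔛]
    (hunif : IsUniform 𝔛) (hnondeg : IsNondegenerate 𝔛) (θ : ℝ) : 0 < V 𝔛 θ := by
  by_contra! hV
  have hm := isUniformWeight_weight 𝔛 hunif
  have hae := ae_sum_chord_eq hL 𝔛 hunif hV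
  by_cases hc : Real.cos θ = 0
  · refine hnondeg.1 ((ae_iff_weight 𝔛).2 fun A hA i => ?_)
    have hs : Real.sin θ ^ 2 = 1 := by have := Real.sin_sq_add_cos_sq θ; rw [hc] at this; linarith
    have h1 : (A.filter fun q => q.1 = i).card = 1 := by
      refine card_filter_eq_one (by omega) (σ := -Real.sin θ) (by rw [neg_sq, hs]) A Prod.fst ?_ i
      filter_upwards [hae] with t ht
      have := ht A hA
      simp only [chord_of_cos_eq_zero hc, digitProj, projXY, hc] at this
      rw [← this]
      refine Finset.sum_congr rfl fun q _ => ?_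
      congr 1
      linear_combination ((q.1 : ℕ) : ℝ) * hs
    obtain ⟨q, hq⟩ := Finset.card_eq_one.1 h1
    have hmem : ∀ q', q' ∈ A ∧ q'.1 = i ↔ q' = q := by
      intro q'; simpa using Finset.ext_iff.1 hq q'
    obtain ⟨hqA, hqi⟩ := (hmem q).2 rfl
    refine ⟨q.2, by rw [← hqi]; exact hqA, fun j hj => ?_⟩
    rw [← (hmem (i, j)).1 ⟨hj, rfl⟩]
  by_cases hs : Real.sin θ = 0
  · refine hnondeg.2 ((ae_iff_weight 𝔛).2 fun A hA i => ?_)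
    have hs2 : Real.cos θ ^ 2 = 1 := by have := Real.sin_sq_add_cos_sq θ; rw [hs] at this; linarith
    have h1 : (A.filter fun q => q.2 = i).card = 1 := by
      refine card_filter_eq_one (by omega) hs2 A Prod.snd ?_ i
      filter_upwards [hae] with t ht
      have := ht A hA
      simp only [chord_of_sin_eq_zero hs, digitProj, projXY, hs] at this
      rw [← this]
      refine Finset.sum_congr rfl fun q _ => ?_
      congr 1
      linear_combination ((q.2 : ℕ) : ℝ) * hs2
    obtain ⟨q, hq⟩ := Finset.card_eq_one.1 h1
    have hmem : ∀ q', q' ∈ A ∧ q'.2 = i ↔ q' = q := by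
      intro q'; simpa using Finset.ext_iff.1 hq q'
    obtain ⟨hqA, hqi⟩ := (hmem q).2 rfl
    refine ⟨q.1, by rw [← hqi]; exact hqA, fun j hj => ?_⟩
    rw [← (hmem (j, i)).1 ⟨hj, rfl⟩]
  obtain ⟨i, hi, hi'⟩ := exists_extremal_digit (L := L) (by omega) (-Real.sin θ)
  obtain ⟨j, hj, hj'⟩ := exists_extremal_digit (L := L) (by omega) (Real.cos θ)
  obtain ⟨A, hA, hAq⟩ := exists_weight_ne_zero_notMem hL hm (i, j)
  have hL' : (2 : ℝ) ≤ L := by exact_mod_cast hL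
  -- All squares except the corner square project at least d / L above the lower end, so at heights
  -- within d / L of it their chords vanish.
  set d := min |Real.sin θ| |Real.cos θ| with hd
  have hd0 : 0 < d := lt_min (abs_pos.2 hs) (abs_pos.2 hc)
  have hds : d ≤ |Real.sin θ| := min_le_left _ _
  have hdc : d ≤ |Real.cos θ| := min_le_right _ _
  have hwidth := projHi_sub_projLo θ
  obtain ⟨t, ht, hte⟩ := exists_mem_Ioo_of_ae hae
    (show projLo θ < projLo θ + d / L by linarith [div_pos hd0 (by linarith : (0 : ℝ) < L)])
  have hdL : d / L * L = d := div_mul_cancel₀ _ (by linarith)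
  have hdL' : d / L ≤ d := div_le_self hd0.le (by linarith)
  have hpos := chord_pos (θ := θ) (t := t) ⟨ht.1, by linarith [ht.2]⟩
  rw [← hte A hA, Finset.sum_eq_zero] at hpos
  · exact lt_irrefl _ hpos
  · intro q hq
    refine chord_eq_zero fun hmem => ?_
    have hne : q ≠ (i, j) := fun h => hAq (h ▸ hq)
    have hbound : (L - 1) * projLo θ + d ≤ digitProj θ q := by
      have e1 : (L - 1) * projLo θ = -Real.sin θ * (i : ℕ) + Real.cos θ * (j : ℕ) := by
        rw [hi, hj, projLo]; ring
      have a1 : -Real.sin θ * (i : ℕ) ≤ -Real.sin θ * (q.1 : ℕ) := by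
        by_cases h : q.1 = i
        · rw [h]
        · linarith [hi' q.1 h, abs_nonneg (-Real.sin θ)]
      have a2 : Real.cos θ * (j : ℕ) ≤ Real.cos θ * (q.2 : ℕ) := by
        by_cases h : q.2 = j
        · rw [h]
        · linarith [hj' q.2 h, abs_nonneg (Real.cos θ)]
      rw [e1, digitProj, projXY]
      by_cases h : q.1 = i
      · have h2 : q.2 ≠ j := fun h2 => hne (Prod.ext h h2)
        linarith [hj' q.2 h2]
      · have h3 := hi' q.1 h
        rw [abs_neg] at h3
        linarith
    have h1 := hmem.1
    nlinarith [ht.2]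

end Sections

end

end GridFractal

open MeasureTheory ProbabilityTheory Filter Topology Set

namespace GridFractal

noncomputable section

/-! ### Mixing of the dual transfer operator -/

section Mixing

variable {L : ℕ} {θ : ℝ} {m : Selection L → ℝ}

/-- Only one branch of the iterated average is kept: the one with address `w`, of weight L^(-2n),
which evaluates `g` on the projection of the square `w`. -/
lemma pow_inv_mul_le_iterate_cotransfer (hL : 0 < L) (w : List (Digit L)) {g : ℝ → ℝ} {c : ℝ}
    (h0 : ∀ t, 0 ≤ g t)
    (hg : ∀ x ∈ Icc (0 : ℝ) 1, ∀ y ∈ Icc (0 : ℝ) 1, c ≤ g (projXY θ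
      ((corner w).1 + x / (L : ℝ) ^ w.length) ((corner w).2 + y / (L : ℝ) ^ w.length)))
    {t : ℝ} (ht : t ∈ Icc (projLo θ) (projHi θ)) :
    (((L : ℝ) ^ 2)⁻¹) ^ w.length * c ≤ (cotransfer (digitProj (L := L) θ))^[w.length] g t := by
  have hL' : (0 : ℝ) < L := by exact_mod_cast hL
  induction w generalizing g c with
  | nil =>
    obtain ⟨a, ha, b, hb, rfl⟩ := exists_projXY_eq ht
    simpa [corner] using hg a ha b hb
  | cons q w ih =>
    rw [List.length_cons, Function.iterate_succ_apply, pow_succ, mul_assoc]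
    refine ih (fun t => ?_) fun x hx y hy => ?_
    · exact mul_nonneg (by positivity) (Finset.sum_nonneg fun q _ => h0 _)
    · have h1 := hg x hx y hy
      unfold cotransfer
      refine mul_le_mul_of_nonneg_left (h1.trans ?_) (by positivity)
      refine le_trans (le_of_eq ?_) (Finset.single_le_sum (f := fun q : Digit L => g ((projXY θ
        ((corner w).1 + x / (L : ℝ) ^ w.length) ((corner w).2 + y / (L : ℝ) ^ w.length) +
          digitProj θ q) / L)) (fun q _ => h0 _) (Finset.mem_univ q))
      congr 1
      simp only [corner, List.length_cons, digitProj, projXY, pow_succ]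
      field_simp
      ring

lemma exists_corner (hL : 0 < L) (n : ℕ) {a b : ℝ} (ha : a ∈ Ico (0 : ℝ) 1) (hb : b ∈ Ico (0 : ℝ) 1) :
    ∃ w : List (Digit L), w.length = n ∧ ∃ x ∈ Ico (0 : ℝ) 1, ∃ y ∈ Ico (0 : ℝ) 1,
      a = (corner w).1 + x / (L : ℝ) ^ n ∧ b = (corner w).2 + y / (L : ℝ) ^ n := by
  have hL' : (0 : ℝ) < L := by exact_mod_cast hL
  induction n generalizing a b with
  | zero => exact ⟨[], rfl, a, ha, b, hb, by simp [corner], by simp [corner]⟩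
  | succ n ih =>
    have key : ∀ c ∈ Ico (0 : ℝ) 1, ∃ i : Fin L, L * c - (i : ℕ) ∈ Ico (0 : ℝ) 1 := by
      intro c hc
      have h0 : 0 ≤ L * c := mul_nonneg hL'.le hc.1
      refine ⟨⟨⌊L * c⌋₊, (Nat.floor_lt h0).2 (by nlinarith [hc.2])⟩, ?_, ?_⟩
      · simpa using Nat.floor_le h0
      · have := Nat.lt_floor_add_one (L * c)
        simp only
        linarith
    obtain ⟨i, hi⟩ := key a ha
    obtain ⟨j, hj⟩ := key b hb
    obtain ⟨w, hw, x, hx, y, hy, h1, h2⟩ := ih hi hj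
    refine ⟨(i, j) :: w, by rw [List.length_cons, hw], x, hx, y, hy, ?_, ?_⟩
    · rw [corner, pow_succ, ← div_div, ← add_div, eq_div_iff hL'.ne']
      simp only
      linarith
    · rw [corner, pow_succ, ← div_div, ← add_div, eq_div_iff hL'.ne']
      simp only
      linarith

/-- Otherwise one chord in each product vanishes, except at the finitely many heights through an end
of the projection of a square, and V would be 0. -/
lemma exists_overlap (hL : 2 ≤ L)
    (hV : 0 < ∫ t, pairing m (digitProj θ) (chord θ) (chord θ) t) :
    ∃ q q' : Digit L, pairProb m q q' ≠ 0 ∧ ∃ τ ∈ Ioo (projLo θ) (projHi θ),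
      τ + (digitProj θ q - digitProj θ q') ∈ Ioo (projLo θ) (projHi θ) := by
  by_contra! hcon
  have hL' : (0 : ℝ) < L := by exact_mod_cast (by omega : 0 < L)
  refine hV.ne' ?_
  have hne : ∀ a : ℝ, ∀ q : Digit L, ∀ᵐ t : ℝ, L * t - digitProj θ q ≠ a := by
    intro a q
    have : ∀ᵐ t : ℝ, t ≠ (a + digitProj θ q) / L := by simp [ae_iff]
    filter_upwards [this] with t ht h
    apply ht
    rw [eq_div_iff hL'.ne']
    linarith
  have h0 : ∀ᵐ t : ℝ, pairing m (digitProj θ) (chord θ) (chord θ) t = 0 := by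
    filter_upwards [ae_all_iff.2 (hne (projLo θ)), ae_all_iff.2 (hne (projHi θ))] with t h1 h2
    refine Finset.sum_eq_zero fun q _ => Finset.sum_eq_zero fun q' _ => ?_
    by_cases hP : pairProb m q q' = 0
    · rw [hP, zero_mul]
    have hz : ∀ q : Digit L, L * t - digitProj θ q ∉ Ioo (projLo θ) (projHi θ) →
        chord θ (L * t - digitProj θ q) = 0 := fun q hq => chord_eq_zero fun hm =>
      hq ⟨lt_of_le_of_ne hm.1 (h1 q).symm, lt_of_le_of_ne hm.2 (h2 q)⟩
    by_cases hm : L * t - digitProj θ q ∈ Ioo (projLo θ) (projHi θ)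
    · have := hcon q q' hP _ hm
      rw [sub_add_sub_cancel] at this
      rw [hz q' this, mul_zero, mul_zero]
    · rw [hz q hm, zero_mul, mul_zero]
  rw [integral_congr_ae h0, integral_zero]

/-- The dual transfer operator spreads the overlaps over the whole projection, uniformly for nearby
directions. -/
lemma eventually_le_iterate_cotransfer (hL : 2 ≤ L) (hm : IsUniformWeight m) (θ₀ : ℝ)
    (hV : 0 < ∫ t, pairing m (digitProj θ₀) (chord θ₀) (chord θ₀) t) :
    ∃ i : ℕ, ∃ c > 0, ∀ᶠ θ in 𝓝 θ₀, ∀ t ∈ Icc (projLo θ) (projHi θ),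
      c ≤ (cotransfer (digitProj (L := L) θ))^[i] (pairDensity m (digitProj θ) (chord θ)) t := by
  have hL' : (0 : ℝ) < L := by exact_mod_cast (by omega : 0 < L)
  have hL2 : (2 : ℝ) ≤ L := by exact_mod_cast hL
  obtain ⟨q, q', hP, τ, hτ, hτ'⟩ := exists_overlap hL hV
  have hPpos : 0 < pairProb m q q' := lt_of_le_of_ne (pairProb_nonneg hm q q') hP.symm
  obtain ⟨a₀, ha₀, b₀, hb₀, hab₀⟩ := exists_interior hτ
  obtain ⟨a₁, ha₁, b₁, hb₁, hab₁⟩ := exists_interior hτ'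
  -- The two points have the same height, so after translation by q - q' they differ by a multiple σ
  -- of the direction vector. Sliding by σ along the line also works for nearby points and
  -- directions, which is what `A` and `B` record.
  set d₁ := a₁ - a₀ - ((q.1 : ℕ) - (q'.1 : ℕ)) with hd₁
  set d₂ := b₁ - b₀ - ((q.2 : ℕ) - (q'.2 : ℕ)) with hd₂
  have hd : projXY θ₀ d₁ d₂ = 0 := by
    have : projXY θ₀ a₁ b₁ = projXY θ₀ a₀ b₀ + (digitProj θ₀ q - digitProj θ₀ q') := by
      rw [hab₀, hab₁]
    unfold digitProj projXY at this
    rw [hd₁, hd₂, projXY]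
    linarith
  set σ := Real.cos θ₀ * d₁ + Real.sin θ₀ * d₂ with hσ
  have hσ1 : σ * Real.cos θ₀ = d₁ := by
    rw [hσ]; unfold projXY at hd
    linear_combination Real.sin θ₀ * hd + d₁ * Real.sin_sq_add_cos_sq θ₀
  have hσ2 : σ * Real.sin θ₀ = d₂ := by
    rw [hσ]; unfold projXY at hd
    linear_combination -Real.cos θ₀ * hd + d₂ * Real.sin_sq_add_cos_sq θ₀
  obtain ⟨r, hr0, hra, hrb⟩ : ∃ r > 0, a₁ ∈ Ioo r (1 - r) ∧ b₁ ∈ Ioo r (1 - r) := by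
    have h1 : 0 < min (min a₁ (1 - a₁)) (min b₁ (1 - b₁)) := by
      simp only [lt_min_iff, sub_pos]; exact ⟨⟨ha₁.1, ha₁.2⟩, hb₁.1, hb₁.2⟩
    have h2 := half_lt_self h1
    simp only [lt_min_iff] at h2
    exact ⟨_, half_pos h1, ⟨h2.1.1, by linarith [h2.1.2]⟩, h2.2.1, by linarith [h2.2.2]⟩
  let A : ℝ × ℝ × ℝ → ℝ := fun z => z.2.1 + ((q.1 : ℕ) - (q'.1 : ℕ)) + σ * Real.cos z.1
  let B : ℝ × ℝ × ℝ → ℝ := fun z => z.2.2 + ((q.2 : ℕ) - (q'.2 : ℕ)) + σ * Real.sin z.1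
  have hA : Continuous A := by fun_prop
  have hB : Continuous B := by fun_prop
  have hA0 : A (θ₀, a₀, b₀) = a₁ := by simp only [A, hσ1, hd₁]; ring
  have hB0 : B (θ₀, a₀, b₀) = b₁ := by simp only [B, hσ2, hd₂]; ring
  have hev : ∀ᶠ z in 𝓝 (θ₀, a₀, b₀), A z ∈ Ioo r (1 - r) ∧ B z ∈ Ioo r (1 - r) :=
    (hA.continuousAt.eventually_mem (by rw [hA0]; exact Ioo_mem_nhds hra.1 hra.2)).and
      (hB.continuousAt.eventually_mem (by rw [hB0]; exact Ioo_mem_nhds hrb.1 hrb.2))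
  rw [nhds_prod_eq] at hev
  obtain ⟨U, hU, W, hW, hUW⟩ := Filter.eventually_prod_iff.1 hev
  obtain ⟨ε, hε, hball⟩ := Metric.eventually_nhds_iff.1 hW
  -- The level n is taken so fine that the L-adic square around (a₀, b₀) lies in the neighbourhood
  -- of good points.
  obtain ⟨n, hn⟩ := exists_pow_lt_of_lt_one hε (inv_lt_one_of_one_lt₀ (by linarith) : (L : ℝ)⁻¹ < 1)
  obtain ⟨w, hw, x₀, hx₀, y₀, hy₀, hax, hby⟩ := exists_corner (L := L) (by omega) n
    (Ioo_subset_Ico_self ha₀) (Ioo_subset_Ico_self hb₀)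
  refine ⟨w.length, (((L : ℝ) ^ 2)⁻¹) ^ w.length * ((L : ℝ)⁻¹ * (pairProb m q q' * r)),
    by positivity, ?_⟩
  filter_upwards [hU] with θ hθ t ht
  refine pow_inv_mul_le_iterate_cotransfer (by omega) w
    (pairDensity_nonneg hm (chord_nonneg θ)) (fun x hx y hy => ?_) ht
  rw [hw]
  set a := (corner w).1 + x / (L : ℝ) ^ n with ha
  set b := (corner w).2 + y / (L : ℝ) ^ n with hb
  have hclose : ∀ u v : ℝ, u ∈ Icc (0 : ℝ) 1 → v ∈ Ico (0 : ℝ) 1 → ∀ k : ℝ,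
      dist (k + u / (L : ℝ) ^ n) (k + v / (L : ℝ) ^ n) < ε := by
    intro u v hu hv k
    refine lt_of_le_of_lt ?_ hn
    rw [Real.dist_eq, add_sub_add_left_eq_sub, ← sub_div, abs_div, abs_of_pos (by positivity :
      (0 : ℝ) < (L : ℝ) ^ n), inv_pow, ← one_div]
    gcongr
    rw [abs_le]
    exact ⟨by linarith [hu.1, hv.2], by linarith [hu.2, hv.1]⟩
  have hmem := hUW hθ (hball (y := (a, b)) (by
    rw [Prod.dist_eq, max_lt_iff]
    rw [hax, hby]
    exact ⟨hclose x x₀ hx hx₀ _, hclose y y₀ hy hy₀ _⟩))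
  have hproj : projXY θ (A (θ, a, b)) (B (θ, a, b)) =
      projXY θ a b + (digitProj θ q - digitProj θ q') := by
    simp only [A, B, digitProj, projXY]; ring
  have hr := le_chord (θ := θ) hr0.le hmem.1 hmem.2
  rw [hproj] at hr
  unfold pairDensity
  refine mul_le_mul_of_nonneg_left ?_ (by positivity)
  calc pairProb m q q' * r ≤ pairProb m q q' *
        chord θ (projXY θ a b + (digitProj θ q - digitProj θ q')) :=
        mul_le_mul_of_nonneg_left hr hPpos.le
    _ ≤ ∑ q', pairProb m q q' * chord θ (projXY θ a b + (digitProj θ q - digitProj θ q')) :=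
        Finset.single_le_sum (f := fun q' => pairProb m q q' *
          chord θ (projXY θ a b + (digitProj θ q - digitProj θ q')))
          (fun _ _ => mul_nonneg (pairProb_nonneg hm _ _) (chord_nonneg _ _)) (Finset.mem_univ q')
    _ ≤ _ :=
        Finset.single_le_sum (f := fun q => ∑ q', pairProb m q q' *
          chord θ (projXY θ a b + (digitProj θ q - digitProj θ q')))
          (fun _ _ => Finset.sum_nonneg fun _ _ =>
            mul_nonneg (pairProb_nonneg hm _ _) (chord_nonneg _ _)) (Finset.mem_univ q)

/-- The mean length of the projections of the level `n` approximation in direction `θ`. -/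
def projLength (m : Selection L → ℝ) (n : ℕ) (θ : ℝ) : ℝ :=
  meanLength m (digitProj θ) (projLo θ) (projHi θ) n

lemma measurable_projLo : Measurable projLo := by unfold projLo; fun_prop

lemma measurable_projHi : Measurable projHi := by unfold projHi; fun_prop

lemma measurable_digitProj (q : Digit L) : Measurable fun θ => digitProj θ q := by
  unfold digitProj projXY; fun_prop

lemma measurable_hitProb_prod (m : Selection L → ℝ) (n : ℕ) : Measurable fun z : ℝ × ℝ =>
    hitProb m (digitProj z.1) (projLo z.1) (projHi z.1) n z.2 := by
  induction n with
  | zero =>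
    have h : MeasurableSet {z : ℝ × ℝ | projLo z.1 ≤ z.2 ∧ z.2 ≤ projHi z.1} :=
      (measurableSet_le (measurable_projLo.comp measurable_fst) measurable_snd).inter
        (measurableSet_le measurable_snd (measurable_projHi.comp measurable_fst))
    exact measurable_const.indicator (f := fun _ => (1 : ℝ)) h
  | succ n ih =>
    simp only [hitProb_succ, survive]
    refine Finset.measurable_sum _ fun A _ => Measurable.const_mul (measurable_const.sub
      (Finset.measurable_prod _ fun q _ => measurable_const.sub ?_)) _
    exact ih.comp (measurable_fst.prodMk ((measurable_snd.const_mul _).sub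
      ((measurable_digitProj q).comp measurable_fst)))

lemma measurable_projLength (m : Selection L → ℝ) (n : ℕ) : Measurable (projLength m n) :=
  ((measurable_hitProb_prod m n).stronglyMeasurable.integral_prod_right).measurable

lemma measurable_V (hL : 2 ≤ L) (𝔛 : Measure (Selection L)) [IsProbabilityMeasure 𝔛]
    (hunif : IsUniform 𝔛) : Measurable (V 𝔛) := by
  have h1 : Measurable fun z : ℝ × ℝ =>
      pairing (weight 𝔛) (digitProj z.1) (chord z.1) (chord z.1) z.2 := by
    have hq : ∀ q : Digit L, Measurable fun z : ℝ × ℝ => chord z.1 (L * z.2 - digitProj z.1 q) :=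
      fun q => measurable_chord.comp (measurable_fst.prodMk ((measurable_snd.const_mul _).sub
        ((measurable_digitProj q).comp measurable_fst)))
    exact Finset.measurable_sum _ fun q _ => Finset.measurable_sum _ fun q' _ =>
      ((hq q).mul (hq q')).const_mul _
  have h2 := (h1.stronglyMeasurable.integral_prod_right' (ν := volume)).measurable
  rw [show V 𝔛 = _ from funext (V_eq hL 𝔛 hunif)]
  exact h2

/-- Near each direction the mixing holds with the same `i` and `c`, on which alone, besides `L`, the
constants of `exists_meanLength_bound` depend. It also gives c ≤ V, because V is the average of the
mixed density with respect to the chord. Compactness makes these local bounds global. -/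
lemma exists_uniform_bound (hL : 2 ≤ L) (𝔛 : Measure (Selection L)) [IsProbabilityMeasure 𝔛]
    (hunif : IsUniform 𝔛) (hnondeg : IsNondegenerate 𝔛) :
    ∃ v > 0, ∃ C > 0, ∀ θ ∈ Icc 0 Real.pi, v ≤ V 𝔛 θ ∧ ∀ n : ℕ,
      n * projLength (weight 𝔛) n θ ≤ C ∧ (n : ℝ) ^ 2 *
        (projLength (weight 𝔛) n θ - projLength (weight 𝔛) (n + 1) θ) ≤ C := by
  have hm := isUniformWeight_weight 𝔛 hunif
  refine isCompact_Icc.induction_on (p := fun s => ∃ v > 0, ∃ C > 0, ∀ θ ∈ s, v ≤ V 𝔛 θ ∧ ∀ n : ℕ,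
      n * projLength (weight 𝔛) n θ ≤ C ∧ (n : ℝ) ^ 2 *
        (projLength (weight 𝔛) n θ - projLength (weight 𝔛) (n + 1) θ) ≤ C) ?_ ?_ ?_ ?_
  · exact ⟨1, one_pos, 1, one_pos, by simp⟩
  · rintro s t hst ⟨v, hv, C, hC, h⟩
    exact ⟨v, hv, C, hC, fun θ hθ => h θ (hst hθ)⟩
  · rintro s t ⟨v, hv, C, hC, h⟩ ⟨v', hv', C', hC', h'⟩
    refine ⟨min v v', lt_min hv hv', max C C', lt_max_of_lt_left hC, fun θ hθ => ?_⟩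
    rcases hθ with hθ | hθ
    · exact ⟨(min_le_left _ _).trans (h θ hθ).1, fun n =>
        ⟨((h θ hθ).2 n).1.trans (le_max_left _ _), ((h θ hθ).2 n).2.trans (le_max_left _ _)⟩⟩
    · exact ⟨(min_le_right _ _).trans (h' θ hθ).1, fun n =>
        ⟨((h' θ hθ).2 n).1.trans (le_max_right _ _), ((h' θ hθ).2 n).2.trans (le_max_right _ _)⟩⟩
  · intro θ₀ _
    have hV := V_pos hL 𝔛 hunif hnondeg θ₀
    rw [V_eq hL 𝔛 hunif] at hV
    obtain ⟨i, c, hc, hev⟩ := eventually_le_iterate_cotransfer hL hm θ₀ hV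
    obtain ⟨C, hC, hbound⟩ := exists_meanLength_bound L i hc
    have hL' : (0 : ℝ) < L := by exact_mod_cast (by omega : 0 < L)
    refine ⟨_, nhdsWithin_le_nhds hev, c, hc, max C (10 * (L : ℝ) ^ 3 * C),
      lt_max_of_lt_left hC, fun θ hθ => ⟨?_, fun n => ?_⟩⟩
    · have S := lineSystem hL θ
      have hgm := measurable_pairDensity (m := weight 𝔛) (κ := digitProj θ) S.nice.measurable
      have hgb := abs_pairDensity_le hm S
      have h1 := integral_iterate_transfer_mul S S.nice hgm hgb i
      rw [iterate_transfer_eq S] at h1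
      rw [V_eq hL 𝔛 hunif, integral_pairing S S.nice S.nice, h1]
      have hb := iterate_cotransfer_bounded (κ := digitProj θ) hL' hgm hgb i
      calc c = ∫ t, chord θ t * c := by rw [integral_mul_const, S.integral_eq, one_mul]
        _ ≤ _ := integral_mono (S.nice.integrable.mul_const c)
            (S.nice.mul_bounded hb.1 hb.2).integrable fun t => by
              by_cases ht : t ∈ Icc (projLo θ) (projHi θ)
              · exact mul_le_mul_of_nonneg_left (hθ t ht) (S.nonneg t)
              · simp [S.nice.eq_zero t ht]
    · have S := lineSystem hL θ
      obtain ⟨h1, h2⟩ := hbound _ _ _ _ _ S hm hθ n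
      refine ⟨h1.trans (le_max_left _ _), le_trans ?_ (le_max_right _ _)⟩
      have h3 := meanLength_sub_succ_le S hm n
      calc _ ≤ (n : ℝ) ^ 2 * _ := mul_le_mul_of_nonneg_left h3 (by positivity)
        _ = 10 * (L : ℝ) ^ 3 * ((n : ℝ) ^ 2 * _) := by ring
        _ ≤ _ := mul_le_mul_of_nonneg_left h2 (by positivity)

/-! ### Directions which are not parallel to the axes -/

lemma continuousAt_unitInd {x : ℝ} (h0 : x ≠ 0) (h1 : x ≠ 1) : ContinuousAt unitInd x := by
  have : frontier (Ico (0 : ℝ) 1) = {0, 1} := frontier_Ico zero_lt_one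
  exact (continuous_const (y := (1 : ℝ))).continuousOn.continuousAt_indicator (by simp [this, h0, h1])

/-- A line not parallel to the sides crosses each side line in one point, so the indicator functions
converge off a null set. In an axis-parallel direction the chord is an indicator function and jumps.
-/
lemma continuous_chord (hs : Real.sin θ ≠ 0) (hc : Real.cos θ ≠ 0) : Continuous (chord θ) := by
  refine continuous_iff_continuousAt.2 fun t => ?_
  refine continuousAt_of_dominated (bound := (Icc (min 0 (Real.cos θ) + min 0 (Real.sin θ))
      (max 0 (Real.cos θ) + max 0 (Real.sin θ))).indicator fun _ => (1 : ℝ))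
    (Eventually.of_forall fun t => (measurable_unitBox_right θ t).aestronglyMeasurable)
    (Eventually.of_forall fun t => Eventually.of_forall fun s => ?_)
    (integrable_indicator_Icc _ _) ?_
  · rw [Real.norm_of_nonneg (unitBox_nonneg θ t s)]
    exact unitBox_le_indicator θ t s
  · have hne : ∀ u v a : ℝ, v ≠ 0 → ∀ᵐ s : ℝ, t * u + s * v ≠ a := by
      intro u v a hv
      have : ∀ᵐ s : ℝ, s ≠ (a - t * u) / v := by simp [ae_iff]
      filter_upwards [this] with s hs h
      apply hs
      rw [eq_div_iff hv]
      linarith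
    filter_upwards [hne (-Real.sin θ) _ 0 hc, hne (-Real.sin θ) _ 1 hc, hne (Real.cos θ) _ 0 hs,
      hne (Real.cos θ) _ 1 hs] with s h1 h2 h3 h4
    refine ContinuousAt.mul ?_ ?_
    · refine ContinuousAt.comp (g := unitInd) (f := fun t => lineX θ t s)
        (continuousAt_unitInd h1 h2) ?_
      unfold lineX; fun_prop
    · refine ContinuousAt.comp (g := unitInd) (f := fun t => lineY θ t s)
        (continuousAt_unitInd h3 h4) ?_
      unfold lineY; fun_prop

/-- Each dual step averages values at points brought closer by the factor L, so an oscillation bound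
at scale d becomes one at scale d Lⁱ. -/
lemma iterate_cotransfer_sub_le {κ : Digit L → ℝ} {g : ℝ → ℝ} {d ε : ℝ} (hL : (0 : ℝ) < L)
    (h : ∀ t t', |t - t'| ≤ d → g t - g t' ≤ ε) (i : ℕ) {t t' : ℝ}
    (ht : |t - t'| ≤ d * (L : ℝ) ^ i) :
    (cotransfer κ)^[i] g t - (cotransfer κ)^[i] g t' ≤ ε := by
  induction i generalizing t t' with
  | zero => exact h t t' (by simpa using ht)
  | succ i ih =>
    rw [Function.iterate_succ_apply', cotransfer, cotransfer, ← mul_sub, ← Finset.sum_sub_distrib]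
    have h1 : ∀ q : Digit L, (cotransfer κ)^[i] g ((t + κ q) / L) -
        (cotransfer κ)^[i] g ((t' + κ q) / L) ≤ ε := fun q => ih (by
      rw [← sub_div, add_sub_add_right_eq_sub, abs_div, abs_of_pos hL, div_le_iff₀ hL, mul_assoc,
        ← pow_succ]
      exact ht)
    calc _ ≤ ((L : ℝ) ^ 2)⁻¹ * ∑ _q : Digit L, ε :=
          mul_le_mul_of_nonneg_left (Finset.sum_le_sum fun q _ => h1 q) (by positivity)
      _ = ε := by
          rw [Finset.sum_const, nsmul_eq_mul, card_digit]; field_simp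

/-- After enough steps the density oscillates by at most δ on the whole projection. Its average
against the chord is V at every step, by duality and invariance of the chord. -/
lemma exists_sharp_mixing (hL : 2 ≤ L) (hm : IsUniformWeight m) (hs : Real.sin θ ≠ 0)
    (hc : Real.cos θ ≠ 0) {δ : ℝ} (hδ : 0 < δ) : ∃ i, ∀ t ∈ Icc (projLo θ) (projHi θ),
      (∫ t, pairing m (digitProj θ) (chord θ) (chord θ) t) - δ ≤
        (cotransfer (digitProj (L := L) θ))^[i] (pairDensity m (digitProj θ) (chord θ)) t := by
  have hL' : (0 : ℝ) < L := by exact_mod_cast (by omega : 0 < L)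
  have hL2 : (2 : ℝ) ≤ L := by exact_mod_cast hL
  have S := lineSystem hL θ
  have hu : UniformContinuous (chord θ) := by
    refine (HasCompactSupport.intro isCompact_Icc fun t ht =>
      chord_eq_zero (θ := θ) ht).uniformContinuous_of_continuous (continuous_chord hs hc)
  have hgu : UniformContinuous (pairDensity m (digitProj θ) (chord θ)) := by
    have h1 : ∀ q q' : Digit L, UniformContinuous fun τ =>
        (L : ℝ)⁻¹ * (pairProb m q q' * chord θ (τ + (digitProj θ q - digitProj θ q'))) :=
      fun q q' => (Real.uniformContinuous_const_mul.comp (Real.uniformContinuous_const_mul.comp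
        (hu.comp (uniformContinuous_id.add uniformContinuous_const))))
    have h2 : pairDensity m (digitProj θ) (chord θ) = fun τ => ∑ z : Digit L × Digit L,
        (L : ℝ)⁻¹ * (pairProb m z.1 z.2 * chord θ (τ + (digitProj θ z.1 - digitProj θ z.2))) := by
      ext τ
      simp only [pairDensity, Finset.mul_sum]
      exact (Fintype.sum_prod_type fun z : Digit L × Digit L => (L : ℝ)⁻¹ * (pairProb m z.1 z.2 *
        chord θ (τ + (digitProj θ z.1 - digitProj θ z.2)))).symm
    rw [h2]
    classical
    have h3 : ∀ s : Finset (Digit L × Digit L), UniformContinuous fun τ => ∑ z ∈ s,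
        (L : ℝ)⁻¹ * (pairProb m z.1 z.2 * chord θ (τ + (digitProj θ z.1 - digitProj θ z.2))) := by
      intro s
      induction s using Finset.induction_on with
      | empty => simpa using uniformContinuous_const
      | insert z s hz ih => simp only [Finset.sum_insert hz]; exact (h1 z.1 z.2).add ih
    exact h3 _
  obtain ⟨d, hd, hdε⟩ := Metric.uniformContinuous_iff.1 hgu δ hδ
  obtain ⟨i, hi⟩ := pow_unbounded_of_one_lt (2 / (d / 2)) (by linarith : (1 : ℝ) < L)
  refine ⟨i, fun t ht => ?_⟩
  have hosc : ∀ τ ∈ Icc (projLo θ) (projHi θ),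
      (cotransfer (digitProj (L := L) θ))^[i] (pairDensity m (digitProj θ) (chord θ)) τ -
        (cotransfer (digitProj (L := L) θ))^[i] (pairDensity m (digitProj θ) (chord θ)) t ≤ δ := by
    intro τ hτ
    refine iterate_cotransfer_sub_le hL' (d := d / 2) (fun t t' htt => ?_) i ?_
    · have := hdε (a := t) (b := t') (by rw [Real.dist_eq]; linarith)
      rw [Real.dist_eq] at this
      exact (le_abs_self _).trans this.le
    · have h2 := projHi_sub_projLo_le θ
      rw [div_lt_iff₀ (by positivity)] at hi
      rw [abs_le]
      constructor <;> linarith [ht.1, ht.2, hτ.1, hτ.2]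
  have hgm := measurable_pairDensity (m := m) (κ := digitProj θ) S.nice.measurable
  have hgb := abs_pairDensity_le hm S
  have h1 := integral_iterate_transfer_mul S S.nice hgm hgb i
  have hb := iterate_cotransfer_bounded (κ := digitProj θ) hL' hgm hgb i
  rw [iterate_transfer_eq S] at h1
  rw [integral_pairing S S.nice S.nice, h1, sub_le_iff_le_add]
  set G := (cotransfer (digitProj (L := L) θ))^[i] (pairDensity m (digitProj θ) (chord θ)) with hG
  calc ∫ τ, chord θ τ * G τ ≤ ∫ τ, chord θ τ * (G t + δ) :=
        integral_mono (S.nice.mul_bounded hb.1 hb.2).integrable (S.nice.integrable.mul_const _)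
          fun τ => by
            by_cases hτ : τ ∈ Icc (projLo θ) (projHi θ)
            · exact mul_le_mul_of_nonneg_left (by linarith [hosc τ hτ]) (S.nonneg τ)
            · simp [S.nice.eq_zero τ hτ]
    _ = G t + δ := by rw [integral_mul_const, S.integral_eq, one_mul]

lemma tendsto_mul_projLength (hL : 2 ≤ L) (𝔛 : Measure (Selection L)) [IsProbabilityMeasure 𝔛]
    (hunif : IsUniform 𝔛) (hnondeg : IsNondegenerate 𝔛) (hs : Real.sin θ ≠ 0)
    (hc : Real.cos θ ≠ 0) {C : ℝ} (hC : ∀ n : ℕ, n * projLength (weight 𝔛) n θ ≤ C) :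
    Tendsto (fun n : ℕ => n * projLength (weight 𝔛) n θ) atTop (𝓝 (2 / V 𝔛 θ)) := by
  have hV := V_pos hL 𝔛 hunif hnondeg θ
  have hm := isUniformWeight_weight 𝔛 hunif
  have S := lineSystem hL θ
  rw [V_eq hL 𝔛 hunif] at hV ⊢
  exact tendsto_order.2 ⟨fun x hx => eventually_lt_mul_meanLength S hm hV hC hx, fun x hx =>
    eventually_mul_meanLength_lt S hm hV (fun δ hδ => exists_sharp_mixing hL hm hs hc hδ) hx⟩

lemma ae_sin_ne_zero_and_cos_ne_zero :
    ∀ᵐ θ : ℝ, Real.sin θ ≠ 0 ∧ Real.cos θ ≠ 0 := by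
  have h1 : ∀ᵐ θ : ℝ, ∀ n : ℤ, θ ≠ n * Real.pi :=
    ae_all_iff.2 fun n => by simp [ae_iff]
  have h2 : ∀ᵐ θ : ℝ, ∀ n : ℤ, θ ≠ (2 * n + 1) * Real.pi / 2 :=
    ae_all_iff.2 fun n => by simp [ae_iff]
  filter_upwards [h1, h2] with θ h1 h2
  refine ⟨fun h => ?_, fun h => ?_⟩
  · obtain ⟨n, hn⟩ := Real.sin_eq_zero_iff.1 h
    exact h1 n hn.symm
  · obtain ⟨n, hn⟩ := Real.cos_eq_zero_iff.1 h
    exact h2 n hn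

lemma intervalIntegrable_two_div_V (hL : 2 ≤ L) (𝔛 : Measure (Selection L)) [IsProbabilityMeasure 𝔛]
    (hunif : IsUniform 𝔛) (hnondeg : IsNondegenerate 𝔛) :
    IntervalIntegrable (fun θ => 2 / V 𝔛 θ) volume 0 Real.pi := by
  obtain ⟨v, hv, C, -, h⟩ := exists_uniform_bound hL 𝔛 hunif hnondeg
  rw [intervalIntegrable_iff_integrableOn_Ioc_of_le Real.pi_pos.le]
  refine Measure.integrableOn_of_bounded (M := 2 / v) (by simp)
    (measurable_const.div (measurable_V hL 𝔛 hunif)).aestronglyMeasurable ?_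
  filter_upwards [ae_restrict_mem measurableSet_Ioc] with θ hθ
  have h1 := (h θ (Ioc_subset_Icc_self hθ)).1
  rw [Real.norm_of_nonneg (div_nonneg zero_le_two (hv.le.trans h1))]
  gcongr

/-- The mean Favard length of the level `n` approximation (shifted by one level). -/
def meanFavard (m : Selection L → ℝ) (n : ℕ) : ℝ := ∫ θ in (0 : ℝ)..Real.pi, projLength m n θ

lemma projLength_mem (hL : 2 ≤ L) (hm : IsUniformWeight m) (n : ℕ) (θ : ℝ) :
    projLength m n θ ∈ Icc (0 : ℝ) 2 := by
  have S := lineSystem hL θ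
  refine ⟨meanLength_nonneg hm n, (meanLength_antitone S hm (Nat.zero_le n)).trans ?_⟩
  rw [meanLength_zero S]
  exact projHi_sub_projLo_le θ

lemma intervalIntegrable_projLength (hL : 2 ≤ L) (hm : IsUniformWeight m) (n : ℕ) :
    IntervalIntegrable (projLength m n) volume 0 Real.pi := by
  rw [intervalIntegrable_iff_integrableOn_Ioc_of_le Real.pi_pos.le]
  refine Measure.integrableOn_of_bounded (M := 2) (by simp)
    (measurable_projLength m n).aestronglyMeasurable (Eventually.of_forall fun θ => ?_)
  have := projLength_mem hL hm n θ
  rw [Real.norm_of_nonneg this.1]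
  exact this.2

/-- Dominated convergence: the bound holds in all directions, the pointwise limit is needed only off
the axis-parallel ones. -/
theorem tendsto_mul_meanFavard (hL : 2 ≤ L) (𝔛 : Measure (Selection L)) [IsProbabilityMeasure 𝔛]
    (hunif : IsUniform 𝔛) (hnondeg : IsNondegenerate 𝔛) :
    Tendsto (fun n : ℕ => n * meanFavard (weight 𝔛) n) atTop
      (𝓝 (∫ θ in (0 : ℝ)..Real.pi, 2 / V 𝔛 θ)) := by
  have hm := isUniformWeight_weight 𝔛 hunif
  obtain ⟨v, hv, C, -, h⟩ := exists_uniform_bound hL 𝔛 hunif hnondeg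
  simp only [meanFavard, ← intervalIntegral.integral_const_mul]
  refine intervalIntegral.tendsto_integral_filter_of_dominated_convergence (fun _ => C)
    (Eventually.of_forall fun n =>
      ((measurable_projLength _ n).const_mul _).aestronglyMeasurable)
    (Eventually.of_forall fun n => Eventually.of_forall fun θ hθ => ?_)
    intervalIntegrable_const ?_
  · rw [uIoc_of_le Real.pi_pos.le] at hθ
    rw [Real.norm_of_nonneg (mul_nonneg (Nat.cast_nonneg _) (projLength_mem hL hm n θ).1)]
    exact ((h θ (Ioc_subset_Icc_self hθ)).2 n).1
  · filter_upwards [ae_sin_ne_zero_and_cos_ne_zero] with θ hθ hmem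
    rw [uIoc_of_le Real.pi_pos.le] at hmem
    exact tendsto_mul_projLength hL 𝔛 hunif hnondeg hθ.1 hθ.2
      fun n => ((h θ (Ioc_subset_Icc_self hmem)).2 n).1

lemma meanFavard_sub_succ_le (hL : 2 ≤ L) (𝔛 : Measure (Selection L)) [IsProbabilityMeasure 𝔛]
    (hunif : IsUniform 𝔛) (hnondeg : IsNondegenerate 𝔛) :
    ∃ C, 0 < C ∧ ∀ n : ℕ, (n : ℝ) ^ 2 *
      (meanFavard (weight 𝔛) n - meanFavard (weight 𝔛) (n + 1)) ≤ C := by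
  have hm := isUniformWeight_weight 𝔛 hunif
  obtain ⟨v, hv, C, hC, h⟩ := exists_uniform_bound hL 𝔛 hunif hnondeg
  refine ⟨Real.pi * C, mul_pos Real.pi_pos hC, fun n => ?_⟩
  have h1 := intervalIntegrable_projLength hL hm n
  have h2 := intervalIntegrable_projLength hL hm (n + 1)
  rw [meanFavard, meanFavard, ← intervalIntegral.integral_sub h1 h2,
    ← intervalIntegral.integral_const_mul]
  refine (intervalIntegral.integral_mono_on Real.pi_pos.le ((h1.sub h2).const_mul _)
    (intervalIntegrable_const (c := C)) fun θ hθ => ((h θ hθ).2 n).2).trans ?_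
  simp

end Mixing

end

end GridFractal

open MeasureTheory ProbabilityTheory Filter Topology Set

namespace GridFractal

noncomputable section

/-! ### The branching structure -/

section Branching

variable {L : ℕ} {𝔛 : Measure (Selection L)}

/-- The selections used in all squares of all levels. -/
abbrev Env (L : ℕ) : Type := List (Digit L) → Selection L

/-- The selections used inside the square `[q]`, rescaled. -/
def child (x : Env L) (q : Digit L) : Env L := fun w => x (q :: w)

/-- Independent selections with law `𝔛`. -/
def envMeasure (𝔛 : Measure (Selection L)) : Measure (Env L) := Measure.infinitePi fun _ => 𝔛

instance [IsProbabilityMeasure 𝔛] : IsProbabilityMeasure (envMeasure 𝔛) := by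
  unfold envMeasure; infer_instance

/-- The selections given by one in the unit square and families in the squares of level one. -/
def graft (z : Selection L × (Digit L → Env L)) : Env L
  | [] => z.1
  | q :: w => z.2 q w

lemma measurable_graft : Measurable (graft (L := L)) := by
  refine measurable_pi_lambda _ fun w => ?_
  cases w with
  | nil => exact measurable_fst
  | cons q w => exact (measurable_pi_apply w).comp ((measurable_pi_apply q).comp measurable_snd)

lemma measurable_child (q : Digit L) : Measurable fun x : Env L => child x q :=
  measurable_pi_lambda _ fun _ => measurable_pi_apply _

/-- A word is empty or starts with a digit; this splits the product over a cylinder into root and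
subtrees for `map_graft`. -/
lemma prod_list_eq {M : Type*} [CommMonoid M] (s : Finset (List (Digit L)))
    (g : List (Digit L) → M) : ∏ w ∈ s, g w = (if [] ∈ s then g [] else 1) *
      ∏ q, ∏ w ∈ s.preimage (List.cons q) (List.cons_injective.injOn), g (q :: w) := by
  classical
  rw [Finset.prod_sigma', ← Finset.prod_filter_mul_prod_filter_not s (fun w => w = [])]
  congr 1
  · rw [Finset.prod_filter]
    simp
  · symm
    refine Finset.prod_bij (fun x _ => x.1 :: x.2) ?_ ?_ ?_ ?_
    · intro x hx
      simpa using hx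
    · rintro ⟨q, w⟩ _ ⟨q', w'⟩ _ h
      obtain ⟨rfl, rfl⟩ := List.cons.inj h
      rfl
    · intro w hw
      rw [Finset.mem_filter] at hw
      obtain ⟨q, w', rfl⟩ := List.exists_cons_of_ne_nil hw.2
      exact ⟨⟨q, w'⟩, by simpa using hw.1, rfl⟩
    · intro x _; rfl

/-- The branching property: the first selection and the families inside the L² squares are
independent, and each family has the law of the whole. It is enough to check cylinders. -/
lemma map_graft [IsProbabilityMeasure 𝔛] :
    (𝔛.prod (Measure.pi fun _ : Digit L => envMeasure 𝔛)).map graft = envMeasure 𝔛 := by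
  refine Measure.eq_infinitePi _ fun s t ht => ?_
  have hpre : graft ⁻¹' ((s : Set (List (Digit L))).pi t) =
      {A : Selection L | [] ∈ s → A ∈ t []} ×ˢ Set.univ.pi fun q : Digit L =>
        ((s.preimage (List.cons q) List.cons_injective.injOn : Finset (List (Digit L))) :
          Set (List (Digit L))).pi fun w => t (q :: w) := by
    ext z
    simp only [mem_preimage, Set.mem_pi, mem_prod, mem_ofPred_eq, Set.mem_univ, forall_const,
      Finset.coe_preimage, Finset.mem_coe]
    constructor
    · exact fun h => ⟨fun h0 => h [] h0, fun q w hw => h (q :: w) hw⟩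
    · rintro ⟨h0, h1⟩ w hw
      cases w with
      | nil => exact h0 hw
      | cons q w => exact h1 q w hw
  rw [Measure.map_apply measurable_graft (MeasurableSet.pi s.countable_toSet fun i _ => ht i), hpre,
    Measure.prod_prod, Measure.pi_pi, prod_list_eq s]
  congr 1
  · split_ifs with h <;> simp [h]
  · refine Finset.prod_congr rfl fun q _ => ?_
    exact Measure.infinitePi_pi _ fun w _ => ht _

/-- Conditional independence of the subtrees given the first selection, in the form from which the
recursions in mean below are derived. -/
lemma integral_prod_child [IsProbabilityMeasure 𝔛] {F : Selection L → Digit L → Env L → ℝ}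
    (hF : ∀ A q, Measurable (F A q)) {C : ℝ} (hC : ∀ A q x, |F A q x| ≤ C) :
    ∫ x, ∏ q, F (x []) q (child x q) ∂envMeasure 𝔛 =
      ∑ A, weight 𝔛 A * ∏ q, ∫ x, F A q x ∂envMeasure 𝔛 := by
  set G : Selection L × (Digit L → Env L) → ℝ := fun z => ∏ q, F z.1 q (z.2 q) with hG
  have hGm : Measurable G := by
    refine measurable_from_prod_countable_right fun A => ?_
    exact Finset.measurable_prod _ fun q _ => (hF A q).comp (measurable_pi_apply q)
  have hxm : Measurable fun x : Env L => ∏ q, F (x []) q (child x q) :=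
    hGm.comp ((measurable_pi_apply []).prodMk (measurable_pi_lambda _ fun q => measurable_child q))
  have hGi : Integrable G (𝔛.prod (Measure.pi fun _ : Digit L => envMeasure 𝔛)) := by
    refine Integrable.of_bound hGm.aestronglyMeasurable (C ^ (Finset.univ : Finset (Digit L)).card)
      (Eventually.of_forall fun z => ?_)
    rw [Real.norm_eq_abs, hG, Finset.abs_prod]
    calc _ ≤ ∏ _q : Digit L, C :=
          Finset.prod_le_prod (fun _ _ => abs_nonneg _) fun q _ => hC _ _ _
      _ = _ := Finset.prod_const _
  have h1 : ∫ x, ∏ q, F (x []) q (child x q) ∂envMeasure 𝔛 =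
      ∫ z, G z ∂𝔛.prod (Measure.pi fun _ : Digit L => envMeasure 𝔛) := by
    conv_lhs => rw [← map_graft]
    rw [integral_map measurable_graft.aemeasurable hxm.aestronglyMeasurable]
    rfl
  rw [h1]
  rw [integral_prod _ hGi, integral_fintype Integrable.of_finite]
  refine Finset.sum_congr rfl fun A _ => ?_
  have h2 := integral_fintype_prod_eq_prod (𝕜 := ℝ) (fun q => F A q)
    (μ := fun _ : Digit L => envMeasure 𝔛)
  rw [← h2]
  rfl

/-- Bounded measurable functions. -/
def IsBoundedMeasurable {α : Type*} [MeasurableSpace α] (f : α → ℝ) : Prop :=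
  Measurable f ∧ ∃ C, ∀ x, |f x| ≤ C

lemma IsBoundedMeasurable.integrable {α : Type*} [MeasurableSpace α] {f : α → ℝ}
    (hf : IsBoundedMeasurable f) (μ : Measure α) [IsFiniteMeasure μ] : Integrable f μ :=
  Integrable.of_bound hf.1.aestronglyMeasurable hf.2.choose
    (Eventually.of_forall fun x => hf.2.choose_spec x)

lemma IsBoundedMeasurable.sub {α : Type*} [MeasurableSpace α] {f g : α → ℝ}
    (hf : IsBoundedMeasurable f) (hg : IsBoundedMeasurable g) :
    IsBoundedMeasurable fun x => f x - g x := by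
  obtain ⟨hfm, C, hC⟩ := hf
  obtain ⟨hgm, D, hD⟩ := hg
  exact ⟨hfm.sub hgm, C + D, fun x => (abs_sub _ _).trans (add_le_add (hC x) (hD x))⟩

lemma IsBoundedMeasurable.mul {α : Type*} [MeasurableSpace α] {f g : α → ℝ}
    (hf : IsBoundedMeasurable f) (hg : IsBoundedMeasurable g) :
    IsBoundedMeasurable fun x => f x * g x := by
  obtain ⟨hfm, C, hC⟩ := hf
  obtain ⟨hgm, D, hD⟩ := hg
  refine ⟨hfm.mul hgm, C * D, fun x => ?_⟩
  rw [abs_mul]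
  exact mul_le_mul (hC x) (hD x) (abs_nonneg _) ((abs_nonneg _).trans (hC x))

lemma IsBoundedMeasurable.const {α : Type*} [MeasurableSpace α] (c : ℝ) :
    IsBoundedMeasurable fun _ : α => c := ⟨measurable_const, |c|, fun _ => le_rfl⟩

lemma IsBoundedMeasurable.sum {α ι : Type*} [MeasurableSpace α] (s : Finset ι) {f : ι → α → ℝ}
    (hf : ∀ i, IsBoundedMeasurable (f i)) : IsBoundedMeasurable fun x => ∑ i ∈ s, f i x := by
  choose hm C hC using hf
  exact ⟨Finset.measurable_sum _ fun i _ => hm i, ∑ i ∈ s, C i, fun x =>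
    (Finset.abs_sum_le_sum_abs _ _).trans (Finset.sum_le_sum fun i _ => hC i x)⟩

/-- The operator `f ↦ L⁻¹ ∑ f(child)`, where the sum is over the selected squares. -/
def branchMean (f : Env L → ℝ) (x : Env L) : ℝ := (L : ℝ)⁻¹ * ∑ q ∈ x [], f (child x q)

/-- The function `f` of the selections inside `[q]` if this square is selected. -/
def offspring (f : Env L → ℝ) (q : Digit L) (x : Env L) : ℝ := if q ∈ x [] then f (child x q) else 0

lemma branchMean_eq (f : Env L → ℝ) (x : Env L) :
    branchMean f x = (L : ℝ)⁻¹ * ∑ q, offspring f q x := by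
  simp only [branchMean, offspring, Finset.sum_ite_mem, Finset.univ_inter]

lemma measurableSet_mem_root (q : Digit L) : MeasurableSet {x : Env L | q ∈ x []} :=
  measurable_pi_apply (X := fun _ : List (Digit L) => Selection L) [] (MeasurableSet.of_discrete
    (s := {A : Selection L | q ∈ A}))

lemma IsBoundedMeasurable.offspring {f : Env L → ℝ} (hf : IsBoundedMeasurable f) (q : Digit L) :
    IsBoundedMeasurable (offspring f q) := by
  obtain ⟨hm, C, hC⟩ := hf
  refine ⟨Measurable.ite (measurableSet_mem_root q) (hm.comp (measurable_child q)) measurable_const,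
    C, fun x => ?_⟩
  unfold GridFractal.offspring
  split_ifs
  · exact hC _
  · simpa using (abs_nonneg _).trans (hC x)

lemma IsBoundedMeasurable.branchMean {f : Env L → ℝ} (hf : IsBoundedMeasurable f) :
    IsBoundedMeasurable (branchMean f) := by
  rw [show GridFractal.branchMean f = _ from funext (branchMean_eq f)]
  exact (IsBoundedMeasurable.const _).mul (IsBoundedMeasurable.sum _ fun q => hf.offspring q)

lemma IsBoundedMeasurable.iterate_branchMean {f : Env L → ℝ} (hf : IsBoundedMeasurable f) (n : ℕ) :
    IsBoundedMeasurable (GridFractal.branchMean^[n] f) := by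
  induction n with
  | zero => exact hf
  | succ n ih => rw [Function.iterate_succ_apply']; exact ih.branchMean

variable [IsProbabilityMeasure 𝔛]

lemma integral_offspring (hunif : IsUniform 𝔛) {f : Env L → ℝ} (hf : IsBoundedMeasurable f)
    (q : Digit L) : ∫ x, offspring f q x ∂envMeasure 𝔛 = (L : ℝ)⁻¹ * ∫ x, f x ∂envMeasure 𝔛 := by
  have hm := isUniformWeight_weight 𝔛 hunif
  obtain ⟨hfm, C, hC⟩ := hf
  have h := integral_prod_child (𝔛 := 𝔛)
    (F := fun A r x => if r = q then (if q ∈ A then f x else 0) else 1) (C := max C 1)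
    (fun A r => by split_ifs <;> first | exact hfm | exact measurable_const)
    (fun A r x => by
      have h0 := (abs_nonneg _).trans (hC x)
      split_ifs
      · exact (hC x).trans (le_max_left _ _)
      · simp
      · simp)
  simp only [Finset.prod_ite_eq', Finset.mem_univ, if_true] at h
  calc _ = _ := h
    _ = ∑ A, (if q ∈ A then weight 𝔛 A else 0) * ∫ x, f x ∂envMeasure 𝔛 := by
      refine Finset.sum_congr rfl fun A _ => ?_
      rw [Finset.prod_eq_single q (fun r _ hr => by simp [hr]) (by simp)]
      by_cases hq : q ∈ A <;> simp [hq]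
    _ = _ := by rw [← Finset.sum_mul, hm.marginal]

/-- Given the first selection the two factors are independent, and the first has mean 0. -/
lemma integral_offspring_mul {f g : Env L → ℝ} (hf : IsBoundedMeasurable f)
    (hg : IsBoundedMeasurable g) (h0 : ∫ x, f x ∂envMeasure 𝔛 = 0) {q q' : Digit L} (hq : q ≠ q') :
    ∫ x, offspring f q x * offspring g q' x ∂envMeasure 𝔛 = 0 := by
  obtain ⟨hfm, C, hC⟩ := hf
  obtain ⟨hgm, D, hD⟩ := hg
  have h := integral_prod_child (𝔛 := 𝔛)
    (F := fun A r x => if r = q then (if q ∈ A then f x else 0) else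
      if r = q' then (if q' ∈ A then g x else 0) else 1) (C := max (max C D) 1)
    (fun A r => by split_ifs <;> first | exact hfm | exact hgm | exact measurable_const)
    (fun A r x => by
      have h0 := (abs_nonneg _).trans (hC x)
      split_ifs
      · exact (hC x).trans ((le_max_left _ _).trans (le_max_left _ _))
      · simp
      · exact (hD x).trans ((le_max_right _ _).trans (le_max_left _ _))
      · simp
      · simp)
  have e : ∀ x : Env L, offspring f q x * offspring g q' x = ∏ r, (if r = q then
      (if q ∈ x [] then f (child x r) else 0) else
      if r = q' then (if q' ∈ x [] then g (child x r) else 0) else 1) := by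
    intro x
    rw [Finset.prod_eq_mul q q' hq (fun r _ hr => by simp [hr.1, hr.2]) (by simp) (by simp)]
    simp [offspring, hq.symm]
  simp only [e]
  rw [h]
  refine Finset.sum_eq_zero fun A _ => ?_
  rw [Finset.prod_eq_zero (Finset.mem_univ q), mul_zero]
  simp only [if_true]
  split_ifs
  · exact h0
  · simp

lemma integral_branchMean (hL : 0 < L) (hunif : IsUniform 𝔛) {f : Env L → ℝ}
    (hf : IsBoundedMeasurable f) :
    ∫ x, branchMean f x ∂envMeasure 𝔛 = ∫ x, f x ∂envMeasure 𝔛 := by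
  have hL' : (0 : ℝ) < L := by exact_mod_cast hL
  simp only [branchMean_eq]
  rw [integral_const_mul, integral_finsetSum _ fun q _ => (hf.offspring q).integrable _]
  simp only [integral_offspring hunif hf, Finset.sum_const, nsmul_eq_mul, card_digit]
  field_simp

/-- The cross terms vanish. The L² diagonal terms have selection probability 1/L and prefactor L⁻²,
leaving a contraction by 1/L. -/
lemma integral_branchMean_sq (hL : 0 < L) (hunif : IsUniform 𝔛) {f : Env L → ℝ}
    (hf : IsBoundedMeasurable f) (h0 : ∫ x, f x ∂envMeasure 𝔛 = 0) :
    ∫ x, branchMean f x ^ 2 ∂envMeasure 𝔛 = (L : ℝ)⁻¹ * ∫ x, f x ^ 2 ∂envMeasure 𝔛 := by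
  have hL' : (0 : ℝ) < L := by exact_mod_cast hL
  have hf2 : IsBoundedMeasurable fun x => f x ^ 2 := by simpa only [sq] using hf.mul hf
  have hd : ∀ q : Digit L, ∫ x, offspring f q x * offspring f q x ∂envMeasure 𝔛 =
      (L : ℝ)⁻¹ * ∫ x, f x ^ 2 ∂envMeasure 𝔛 := by
    intro q
    rw [← integral_offspring hunif hf2 q]
    congr 1
    ext x
    unfold offspring
    split_ifs
    · ring
    · ring
  have e : ∀ x : Env L, branchMean f x ^ 2 =
      ((L : ℝ)⁻¹) ^ 2 * ∑ q, ∑ q', offspring f q x * offspring f q' x := by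
    intro x
    rw [branchMean_eq, mul_pow, sq (∑ q, _), Finset.sum_mul_sum]
  simp only [e]
  rw [integral_const_mul, integral_finsetSum _ fun q _ =>
    (IsBoundedMeasurable.sum _ fun q' => (hf.offspring q).mul (hf.offspring q')).integrable _]
  have e2 : ∀ q : Digit L, ∫ x, ∑ q', offspring f q x * offspring f q' x ∂envMeasure 𝔛 =
      (L : ℝ)⁻¹ * ∫ x, f x ^ 2 ∂envMeasure 𝔛 := by
    intro q
    rw [integral_finsetSum _ fun q' _ => ((hf.offspring q).mul (hf.offspring q')).integrable _,
      Finset.sum_eq_single q (fun q' _ hq' => integral_offspring_mul hf hf h0 hq'.symm) (by simp), hd]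
  simp only [e2, Finset.sum_const, nsmul_eq_mul, card_digit]
  field_simp

lemma integral_iterate_branchMean (hL : 0 < L) (hunif : IsUniform 𝔛) {f : Env L → ℝ}
    (hf : IsBoundedMeasurable f) (n : ℕ) :
    ∫ x, branchMean^[n] f x ∂envMeasure 𝔛 = ∫ x, f x ∂envMeasure 𝔛 := by
  induction n with
  | zero => rfl
  | succ n ih =>
    rw [Function.iterate_succ_apply', integral_branchMean hL hunif (hf.iterate_branchMean n), ih]

lemma integral_iterate_branchMean_sq (hL : 0 < L) (hunif : IsUniform 𝔛) {f : Env L → ℝ}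
    (hf : IsBoundedMeasurable f) (h0 : ∫ x, f x ∂envMeasure 𝔛 = 0) (n : ℕ) :
    ∫ x, branchMean^[n] f x ^ 2 ∂envMeasure 𝔛 = ((L : ℝ)⁻¹) ^ n * ∫ x, f x ^ 2 ∂envMeasure 𝔛 := by
  induction n with
  | zero => simp
  | succ n ih =>
    rw [Function.iterate_succ_apply', integral_branchMean_sq hL hunif (hf.iterate_branchMean n)
      ((integral_iterate_branchMean hL hunif hf n).trans h0), ih]
    ring

/-- Averages over the squares of level `n` are concentrated. -/
lemma integral_abs_iterate_branchMean_le (hL : 2 ≤ L) (hunif : IsUniform 𝔛) {f : Env L → ℝ}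
    (hf : IsBoundedMeasurable f) (h0 : ∫ x, f x ∂envMeasure 𝔛 = 0) {C : ℝ} (hC : ∀ x, |f x| ≤ C)
    (n : ℕ) : ∫ x, |branchMean^[n] f x| ∂envMeasure 𝔛 ≤ C * (Real.sqrt 2)⁻¹ ^ n := by
  have hL' : (2 : ℝ) ≤ L := by exact_mod_cast hL
  have hC0 : 0 ≤ C := (abs_nonneg _).trans (hC fun _ => ∅)
  have hb := hf.iterate_branchMean n
  have hsq : IsBoundedMeasurable fun x => branchMean^[n] f x ^ 2 := by
    simpa only [sq] using hb.mul hb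
  have hab : IsBoundedMeasurable fun x => |branchMean^[n] f x| := by
    obtain ⟨hm, D, hD⟩ := hb
    exact ⟨hm.abs, D, fun x => by rw [abs_abs]; exact hD x⟩
  have h1 : (∫ x, |branchMean^[n] f x| ∂envMeasure 𝔛) ^ 2 ≤
      ∫ x, branchMean^[n] f x ^ 2 ∂envMeasure 𝔛 := by
    set a := ∫ x, |branchMean^[n] f x| ∂envMeasure 𝔛 with ha
    have h2 : 0 ≤ ∫ x, (|branchMean^[n] f x| - a) ^ 2 ∂envMeasure 𝔛 :=
      integral_nonneg fun x => sq_nonneg _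
    have h3 : ∫ x, (|branchMean^[n] f x| - a) ^ 2 ∂envMeasure 𝔛 =
        (∫ x, branchMean^[n] f x ^ 2 ∂envMeasure 𝔛) - 2 * a * a + a ^ 2 := by
      have e : ∀ x, (|branchMean^[n] f x| - a) ^ 2 =
          (branchMean^[n] f x ^ 2 - 2 * a * |branchMean^[n] f x|) + a ^ 2 := fun x => by
        rw [sub_sq, sq_abs]; ring
      simp only [e]
      rw [integral_add ((hsq.sub ((IsBoundedMeasurable.const _).mul hab)).integrable _)
        (integrable_const _), integral_sub (hsq.integrable _) ((hab.integrable _).const_mul _),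
        integral_const_mul, ← ha]
      simp
    nlinarith
  rw [integral_iterate_branchMean_sq (by omega) hunif hf h0] at h1
  have h4 : ∫ x, f x ^ 2 ∂envMeasure 𝔛 ≤ C ^ 2 := by
    have hf2 : IsBoundedMeasurable fun x => f x ^ 2 := by simpa only [sq] using hf.mul hf
    calc _ ≤ ∫ _, C ^ 2 ∂envMeasure 𝔛 := integral_mono (hf2.integrable _) (integrable_const _)
          fun x => by
            rw [← sq_abs]; exact pow_le_pow_left₀ (abs_nonneg _) (hC x) 2
      _ = C ^ 2 := by simp
  -- Second moments contract by 1/L ≤ 1/2, hence first moments by 1/√2.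
  refine abs_le_of_sq_le_sq' ?_ (by positivity) |>.2
  calc _ ≤ _ := h1
    _ ≤ (2⁻¹ : ℝ) ^ n * C ^ 2 := by
      refine mul_le_mul (pow_le_pow_left₀ (by positivity) (inv_anti₀ two_pos hL') n) h4
        (integral_nonneg fun x => sq_nonneg _) (by positivity)
    _ = _ := by
      rw [mul_pow, ← pow_mul, mul_comm n 2, pow_mul, inv_pow (√2), Real.sq_sqrt zero_le_two]
      ring

end Branching

end

end GridFractal

open MeasureTheory ProbabilityTheory Filter Topology Set

namespace GridFractal

noncomputable section

/-! ### The approximations of the random fractal -/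

section Approximations

variable {L : ℕ} {θ : ℝ}

/-- The levels grow by appending a digit at the end, whereas branching removes the first digit; this
reconciles the two recursions. -/
lemma mem_level_succ {x : Env L} {n : ℕ} {w : List (Digit L)} :
    w ∈ level x (n + 1) ↔ ∃ q ∈ x [], ∃ v ∈ level (child x q) n, q :: v = w := by
  induction n generalizing w with
  | zero => simp [level]
  | succ n ih =>
    rw [level]
    simp only [Finset.mem_biUnion, Finset.mem_image, ih]
    constructor
    · rintro ⟨_, ⟨p, hp, u, hu, rfl⟩, q, hq, rfl⟩
      refine ⟨p, hp, u ++ [q], ?_, rfl⟩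
      rw [level]
      simp only [Finset.mem_biUnion, Finset.mem_image]
      exact ⟨u, hu, q, hq, rfl⟩
    · rintro ⟨p, hp, v, hv, rfl⟩
      rw [level] at hv
      simp only [Finset.mem_biUnion, Finset.mem_image] at hv
      obtain ⟨u, hu, q, hq, rfl⟩ := hv
      exact ⟨p :: u, ⟨p, hp, u, hu, rfl⟩, q, hq, rfl⟩

lemma card_level_succ (x : Env L) (n : ℕ) :
    (level x (n + 1)).card = ∑ q ∈ x [], (level (child x q) n).card := by
  have h : level x (n + 1) = (x []).biUnion fun q => (level (child x q) n).image (List.cons q) := by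
    ext w
    simp only [mem_level_succ, Finset.mem_biUnion, Finset.mem_image]
  rw [h, Finset.card_biUnion]
  · exact Finset.sum_congr rfl fun q _ => Finset.card_image_of_injective _ List.cons_injective
  · intro q _ q' _ hne
    refine Finset.disjoint_left.2 fun w hw hw' => ?_
    rw [Finset.mem_image] at hw hw'
    obtain ⟨v, _, rfl⟩ := hw
    obtain ⟨v', _, h'⟩ := hw'
    exact hne (List.cons.inj h').1.symm

lemma Zseq_zero (x : Env L) : Zseq x 0 = 1 := by simp [Zseq, level]

lemma Zseq_nonneg (x : Env L) (n : ℕ) : 0 ≤ Zseq x n := by unfold Zseq; positivity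

lemma Zseq_succ (x : Env L) (n : ℕ) : Zseq x (n + 1) = branchMean (fun y => Zseq y n) x := by
  simp only [Zseq, branchMean, card_level_succ, Nat.cast_sum, Finset.mul_sum, pow_succ, mul_inv]
  refine Finset.sum_congr rfl fun q _ => ?_
  ring

lemma Zseq_eq_iterate (n : ℕ) : (fun x : Env L => Zseq x n) = branchMean^[n] fun _ => 1 := by
  induction n with
  | zero => ext x; exact Zseq_zero x
  | succ n ih =>
    rw [Function.iterate_succ_apply', ← ih]
    ext x
    exact Zseq_succ x n

/-- The affine map which takes the square `[q]` to the unit square. -/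
def rescale (q : Digit L) (p : Plane) : Plane := !₂[L * p 0 - (q.1 : ℕ), L * p 1 - (q.2 : ℕ)]

lemma proj_rescale (q : Digit L) (p : Plane) :
    proj θ (rescale q p) = L * proj θ p - digitProj θ q := by
  simp only [proj, rescale, digitProj, projXY, PiLp.toLp_apply, Matrix.cons_val_zero,
    Matrix.cons_val_one]
  ring

lemma rescale_surjective (hL : 0 < L) (q : Digit L) : Function.Surjective (rescale q) := by
  intro p
  have hL' : (L : ℝ) ≠ 0 := by exact_mod_cast hL.ne'
  refine ⟨!₂[(p 0 + (q.1 : ℕ)) / L, (p 1 + (q.2 : ℕ)) / L], ?_⟩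
  ext i
  fin_cases i
  · simp [rescale, mul_div_cancel₀ _ hL']
  · simp [rescale, mul_div_cancel₀ _ hL']

lemma mem_square_cons (hL : 0 < L) {q : Digit L} {w : List (Digit L)} {p : Plane} :
    p ∈ square (q :: w) ↔ rescale q p ∈ square w := by
  have hL' : (0 : ℝ) < L := by exact_mod_cast hL
  have key : ∀ a c d x : ℝ, x ∈ Icc ((a + c) / (L : ℝ)) ((a + c) / L + (d * L)⁻¹) ↔
      L * x - a ∈ Icc c (c + d⁻¹) := by
    intro a c d x
    have : (d * L)⁻¹ = d⁻¹ / L := by rw [mul_inv, div_eq_mul_inv]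
    rw [this, ← add_div, mem_Icc, mem_Icc, div_le_iff₀ hL', le_div_iff₀ hL']
    constructor <;> rintro ⟨h1, h2⟩ <;> constructor <;> linarith
  simp only [square, mem_ofPred_eq, corner, List.length_cons, pow_succ, key]
  rfl

lemma mem_approx_succ (hL : 0 < L) {x : Env L} {n : ℕ} {p : Plane} :
    p ∈ approx x (n + 1) ↔ ∃ q ∈ x [], rescale q p ∈ approx (child x q) n := by
  simp only [approx, mem_iUnion, mem_level_succ, exists_prop]
  constructor
  · rintro ⟨_, ⟨q, hq, v, hv, rfl⟩, hp⟩
    exact ⟨q, hq, v, hv, (mem_square_cons hL).1 hp⟩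
  · rintro ⟨q, hq, v, hv, hp⟩
    exact ⟨_, ⟨q, hq, v, hv, rfl⟩, (mem_square_cons hL).2 hp⟩

lemma mem_square_nil {p : Plane} :
    p ∈ square ([] : List (Digit L)) ↔ p 0 ∈ Icc (0 : ℝ) 1 ∧ p 1 ∈ Icc (0 : ℝ) 1 := by
  simp [square, corner]

lemma approx_zero (x : Env L) : approx x 0 = square ([] : List (Digit L)) := by simp [approx, level]

lemma approx_succ_subset (hL : 0 < L) (x : Env L) (n : ℕ) : approx x (n + 1) ⊆ approx x n := by
  have hL' : (0 : ℝ) < L := by exact_mod_cast hL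
  induction n generalizing x with
  | zero =>
    intro p hp
    obtain ⟨q, -, hq⟩ := (mem_approx_succ hL).1 hp
    rw [approx_zero, mem_square_nil] at hq ⊢
    have key : ∀ (i : Fin L) (a : ℝ), L * a - (i : ℕ) ∈ Icc (0 : ℝ) 1 → a ∈ Icc (0 : ℝ) 1 := by
      intro i a ha
      have hi : ((i : ℕ) : ℝ) + 1 ≤ L := by exact_mod_cast i.2
      have hi0 : (0 : ℝ) ≤ (i : ℕ) := Nat.cast_nonneg _
      exact ⟨by nlinarith [ha.1], by nlinarith [ha.2]⟩
    exact ⟨key q.1 _ hq.1, key q.2 _ hq.2⟩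
  | succ n ih =>
    intro p hp
    obtain ⟨q, hq, h⟩ := (mem_approx_succ hL).1 hp
    exact (mem_approx_succ hL).2 ⟨q, hq, ih _ h⟩

lemma approx_antitone (hL : 0 < L) (x : Env L) : Antitone (approx x) :=
  antitone_nat_of_succ_le (approx_succ_subset hL x)

lemma image_proj_square_nil :
    proj θ '' square ([] : List (Digit L)) = Icc (projLo θ) (projHi θ) := by
  ext t
  constructor
  · rintro ⟨p, hp, rfl⟩
    obtain ⟨h0, h1⟩ := mem_square_nil.1 hp
    exact projXY_mem h0 h1
  · intro ht
    obtain ⟨a, ha, b, hb, rfl⟩ := exists_projXY_eq ht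
    exact ⟨!₂[a, b], mem_square_nil.2 ⟨ha, hb⟩, rfl⟩

lemma mem_image_proj_approx_succ (hL : 0 < L) {x : Env L} {n : ℕ} {t : ℝ} :
    t ∈ proj θ '' approx x (n + 1) ↔
      ∃ q ∈ x [], L * t - digitProj θ q ∈ proj θ '' approx (child x q) n := by
  have hL' : (L : ℝ) ≠ 0 := by exact_mod_cast hL.ne'
  constructor
  · rintro ⟨p, hp, rfl⟩
    obtain ⟨q, hq, h⟩ := (mem_approx_succ hL).1 hp
    exact ⟨q, hq, rescale q p, h, proj_rescale q p⟩
  · rintro ⟨q, hq, p', hp', h⟩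
    obtain ⟨p, rfl⟩ := rescale_surjective hL q p'
    rw [proj_rescale] at h
    exact ⟨p, (mem_approx_succ hL).2 ⟨q, hq, hp'⟩, mul_left_cancel₀ hL' (by linarith)⟩

/-- Indicator of the event that the line `ℓ(θ, t)` meets the level `n` approximation. -/
def hit (x : Env L) (n : ℕ) (θ t : ℝ) : ℝ := (proj θ '' approx x n).indicator (fun _ => (1 : ℝ)) t

lemma hit_eq_zero_or_one (x : Env L) (n : ℕ) (θ t : ℝ) : hit x n θ t = 0 ∨ hit x n θ t = 1 :=
  indicator_eq_zero_or_self _ _ _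

lemma hit_nonneg (x : Env L) (n : ℕ) (θ t : ℝ) : 0 ≤ hit x n θ t :=
  indicator_nonneg (fun _ _ => zero_le_one) _

lemma hit_le_one (x : Env L) (n : ℕ) (θ t : ℝ) : hit x n θ t ≤ 1 := by
  rcases hit_eq_zero_or_one x n θ t with h | h <;> simp [h]

lemma hit_zero (x : Env L) (θ : ℝ) :
    hit x 0 θ = (Icc (projLo θ) (projHi θ)).indicator 1 := by
  ext t
  rw [hit, approx_zero, image_proj_square_nil]
  rfl

lemma one_sub_hit_succ (hL : 0 < L) (x : Env L) (n : ℕ) (θ t : ℝ) : 1 - hit x (n + 1) θ t =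
    ∏ q, if q ∈ x [] then 1 - hit (child x q) n θ (L * t - digitProj θ q) else 1 := by
  by_cases h : t ∈ proj θ '' approx x (n + 1)
  · obtain ⟨q, hq, hqt⟩ := (mem_image_proj_approx_succ hL).1 h
    rw [hit, indicator_of_mem h, sub_self, Finset.prod_eq_zero (Finset.mem_univ q)]
    rw [if_pos hq, hit, indicator_of_mem hqt, sub_self]
  · rw [hit, indicator_of_notMem h, sub_zero, Finset.prod_eq_one]
    intro q _
    split_ifs with hq
    · rw [hit, indicator_of_notMem, sub_zero]
      exact fun hqt => h ((mem_image_proj_approx_succ hL).2 ⟨q, hq, hqt⟩)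
    · rfl

lemma hit_succ_le_sum (hL : 0 < L) (x : Env L) (n : ℕ) (θ t : ℝ) : hit x (n + 1) θ t ≤
    ∑ q ∈ x [], hit (child x q) n θ (L * t - digitProj θ q) := by
  by_cases h : t ∈ proj θ '' approx x (n + 1)
  · obtain ⟨q, hq, hqt⟩ := (mem_image_proj_approx_succ hL).1 h
    refine (hit_le_one _ _ _ _).trans (le_trans (le_of_eq ?_) (Finset.single_le_sum
      (f := fun q => hit (child x q) n θ (L * t - digitProj θ q)) (fun _ _ => hit_nonneg _ _ _ _) hq))
    exact (indicator_of_mem hqt fun _ => (1 : ℝ)).symm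
  · rw [hit, indicator_of_notMem h]
    exact Finset.sum_nonneg fun _ _ => hit_nonneg _ _ _ _

lemma hit_antitone (hL : 0 < L) (x : Env L) (θ t : ℝ) : Antitone fun n => hit x n θ t :=
  fun _ _ h => indicator_le_indicator_of_subset (f := fun _ => (1 : ℝ))
    (image_mono (approx_antitone hL x h)) (fun _ => zero_le_one) t

lemma measurable_hit (hL : 0 < L) (n : ℕ) {α : Type*} [MeasurableSpace α] {X : α → Env L}
    {Θ T : α → ℝ} (hX : Measurable X) (hΘ : Measurable Θ) (hT : Measurable T) :
    Measurable fun a => hit (X a) n (Θ a) (T a) := by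
  induction n generalizing X T with
  | zero =>
    simp only [hit_zero]
    exact (measurable_hitProb_prod (L := L) 0 0).comp (f := fun a => (Θ a, T a)) (hΘ.prodMk hT)
  | succ n ih =>
    have h : ∀ a, hit (X a) (n + 1) (Θ a) (T a) = 1 - ∏ q, if q ∈ X a [] then
        1 - hit (child (X a) q) n (Θ a) (L * T a - digitProj (Θ a) q) else 1 := fun z => by
      rw [← one_sub_hit_succ hL, sub_sub_cancel]
    simp only [h]
    exact measurable_const.sub (Finset.measurable_prod _ fun q _ => Measurable.ite
      (hX (measurableSet_mem_root q)) (measurable_const.sub (ih ((measurable_child q).comp hX)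
        ((hT.const_mul _).sub ((measurable_digitProj q).comp hΘ)))) measurable_const)

lemma hit_le_indicator (hL : 0 < L) (x : Env L) (n : ℕ) (θ t : ℝ) :
    hit x n θ t ≤ (Icc (projLo θ) (projHi θ)).indicator (fun _ => 1) t := by
  have h : hit x n θ t ≤ hit x 0 θ t := hit_antitone hL x θ t (Nat.zero_le n)
  rw [hit_zero] at h
  exact h

lemma measurable_hit_right (hL : 0 < L) (x : Env L) (n : ℕ) (θ : ℝ) :
    Measurable (hit x n θ) :=
  measurable_hit hL n measurable_const measurable_const measurable_id

lemma integrable_hit (hL : 0 < L) (x : Env L) (n : ℕ) (θ : ℝ) : Integrable (hit x n θ) := by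
  refine (integrable_indicator_Icc (projLo θ) (projHi θ)).mono'
    (measurable_hit_right hL x n θ).aestronglyMeasurable (Eventually.of_forall fun t => ?_)
  rw [Real.norm_of_nonneg (hit_nonneg _ _ _ _)]
  exact hit_le_indicator hL x n θ t

/-- Length of the projection of the level `n` approximation. -/
def imageLength (x : Env L) (n : ℕ) (θ : ℝ) : ℝ := ∫ t, hit x n θ t

/-- Favard length of the level `n` approximation. -/
def favard (x : Env L) (n : ℕ) : ℝ := ∫ θ in (0 : ℝ)..Real.pi, imageLength x n θ

lemma imageLength_nonneg (x : Env L) (n : ℕ) (θ : ℝ) : 0 ≤ imageLength x n θ :=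
  integral_nonneg fun _ => hit_nonneg _ _ _ _

lemma imageLength_le_two (hL : 0 < L) (x : Env L) (n : ℕ) (θ : ℝ) : imageLength x n θ ≤ 2 := by
  refine (integral_mono (integrable_hit hL x n θ) (integrable_indicator_Icc _ _)
    fun t => hit_le_indicator hL x n θ t).trans ?_
  rw [integral_indicator_const _ measurableSet_Icc, smul_eq_mul, mul_one,
    Real.volume_real_Icc_of_le (projLo_lt_projHi θ).le]
  exact projHi_sub_projLo_le θ

lemma measurable_imageLength (hL : 0 < L) (n : ℕ) :
    Measurable fun z : Env L × ℝ => imageLength z.1 n z.2 := by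
  have h : Measurable fun z : (Env L × ℝ) × ℝ => hit z.1.1 n z.1.2 z.2 :=
    measurable_hit hL n (measurable_fst.comp measurable_fst) (measurable_snd.comp measurable_fst)
      measurable_snd
  exact (h.stronglyMeasurable.integral_prod_right').measurable

lemma measurable_imageLength_right (hL : 0 < L) (x : Env L) (n : ℕ) :
    Measurable (imageLength x n) :=
  (measurable_imageLength hL n).comp (f := fun θ => (x, θ)) (measurable_const.prodMk measurable_id)

lemma intervalIntegrable_imageLength (hL : 0 < L) (x : Env L) (n : ℕ) :
    IntervalIntegrable (imageLength x n) volume 0 Real.pi := by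
  rw [intervalIntegrable_iff_integrableOn_Ioc_of_le Real.pi_pos.le]
  refine Measure.integrableOn_of_bounded (M := 2) (by simp)
    (measurable_imageLength_right hL x n).aestronglyMeasurable (Eventually.of_forall fun θ => ?_)
  rw [Real.norm_of_nonneg (imageLength_nonneg x n θ)]
  exact imageLength_le_two hL x n θ

lemma favard_nonneg (x : Env L) (n : ℕ) : 0 ≤ favard x n :=
  intervalIntegral.integral_nonneg Real.pi_pos.le fun θ _ => imageLength_nonneg x n θ

lemma favard_le (hL : 0 < L) (x : Env L) (n : ℕ) : favard x n ≤ 2 * Real.pi := by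
  refine (intervalIntegral.integral_mono_on Real.pi_pos.le (intervalIntegrable_imageLength hL x n)
    (intervalIntegrable_const (c := 2)) fun θ _ => imageLength_le_two hL x n θ).trans ?_
  simp [mul_comm]

lemma isBoundedMeasurable_favard (hL : 0 < L) (n : ℕ) :
    IsBoundedMeasurable fun x : Env L => favard x n := by
  refine ⟨?_, 2 * Real.pi, fun x => by
    rw [abs_of_nonneg (favard_nonneg x n)]; exact favard_le hL x n⟩
  simp only [favard, intervalIntegral.integral_of_le Real.pi_pos.le]
  exact ((measurable_imageLength hL n).stronglyMeasurable.integral_prod_right').measurable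

lemma favard_antitone (hL : 0 < L) (x : Env L) : Antitone (favard x) := fun _ _ h =>
  intervalIntegral.integral_mono_on Real.pi_pos.le (intervalIntegrable_imageLength hL x _)
    (intervalIntegrable_imageLength hL x _) fun θ _ =>
      integral_mono (integrable_hit hL x _ θ) (integrable_hit hL x _ θ) fun _ =>
        hit_antitone hL x θ _ h

/-- Subadditivity of length: the only loss is the overlap of the projections of different selected
squares. -/
lemma favard_succ_le (hL : 0 < L) (x : Env L) (n : ℕ) :
    favard x (n + 1) ≤ branchMean (fun y => favard y n) x := by
  have hL' : (0 : ℝ) < L := by exact_mod_cast hL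
  have h1 : ∀ θ, imageLength x (n + 1) θ ≤ (L : ℝ)⁻¹ * ∑ q ∈ x [], imageLength (child x q) n θ := by
    intro θ
    have hi : ∀ q : Digit L, Integrable fun t => hit (child x q) n θ (L * t - digitProj θ q) :=
      fun q => ((integrable_hit hL (child x q) n θ).comp_sub_right (digitProj θ q)).comp_mul_left'
        hL'.ne'
    refine (integral_mono (integrable_hit hL x _ θ) (integrable_finsetSum _ fun q _ => hi q)
      fun t => hit_succ_le_sum hL x n θ t).trans (le_of_eq ?_)
    rw [integral_finsetSum _ fun q _ => hi q, Finset.mul_sum]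
    exact Finset.sum_congr rfl fun q _ => integral_comp_child hL' _ _
  have h2 : ∀ q ∈ x [], IntervalIntegrable (imageLength (child x q) n) volume 0 Real.pi :=
    fun q _ => intervalIntegrable_imageLength hL _ n
  have h3 : IntervalIntegrable (fun θ => ∑ q ∈ x [], imageLength (child x q) n θ)
      volume 0 Real.pi := by
    have := IntervalIntegrable.sum (x []) h2
    rwa [show (∑ q ∈ x [], imageLength (child x q) n) = fun θ => ∑ q ∈ x [],
      imageLength (child x q) n θ from funext fun θ => Finset.sum_apply _ _ _] at this
  refine (intervalIntegral.integral_mono_on Real.pi_pos.le (intervalIntegrable_imageLength hL x _)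
    (h3.const_mul _) fun θ _ => h1 θ).trans (le_of_eq ?_)
  rw [intervalIntegral.integral_const_mul, intervalIntegral.integral_finsetSum h2]
  rfl

lemma branchMean_mono {f g : Env L → ℝ} (h : ∀ x, f x ≤ g x) (x : Env L) :
    branchMean f x ≤ branchMean g x :=
  mul_le_mul_of_nonneg_left (Finset.sum_le_sum fun _ _ => h _) (by positivity)

lemma favard_add_le (hL : 0 < L) (n k : ℕ) (x : Env L) :
    favard x (n + k) ≤ branchMean^[k] (fun y => favard y n) x := by
  induction k generalizing x with
  | zero => exact le_rfl
  | succ k ih =>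
    rw [Function.iterate_succ_apply']
    exact (favard_succ_le hL x (n + k)).trans (branchMean_mono ih x)

variable {𝔛 : Measure (Selection L)} [IsProbabilityMeasure 𝔛]

/-- The line misses the next level exactly if it misses all selected rescaled copies. Given the
first selection these events are independent, so their probabilities multiply as in `survive`. -/
lemma integral_hit (hL : 0 < L) (hunif : IsUniform 𝔛) (n : ℕ) (θ t : ℝ) :
    ∫ x, hit x n θ t ∂envMeasure 𝔛 =
      hitProb (weight 𝔛) (digitProj θ) (projLo θ) (projHi θ) n t := by
  have hm := isUniformWeight_weight 𝔛 hunif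
  have hmeas : ∀ n t, Measurable fun x : Env L => hit x n θ t := fun n t =>
    measurable_hit hL n measurable_id measurable_const measurable_const
  have hint : ∀ n t, Integrable (fun x : Env L => hit x n θ t) (envMeasure 𝔛) := fun n t =>
    IsBoundedMeasurable.integrable ⟨hmeas n t, 1, fun x => by
      rw [abs_of_nonneg (hit_nonneg _ _ _ _)]; exact hit_le_one _ _ _ _⟩ _
  induction n generalizing t with
  | zero => simp only [hit_zero]; simp [hitProb]
  | succ n ih =>
    have h := integral_prod_child (𝔛 := 𝔛)
      (F := fun A q y => if q ∈ A then 1 - hit y n θ (L * t - digitProj θ q) else 1) (C := 1)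
      (fun A q => by
        split_ifs
        · exact measurable_const.sub (hmeas n _)
        · exact measurable_const)
      (fun A q y => by
        have h0 := hit_nonneg y n θ (L * t - digitProj θ q)
        have h1 := hit_le_one y n θ (L * t - digitProj θ q)
        split_ifs
        · rw [abs_of_nonneg (by linarith)]; linarith
        · simp)
    simp only [← one_sub_hit_succ hL] at h
    rw [integral_sub (integrable_const _) (hint _ _)] at h
    have h2 : ∀ (A : Selection L) (q : Digit L), ∫ y, (if q ∈ A then
        1 - hit y n θ (L * t - digitProj θ q) else 1) ∂envMeasure 𝔛 = if q ∈ A then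
        1 - hitProb (weight 𝔛) (digitProj θ) (projLo θ) (projHi θ) n (L * t - digitProj θ q)
        else 1 := by
      intro A q
      split_ifs
      · rw [integral_sub (integrable_const _) (hint _ _), ih]; simp
      · simp
    simp only [h2, Finset.prod_ite_mem, Finset.univ_inter] at h
    rw [hitProb_succ, survive]
    simp only [mul_sub, mul_one, Finset.sum_sub_distrib, hm.sum_one]
    simp only [integral_const, probReal_univ, smul_eq_mul, mul_one] at h
    linarith

lemma integral_imageLength (hL : 0 < L) (hunif : IsUniform 𝔛) (n : ℕ) (θ : ℝ) :
    ∫ x, imageLength x n θ ∂envMeasure 𝔛 = projLength (weight 𝔛) n θ := by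
  unfold imageLength
  rw [integral_integral_swap]
  · exact integral_congr_ae (Eventually.of_forall fun t => integral_hit hL hunif n θ t)
  · refine ((integrable_indicator_Icc (projLo θ) (projHi θ)).comp_snd (envMeasure 𝔛)).mono'
      (Measurable.aestronglyMeasurable ?_) (Eventually.of_forall fun z => ?_)
    · exact measurable_hit hL n measurable_fst measurable_const measurable_snd
    · exact (Real.norm_of_nonneg (hit_nonneg z.1 n θ z.2)).le.trans
        (hit_le_indicator hL z.1 n θ z.2)

lemma integral_favard (hL : 0 < L) (hunif : IsUniform 𝔛) (n : ℕ) :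
    ∫ x, favard x n ∂envMeasure 𝔛 = meanFavard (weight 𝔛) n := by
  simp only [favard, meanFavard, intervalIntegral.integral_of_le Real.pi_pos.le]
  rw [integral_integral_swap]
  · simp only [integral_imageLength hL hunif]
  · refine IsBoundedMeasurable.integrable ⟨measurable_imageLength hL n, 2, fun z => ?_⟩ _
    exact (abs_of_nonneg (imageLength_nonneg z.1 n z.2)).le.trans (imageLength_le_two hL z.1 n z.2)

end Approximations

end

end GridFractal

open MeasureTheory ProbabilityTheory Filter Topology Set

namespace GridFractal

noncomputable section

/-! ### Almost sure convergence -/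

/-! ### Interpolation between the levels k³ + k, and summable errors -/

section Interpolation

lemma exists_cube_le (n : ℕ) : ∃ k : ℕ, k ^ 3 + k ≤ n ∧ n < (k + 1) ^ 3 + (k + 1) := by
  refine ⟨Nat.findGreatest (fun k => k ^ 3 + k ≤ n) n,
    Nat.findGreatest_spec (P := fun k => k ^ 3 + k ≤ n) (Nat.zero_le n) (by simp), ?_⟩
  by_contra! h
  have h1 : Nat.findGreatest (fun k => k ^ 3 + k ≤ n) n + 1 ≤ n :=
    le_trans (Nat.le_add_left _ _) h
  exact Nat.findGreatest_is_greatest (P := fun k => k ^ 3 + k ≤ n) (Nat.lt_succ_self _) h1 h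

/-- Consecutive levels k³ + k have ratio tending to 1, as have k³ and k³ + k, so monotonicity fills
the gaps. -/
lemma tendsto_mul_of_cube {f : ℕ → ℝ} (hf : Antitone f) (h0 : ∀ n, 0 ≤ f n) {z : ℝ}
    (h : Tendsto (fun k : ℕ => (k : ℝ) ^ 3 * f (k ^ 3 + k)) atTop (𝓝 z)) :
    Tendsto (fun n : ℕ => n * f n) atTop (𝓝 z) := by
  choose K hK1 hK2 using exists_cube_le
  have hK : Tendsto K atTop atTop := by
    refine tendsto_atTop.2 fun b => ?_
    filter_upwards [eventually_ge_atTop (b ^ 3 + b)] with n hn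
    by_contra! hlt
    have h1 : (K n + 1) ^ 3 + (K n + 1) ≤ b ^ 3 + b := by gcongr <;> omega
    have := hK2 n
    omega
  have hx : Tendsto (fun k : ℕ => 1 / (k : ℝ)) atTop (𝓝 0) := tendsto_one_div_atTop_nhds_zero_nat
  have hr1 : Tendsto (fun k : ℕ => ((k : ℝ) ^ 3)⁻¹ * (((k : ℝ) + 1) ^ 3 + (k + 1))) atTop (𝓝 1) := by
    have : Tendsto (fun k : ℕ => (1 + 1 / (k : ℝ)) ^ 3 + (1 / (k : ℝ)) ^ 2 * (1 + 1 / k)) atTop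
        (𝓝 ((1 + 0) ^ 3 + 0 ^ 2 * (1 + 0))) :=
      ((hx.const_add 1).pow 3).add ((hx.pow 2).mul (hx.const_add 1))
    norm_num at this
    refine this.congr' ?_
    filter_upwards [eventually_gt_atTop 0] with k hk
    have : (k : ℝ) ≠ 0 := by exact_mod_cast hk.ne'
    field_simp
  have hr2 : Tendsto (fun k : ℕ => (((k : ℝ) + 1) ^ 3)⁻¹ * ((k : ℝ) ^ 3 + k)) atTop (𝓝 1) := by
    have : Tendsto (fun k : ℕ => ((1 + 1 / (k : ℝ)) ^ 3)⁻¹ * (1 + (1 / (k : ℝ)) ^ 2)) atTop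
        (𝓝 (((1 + 0) ^ 3)⁻¹ * (1 + 0 ^ 2))) :=
      (((hx.const_add 1).pow 3).inv₀ (by norm_num)).mul ((hx.pow 2).const_add 1)
    norm_num at this
    refine this.congr' ?_
    filter_upwards [eventually_gt_atTop 0] with k hk
    have : (k : ℝ) ≠ 0 := by exact_mod_cast hk.ne'
    field_simp
  have hup := ((hr1.mul h).comp hK)
  have hlo := ((hr2.mul (h.comp (tendsto_add_atTop_nat 1))).comp hK)
  rw [one_mul] at hup hlo
  refine tendsto_of_tendsto_of_tendsto_of_le_of_le' hlo hup ?_ ?_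
  · refine Eventually.of_forall fun n => ?_
    have hpos : (0 : ℝ) < ((K n : ℝ) + 1) ^ 3 := by positivity
    simp only [Function.comp_apply, Nat.cast_add, Nat.cast_one]
    calc _ = ((K n : ℝ) ^ 3 + K n) * f ((K n + 1) ^ 3 + (K n + 1)) := by field_simp
      _ ≤ n * f n := mul_le_mul (by exact_mod_cast hK1 n) (hf (hK2 n).le) (h0 _) (Nat.cast_nonneg _)
  · filter_upwards [hK.eventually_gt_atTop 0] with n hn
    have : (K n : ℝ) ≠ 0 := by exact_mod_cast hn.ne'
    simp only [Function.comp_apply]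
    calc n * f n ≤ (((K n : ℝ) + 1) ^ 3 + (K n + 1)) * f (K n ^ 3 + K n) :=
          mul_le_mul (by exact_mod_cast (hK2 n).le) (hf (hK1 n)) (h0 _) (by positivity)
      _ = _ := by field_simp

lemma ae_summable_abs {α : Type*} [MeasurableSpace α] {μ : Measure α} {F : ℕ → α → ℝ}
    (hF : ∀ i, Integrable (F i) μ) (hs : Summable fun i => ∫ x, |F i x| ∂μ) :
    ∀ᵐ x ∂μ, Summable fun i => |F i x| := by
  have h1 : ∫⁻ x, ∑' i, ‖F i x‖ₑ ∂μ ≠ ⊤ := by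
    rw [lintegral_tsum fun i => (hF i).aestronglyMeasurable.enorm]
    have : ∀ i, ∫⁻ x, ‖F i x‖ₑ ∂μ = ENNReal.ofReal (∫ x, |F i x| ∂μ) := fun i =>
      (ofReal_integral_norm_eq_lintegral_enorm (hF i)).symm
    simp only [this]
    exact hs.tsum_ofReal_ne_top
  filter_upwards [ae_lt_top' (AEMeasurable.tsum fun i =>
    (hF i).aestronglyMeasurable.enorm) h1] with x hx
  have h2 : Summable fun i => ‖F i x‖₊ := ENNReal.tsum_coe_ne_top_iff_summable.1 hx.ne
  simpa using NNReal.summable_coe.2 h2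

end Interpolation

/-! ### The limit Z and the Favard length of the levels -/

section AlmostSure

variable {L : ℕ} {𝔛 : Measure (Selection L)}

lemma branchMean_sub (f g : Env L → ℝ) :
    branchMean (fun x => f x - g x) = fun x => branchMean f x - branchMean g x := by
  ext x
  simp only [branchMean, Finset.sum_sub_distrib, mul_sub]

lemma iterate_branchMean_sub (f g : Env L → ℝ) (n : ℕ) :
    branchMean^[n] (fun x => f x - g x) = fun x => branchMean^[n] f x - branchMean^[n] g x := by
  induction n with
  | zero => rfl
  | succ n ih => rw [Function.iterate_succ_apply', ih, branchMean_sub]; simp only [Function.iterate_succ_apply']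

lemma iterate_branchMean_const (c : ℝ) (n : ℕ) :
    branchMean^[n] (fun _ : Env L => c) = fun x => c * Zseq x n := by
  induction n with
  | zero => ext x; simp [Zseq_zero]
  | succ n ih =>
    rw [Function.iterate_succ_apply', ih]
    ext x
    simp only [Zseq_succ, branchMean, ← Finset.mul_sum]
    ring

lemma isBoundedMeasurable_Zseq (n : ℕ) : IsBoundedMeasurable fun x : Env L => Zseq x n := by
  rw [Zseq_eq_iterate]
  exact (IsBoundedMeasurable.const 1).iterate_branchMean n

/-- The increments are iterated branch means of the first one, which is centred; their L¹ norms
therefore decay geometrically. -/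
lemma Zseq_increment (n : ℕ) : (fun x : Env L => Zseq x (n + 1) - Zseq x n) =
    branchMean^[n] fun x => Zseq x 1 - Zseq x 0 := by
  rw [iterate_branchMean_sub]
  ext x
  have h1 := congrFun (Zseq_eq_iterate (L := L) (n + 1)) x
  rw [Function.iterate_add_apply, ← Zseq_eq_iterate] at h1
  have h0 := congrFun (Zseq_eq_iterate (L := L) n) x
  rw [h1, h0]
  simp only [Zseq_zero]

lemma meanFavard_sub_le {C : ℝ} (hC0 : 0 < C)
    (hC : ∀ n : ℕ, (n : ℝ) ^ 2 * (meanFavard (weight 𝔛) n - meanFavard (weight 𝔛) (n + 1)) ≤ C)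
    {n : ℕ} (hn : 0 < n) (k : ℕ) :
    meanFavard (weight 𝔛) n - meanFavard (weight 𝔛) (n + k) ≤ k * (C / (n : ℝ) ^ 2) := by
  have hn' : (0 : ℝ) < n := by exact_mod_cast hn
  induction k with
  | zero => simp
  | succ k ih =>
    have h1 := hC (n + k)
    have h2 : (0 : ℝ) < ((n + k : ℕ) : ℝ) ^ 2 := by positivity
    rw [mul_comm, ← le_div_iff₀ h2] at h1
    have h3 : C / ((n + k : ℕ) : ℝ) ^ 2 ≤ C / (n : ℝ) ^ 2 := by
      gcongr
      omega
    push_cast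
    rw [add_one_mul, ← add_assoc]
    linarith

variable [IsProbabilityMeasure 𝔛]

lemma integral_Zseq (hL : 0 < L) (hunif : IsUniform 𝔛) (n : ℕ) :
    ∫ x, Zseq x n ∂envMeasure 𝔛 = 1 := by
  rw [Zseq_eq_iterate, integral_iterate_branchMean hL hunif (IsBoundedMeasurable.const 1)]
  simp

lemma inv_sqrt_two_lt_one : (√2)⁻¹ < 1 :=
  inv_lt_one_of_one_lt₀ (by rw [Real.lt_sqrt zero_le_one]; norm_num)

lemma summable_integral_abs_increment (hL : 2 ≤ L) (hunif : IsUniform 𝔛) :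
    Summable fun n => ∫ x, |Zseq x (n + 1) - Zseq x n| ∂envMeasure 𝔛 := by
  have hb := (isBoundedMeasurable_Zseq (L := L) 1).sub (isBoundedMeasurable_Zseq (L := L) 0)
  obtain ⟨C, hC⟩ := hb.2
  have h0 : ∫ x : Env L, (Zseq x 1 - Zseq x 0) ∂envMeasure 𝔛 = 0 := by
    rw [integral_sub ((isBoundedMeasurable_Zseq 1).integrable _)
      ((isBoundedMeasurable_Zseq 0).integrable _), integral_Zseq (by omega) hunif,
      integral_Zseq (by omega) hunif, sub_self]
  refine Summable.of_nonneg_of_le (fun n => integral_nonneg fun x => abs_nonneg _) (fun n => ?_)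
    ((summable_geometric_of_lt_one (by positivity) inv_sqrt_two_lt_one).mul_left C)
  have h := integral_abs_iterate_branchMean_le hL hunif hb h0 hC n
  rw [← Zseq_increment] at h
  exact h

lemma integrable_increment (n : ℕ) :
    Integrable (fun x : Env L => Zseq x (n + 1) - Zseq x n) (envMeasure 𝔛) :=
  ((isBoundedMeasurable_Zseq _).sub (isBoundedMeasurable_Zseq _)).integrable _

lemma ae_tendsto_Zseq (hL : 2 ≤ L) (hunif : IsUniform 𝔛) :
    ∀ᵐ x ∂envMeasure 𝔛, Tendsto (Zseq x) atTop (𝓝 (Z x)) := by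
  filter_upwards [ae_summable_abs integrable_increment (summable_integral_abs_increment hL hunif)]
    with x hx
  refine CauchySeq.tendsto_limUnder (cauchySeq_of_summable_dist (hx.congr fun n => ?_))
  rw [dist_comm, Real.dist_eq]

/-- The event of (mean) extinction. -/
def degenerateSet (L : ℕ) : Set (Env L) := {x | Tendsto (Zseq x) atTop (𝓝 0)}

lemma measurableSet_degenerateSet : MeasurableSet (degenerateSet L) :=
  measurableSet_tendsto (f := fun n (x : Env L) => Zseq x n) (𝓝 0)
    fun n => (isBoundedMeasurable_Zseq n).1

lemma mem_degenerateSet_iff (hL : 0 < L) (x : Env L) :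
    x ∈ degenerateSet L ↔ ∀ q ∈ x [], child x q ∈ degenerateSet L := by
  have hL' : (0 : ℝ) < L := by exact_mod_cast hL
  have e : ∀ n, Zseq x (n + 1) = (L : ℝ)⁻¹ * ∑ q ∈ x [], Zseq (child x q) n := fun n => Zseq_succ x n
  constructor
  · intro h q hq
    have h1 : Tendsto (fun n => (L : ℝ) * Zseq x (n + 1)) atTop (𝓝 0) := by
      simpa using ((tendsto_add_atTop_iff_nat 1).2 h).const_mul (L : ℝ)
    refine squeeze_zero (fun n => Zseq_nonneg _ n) (fun n => ?_) h1
    rw [e, mul_inv_cancel_left₀ hL'.ne']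
    exact Finset.single_le_sum (f := fun q => Zseq (child x q) n) (fun _ _ => Zseq_nonneg _ _) hq
  · intro h
    have h1 : Tendsto (fun n => Zseq x (n + 1)) atTop (𝓝 0) := by
      simp only [e]
      simpa using (tendsto_finsetSum _ fun q hq => h q hq).const_mul (L : ℝ)⁻¹
    exact (tendsto_add_atTop_iff_nat 1).1 h1

/-- The event occurs exactly if it occurs in every selected square, so its probability is a fixed
point of the generating function of the number of selected squares. -/
lemma measureReal_degenerateSet_eq (hL : 0 < L) : (envMeasure 𝔛).real (degenerateSet L) =
    ∑ A, weight 𝔛 A * (envMeasure 𝔛).real (degenerateSet L) ^ A.card := by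
  classical
  have hG := measurableSet_degenerateSet (L := L)
  have h := integral_prod_child (𝔛 := 𝔛)
    (F := fun A q y => if q ∈ A then (degenerateSet L).indicator (fun _ => (1 : ℝ)) y else 1) (C := 1)
    (fun A q => by
      split_ifs
      · exact measurable_const.indicator hG
      · exact measurable_const)
    (fun A q y => by
      split_ifs
      · by_cases hy : y ∈ degenerateSet L
        · rw [indicator_of_mem hy]; simp
        · rw [indicator_of_notMem hy]; simp
      · simp)
  have e : ∀ x : Env L, (∏ q, if q ∈ x [] then
      (degenerateSet L).indicator (fun _ => (1 : ℝ)) (child x q) else 1) =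
      (degenerateSet L).indicator (fun _ => (1 : ℝ)) x := by
    intro x
    by_cases hx : x ∈ degenerateSet L
    · rw [indicator_of_mem hx]
      refine Finset.prod_eq_one fun q _ => ?_
      split_ifs with hq
      · exact indicator_of_mem ((mem_degenerateSet_iff hL x).1 hx q hq) _
      · rfl
    · rw [indicator_of_notMem hx]
      obtain ⟨q, hq, hq'⟩ : ∃ q ∈ x [], child x q ∉ degenerateSet L := by
        by_contra! hc
        exact hx ((mem_degenerateSet_iff hL x).2 hc)
      refine Finset.prod_eq_zero (Finset.mem_univ q) ?_
      rw [if_pos hq, indicator_of_notMem hq']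
  simp only [e] at h
  have e2 : ∀ (A : Selection L) (q : Digit L), ∫ y, (if q ∈ A then
      (degenerateSet L).indicator (fun _ => (1 : ℝ)) y else 1) ∂envMeasure 𝔛 =
      if q ∈ A then (envMeasure 𝔛).real (degenerateSet L) else 1 := by
    intro A q
    split_ifs
    · rw [integral_indicator_const _ hG]; simp
    · simp
  rw [integral_indicator_const _ hG, smul_eq_mul, mul_one] at h
  refine h.trans ?_
  simp only [e2, Finset.prod_ite_mem, Finset.univ_inter, Finset.prod_const]

/-- The probability p of degeneracy cannot be 1, since the increments have mean 0 and are summable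
in L¹, so the limit has mean 1. It cannot lie strictly between 0 and 1: by survival p^|A| ≤ p for
all selections of positive weight, with strict inequality for some selection of two or more squares,
which exists because the mean number of squares is L ≥ 2. -/
lemma ae_notMem_degenerateSet (hL : 2 ≤ L) (hunif : IsUniform 𝔛) (hsurv : IsSurviving 𝔛) :
    ∀ᵐ x ∂envMeasure 𝔛, x ∉ degenerateSet L := by
  have hm := isUniformWeight_weight 𝔛 hunif
  have hL' : (2 : ℝ) ≤ L := by exact_mod_cast hL
  have hsurv' := (ae_iff_weight 𝔛).1 hsurv
  set p := (envMeasure 𝔛).real (degenerateSet L) with hp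
  have hp0 : 0 ≤ p := measureReal_nonneg
  have hp1 : p ≤ 1 := measureReal_le_one
  have heq := measureReal_degenerateSet_eq (𝔛 := 𝔛) (L := L) (by omega)
  rw [← hp] at heq
  rcases hp0.eq_or_lt with h0 | h0
  · rw [ae_iff]
    simp only [not_not]
    have h0' : (envMeasure 𝔛).real (degenerateSet L) = 0 := h0.symm
    rwa [measureReal_eq_zero_iff] at h0'
  rcases hp1.eq_or_lt with h1 | h1
  · exfalso
    have hae : ∀ᵐ x ∂envMeasure 𝔛, x ∈ degenerateSet L := by
      rw [ae_iff, ← compl_def, ← measureReal_eq_zero_iff, probReal_compl_eq_one_sub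
        measurableSet_degenerateSet, ← hp, h1, sub_self]
    have hs := hasSum_integral_of_summable_integral_norm integrable_increment
      (summable_integral_abs_increment hL hunif)
    have hz : ∀ n, ∫ x : Env L, (Zseq x (n + 1) - Zseq x n) ∂envMeasure 𝔛 = 0 := fun n => by
      rw [integral_sub ((isBoundedMeasurable_Zseq _).integrable _)
        ((isBoundedMeasurable_Zseq _).integrable _), integral_Zseq (by omega) hunif,
        integral_Zseq (by omega) hunif, sub_self]
    simp only [hz] at hs
    have h2 := hs.unique hasSum_zero
    have h3 : ∀ᵐ x ∂envMeasure 𝔛, ∑' n, (Zseq x (n + 1) - Zseq x n) = -1 := by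
      filter_upwards [hae, ae_summable_abs integrable_increment
        (summable_integral_abs_increment hL hunif)] with x hx hsx
      have h4 := hsx.of_abs.hasSum.tendsto_sum_nat
      simp only [Finset.sum_range_sub, Zseq_zero] at h4
      have h5 : Tendsto (fun n => Zseq x n - 1) atTop (𝓝 (0 - 1)) := Tendsto.sub_const hx 1
      rw [tendsto_nhds_unique h4 h5, zero_sub]
    rw [integral_congr_ae h3] at h2
    simp at h2
  · exfalso
    obtain ⟨A, hA, hA2⟩ : ∃ A, weight 𝔛 A ≠ 0 ∧ 2 ≤ A.card := by
      by_contra! hc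
      have h2 := sum_mul_sum hm fun _ => (1 : ℝ)
      simp only [Finset.sum_const, nsmul_eq_mul, mul_one, card_digit] at h2
      have h3 : ∑ A, weight 𝔛 A * (A.card : ℝ) ≤ ∑ A, weight 𝔛 A := by
        refine Finset.sum_le_sum fun A _ => ?_
        by_cases hA : weight 𝔛 A = 0
        · simp [hA]
        · have h4 : (A.card : ℝ) ≤ 1 := by
            have := hc A hA
            exact_mod_cast (by omega : A.card ≤ 1)
          nlinarith [hm.nonneg A]
      rw [h2, hm.sum_one] at h3
      have h4 : (L : ℝ)⁻¹ * L ^ 2 = L := by field_simp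
      linarith
    have hlt : ∑ A, weight 𝔛 A * p ^ A.card < ∑ A, weight 𝔛 A * p := by
      refine Finset.sum_lt_sum (fun B _ => ?_) ⟨A, Finset.mem_univ A, ?_⟩
      · by_cases hB : weight 𝔛 B = 0
        · simp [hB]
        · exact mul_le_mul_of_nonneg_left (pow_le_of_le_one hp0 hp1
            (by have := hsurv' B hB; omega)) (hm.nonneg B)
      · exact mul_lt_mul_of_pos_left (pow_lt_self_of_lt_one₀ h0 h1 (by omega))
          (lt_of_le_of_ne (hm.nonneg A) hA.symm)
    rw [← Finset.sum_mul, hm.sum_one, one_mul, ← heq] at hlt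
    exact lt_irrefl _ hlt

lemma ae_Z_pos (hL : 2 ≤ L) (hunif : IsUniform 𝔛) (hsurv : IsSurviving 𝔛) :
    ∀ᵐ x ∂envMeasure 𝔛, 0 < Z x := by
  filter_upwards [ae_tendsto_Zseq hL hunif, ae_notMem_degenerateSet hL hunif hsurv] with x h1 h2
  refine lt_of_le_of_ne (ge_of_tendsto' h1 fun n => Zseq_nonneg x n) fun h => h2 ?_
  unfold degenerateSet
  rwa [← h] at h1

lemma meanFavard_mem (hL : 0 < L) (hunif : IsUniform 𝔛) (n : ℕ) :
    meanFavard (weight 𝔛) n ∈ Icc 0 (2 * Real.pi) := by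
  rw [← integral_favard hL hunif]
  refine ⟨integral_nonneg fun x => favard_nonneg x n, ?_⟩
  refine (integral_mono ((isBoundedMeasurable_favard hL n).integrable _) (integrable_const _)
    fun x => favard_le hL x n).trans ?_
  simp

/-- The average of the Favard lengths over the squares of level k lies above the Favard length of
level n + k. The L¹ norm of an ordered difference is the difference of the means; the average itself
is concentrated near its conditional value at rate 2^(-k/2). -/
lemma integral_abs_favard_sub_le (hL : 2 ≤ L) (hunif : IsUniform 𝔛) (n k : ℕ) :
    ∫ x, |favard x (n + k) - meanFavard (weight 𝔛) n * Zseq x k| ∂envMeasure 𝔛 ≤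
      (meanFavard (weight 𝔛) n - meanFavard (weight 𝔛) (n + k)) +
        2 * Real.pi * (√2)⁻¹ ^ k := by
  have hL0 : 0 < L := by omega
  have hf := isBoundedMeasurable_favard (L := L) hL0 n
  have hfk := isBoundedMeasurable_favard (L := L) hL0 (n + k)
  have ha := meanFavard_mem (𝔛 := 𝔛) hL0 hunif n
  set a := meanFavard (weight 𝔛) n with hadef
  have hg := hf.sub (IsBoundedMeasurable.const a)
  have h0 : ∫ x, (favard x n - a) ∂envMeasure 𝔛 = 0 := by
    rw [integral_sub (hf.integrable _) (integrable_const _), integral_favard hL0 hunif]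
    simp [hadef]
  have hgC : ∀ x : Env L, |favard x n - a| ≤ 2 * Real.pi := fun x => by
    have h1 := favard_nonneg x n
    have h2 := favard_le hL0 x n
    rw [abs_le]
    constructor <;> linarith [ha.1, ha.2]
  have hconc := integral_abs_iterate_branchMean_le hL hunif hg h0 hgC k
  rw [iterate_branchMean_sub, iterate_branchMean_const] at hconc
  have hA := hf.iterate_branchMean k
  have hAi : ∫ x, branchMean^[k] (fun y => favard y n) x ∂envMeasure 𝔛 = a := by
    rw [integral_iterate_branchMean hL0 hunif hf, integral_favard hL0 hunif]
  have hd := hA.sub hfk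
  have hz := hA.sub ((IsBoundedMeasurable.const a).mul (isBoundedMeasurable_Zseq (L := L) k))
  have habs : Integrable (fun x : Env L => |branchMean^[k] (fun y => favard y n) x - a * Zseq x k|)
      (envMeasure 𝔛) := (hz.integrable _).abs
  calc _ ≤ ∫ x, ((branchMean^[k] (fun y => favard y n) x - favard x (n + k)) +
        |branchMean^[k] (fun y => favard y n) x - a * Zseq x k|) ∂envMeasure 𝔛 := by
        refine integral_mono ((hfk.sub ((IsBoundedMeasurable.const a).mul
          (isBoundedMeasurable_Zseq k))).integrable _).abs ((hd.integrable _).add habs) fun x => ?_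
        have h1 := favard_add_le hL0 n k x
        have h2 := abs_sub_abs_le_abs_sub (favard x (n + k) - a * Zseq x k)
          (branchMean^[k] (fun y => favard y n) x - a * Zseq x k)
        rw [sub_sub_sub_cancel_right, abs_sub_comm (favard x (n + k))
          (branchMean^[k] (fun y => favard y n) x), abs_of_nonneg
          (show 0 ≤ branchMean^[k] (fun y => favard y n) x - favard x (n + k) by linarith)] at h2
        simp only
        linarith
    _ = (a - meanFavard (weight 𝔛) (n + k)) +
        ∫ x, |branchMean^[k] (fun y => favard y n) x - a * Zseq x k| ∂envMeasure 𝔛 := by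
        rw [integral_add (hd.integrable _) habs, integral_sub (hA.integrable _) (hfk.integrable _),
          hAi, integral_favard hL0 hunif]
    _ ≤ _ := add_le_add le_rfl hconc

/-- At level k³ + k the loss of mean Favard length over k generations is at most k C / k⁶.
Multiplied by k³ it is summable, as is the exponentially small fluctuation, so the errors tend to 0
almost surely. -/
theorem ae_tendsto_mul_favard (hL : 2 ≤ L) (hunif : IsUniform 𝔛) (hnondeg : IsNondegenerate 𝔛) :
    ∀ᵐ x ∂envMeasure 𝔛, Tendsto (fun n : ℕ => n * favard x n) atTop
      (𝓝 (Z x * ∫ θ in (0 : ℝ)..Real.pi, 2 / V 𝔛 θ)) := by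
  have hL0 : 0 < L := by omega
  obtain ⟨C, hC0, hC⟩ := meanFavard_sub_succ_le hL 𝔛 hunif hnondeg
  set a := meanFavard (weight 𝔛) with ha
  let X : ℕ → Env L → ℝ := fun k x =>
    (k : ℝ) ^ 3 * (favard x (k ^ 3 + k) - a (k ^ 3) * Zseq x k)
  have hXi : ∀ k, Integrable (X k) (envMeasure 𝔛) := fun k =>
    (((isBoundedMeasurable_favard hL0 (k ^ 3 + k)).integrable _).sub
      (((isBoundedMeasurable_Zseq k).integrable _).const_mul (a (k ^ 3)))).const_mul _
  have hXs : Summable fun k => ∫ x, |X k x| ∂envMeasure 𝔛 := by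
    have hs1 : Summable fun k : ℕ => C * (1 / (k : ℝ) ^ 2) :=
      (Real.summable_one_div_nat_pow.2 one_lt_two).mul_left C
    have hnorm : ‖(√2)⁻¹‖ < 1 := by
      rw [Real.norm_of_nonneg (by positivity)]; exact inv_sqrt_two_lt_one
    have hs2 : Summable fun k : ℕ => 2 * Real.pi * ((k : ℝ) ^ 3 * (√2)⁻¹ ^ k) :=
      (summable_pow_mul_geometric_of_norm_lt_one 3 hnorm).mul_left (2 * Real.pi)
    refine Summable.of_nonneg_of_le (fun k => integral_nonneg fun x => abs_nonneg _) (fun k => ?_)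
      (hs1.add hs2)
    simp only [X, abs_mul, abs_of_nonneg (show (0 : ℝ) ≤ (k : ℝ) ^ 3 by positivity)]
    rw [integral_const_mul]
    rcases Nat.eq_zero_or_pos k with rfl | hk
    · simp
    have hk' : (0 : ℝ) < k := by exact_mod_cast hk
    have h1 := integral_abs_favard_sub_le hL hunif (k ^ 3) k
    have h2 := meanFavard_sub_le hC0 hC (pow_pos hk 3) k
    calc _ ≤ (k : ℝ) ^ 3 * (k * (C / ((k ^ 3 : ℕ) : ℝ) ^ 2) + 2 * Real.pi * (√2)⁻¹ ^ k) := by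
          gcongr
          linarith
      _ = _ := by
          push_cast
          field_simp
  filter_upwards [ae_summable_abs hXi hXs, ae_tendsto_Zseq hL hunif] with x hx hZ
  refine tendsto_mul_of_cube (favard_antitone hL0 x) (favard_nonneg x) ?_
  have h1 : Tendsto (fun k => X k x) atTop (𝓝 0) := hx.of_abs.tendsto_atTop_zero
  have hcube : Tendsto (fun k : ℕ => k ^ 3) atTop atTop := tendsto_pow_atTop (by norm_num)
  have h2 := ((tendsto_mul_meanFavard hL 𝔛 hunif hnondeg).comp hcube)
  have h3 := h1.add (hZ.mul h2)
  rw [zero_add] at h3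
  refine h3.congr fun k => ?_
  simp only [X, Function.comp_apply, ← ha]
  push_cast
  ring

end AlmostSure

end

end GridFractal

open MeasureTheory ProbabilityTheory Filter Topology Set

namespace GridFractal

noncomputable section

/-! ### Neighbourhoods of the limit set -/

section Thickening

variable {L : ℕ} {θ : ℝ}

lemma abs_proj_sub_le (θ : ℝ) (p y : Plane) : |proj θ p - proj θ y| ≤ dist p y := by
  rw [EuclideanSpace.dist_eq, Fin.sum_univ_two, Real.dist_eq, Real.dist_eq, sq_abs, sq_abs]
  refine Real.abs_le_sqrt ?_
  have h := Real.sin_sq_add_cos_sq θ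
  set a := p 0 - y 0
  set b := p 1 - y 1
  have h1 : proj θ p - proj θ y = -Real.sin θ * a + Real.cos θ * b := by
    simp only [proj, a, b]; ring
  rw [h1]
  have h2 : (-Real.sin θ * a + Real.cos θ * b) ^ 2 + (Real.cos θ * a + Real.sin θ * b) ^ 2 =
      a ^ 2 + b ^ 2 := by linear_combination (a ^ 2 + b ^ 2) * h
  nlinarith [sq_nonneg (Real.cos θ * a + Real.sin θ * b)]

lemma dist_le_two_mul {p y : Plane} {d : ℝ} (hd : 0 ≤ d) (h0 : |p 0 - y 0| ≤ d)
    (h1 : |p 1 - y 1| ≤ d) : dist p y ≤ 2 * d := by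
  rw [EuclideanSpace.dist_eq, Fin.sum_univ_two, Real.dist_eq, Real.dist_eq]
  refine Real.sqrt_le_iff.2 ⟨by positivity, ?_⟩
  nlinarith [abs_nonneg (p 0 - y 0), abs_nonneg (p 1 - y 1)]

lemma isClosed_square (w : List (Digit L)) : IsClosed (square w) :=
  (isClosed_Icc.preimage (PiLp.continuous_apply 2 (fun _ : Fin 2 => ℝ) 0)).inter
    (isClosed_Icc.preimage (PiLp.continuous_apply 2 (fun _ : Fin 2 => ℝ) 1))

lemma isClosed_approx (x : Env L) (n : ℕ) : IsClosed (approx x n) :=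
  isClosed_biUnion_finset fun w _ => isClosed_square w

lemma isCompact_approx_zero (x : Env L) : IsCompact (approx x 0) := by
  refine Metric.isCompact_of_isClosed_isBounded (isClosed_approx x 0)
    (Metric.isBounded_closedBall (x := (0 : Plane)) (r := 2) |>.subset fun p hp => ?_)
  rw [approx_zero, mem_square_nil] at hp
  rw [Metric.mem_closedBall]
  refine (dist_le_two_mul zero_le_one ?_ ?_).trans (by norm_num)
  · rw [PiLp.zero_apply, sub_zero, abs_of_nonneg hp.1.1]; exact hp.1.2
  · rw [PiLp.zero_apply, sub_zero, abs_of_nonneg hp.2.1]; exact hp.2.2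

lemma approx_nonempty (hL : 0 < L) {x : Env L} (hx : ∀ w, (x w).Nonempty) (n : ℕ) :
    (approx x n).Nonempty := by
  induction n generalizing x with
  | zero =>
    rw [approx_zero]
    exact ⟨0, mem_square_nil.2 ⟨by simp, by simp⟩⟩
  | succ n ih =>
    obtain ⟨q, hq⟩ := hx []
    obtain ⟨p', hp'⟩ := ih (x := child x q) fun w => hx (q :: w)
    obtain ⟨p, rfl⟩ := rescale_surjective hL q p'
    exact ⟨p, (mem_approx_succ hL).2 ⟨q, hq, hp'⟩⟩

lemma limitSet_nonempty (hL : 0 < L) {x : Env L} (hx : ∀ w, (x w).Nonempty) :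
    (limitSet x).Nonempty :=
  IsCompact.nonempty_iInter_of_sequence_nonempty_isCompact_isClosed _ (approx_succ_subset hL x)
    (approx_nonempty hL hx) (isCompact_approx_zero x) (isClosed_approx x)

/-- No selection is empty, so each surviving square contains a point of the limit set. -/
lemma exists_mem_limitSet_near (hL : 0 < L) {x : Env L} (hx : ∀ w, (x w).Nonempty) {n : ℕ}
    {p : Plane} (hp : p ∈ approx x n) : ∃ y ∈ limitSet x,
      |p 0 - y 0| ≤ ((L : ℝ) ^ n)⁻¹ ∧ |p 1 - y 1| ≤ ((L : ℝ) ^ n)⁻¹ := by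
  have hL' : (0 : ℝ) < L := by exact_mod_cast hL
  induction n generalizing x p with
  | zero =>
    obtain ⟨y, hy⟩ := limitSet_nonempty hL hx
    refine ⟨y, hy, ?_⟩
    have hy0 : y ∈ approx x 0 := mem_iInter.1 hy 0
    rw [approx_zero, mem_square_nil] at hp hy0
    rw [pow_zero, inv_one, abs_le, abs_le]
    refine ⟨⟨?_, ?_⟩, ?_, ?_⟩ <;> linarith [hp.1.1, hp.1.2, hp.2.1, hp.2.2, hy0.1.1, hy0.1.2,
      hy0.2.1, hy0.2.2]
  | succ n ih =>
    obtain ⟨q, hq, h⟩ := (mem_approx_succ hL).1 hp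
    obtain ⟨y', hy', h0, h1⟩ := ih (fun w => hx (q :: w)) h
    obtain ⟨y, rfl⟩ := rescale_surjective hL q y'
    have hsucc : ∀ k, y ∈ approx x (k + 1) := fun k =>
      (mem_approx_succ hL).2 ⟨q, hq, mem_iInter.1 hy' k⟩
    have key : ∀ a b c : ℝ, |L * a - c - (L * b - c)| ≤ ((L : ℝ) ^ n)⁻¹ →
        |a - b| ≤ ((L : ℝ) ^ (n + 1))⁻¹ := by
      intro a b c h
      rw [sub_sub_sub_cancel_right, ← mul_sub, abs_mul, abs_of_pos hL'] at h
      rw [pow_succ, mul_inv, ← div_eq_mul_inv, le_div_iff₀ hL']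
      linarith
    refine ⟨y, mem_iInter.2 fun k => approx_succ_subset hL x k (hsucc k), key _ _ _ h0, key _ _ _ h1⟩

lemma approx_subset_thickening (hL : 0 < L) {x : Env L} (hx : ∀ w, (x w).Nonempty) {n : ℕ} {r : ℝ}
    (hr : 2 * ((L : ℝ) ^ n)⁻¹ < r) : approx x n ⊆ Metric.thickening r (limitSet x) := by
  intro p hp
  obtain ⟨y, hy, h0, h1⟩ := exists_mem_limitSet_near hL hx hp
  exact Metric.mem_thickening_iff.2 ⟨y, hy, (dist_le_two_mul (by positivity) h0 h1).trans_lt hr⟩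

lemma image_proj_square (hL : 0 < L) (θ : ℝ) (w : List (Digit L)) : ∃ a b : ℝ,
    proj θ '' square w = Icc a b := by
  have hL' : (0 : ℝ) < L := by exact_mod_cast hL
  set d := ((L : ℝ) ^ w.length)⁻¹ with hd
  have hd0 : 0 < d := by positivity
  refine ⟨projXY θ (corner w).1 (corner w).2 + d * projLo θ,
    projXY θ (corner w).1 (corner w).2 + d * projHi θ, ?_⟩
  have e : ∀ u v a b : ℝ, projXY θ (u + d * a) (v + d * b) = projXY θ u v + d * projXY θ a b := by
    intro u v a b; unfold projXY; ring
  have key : ∀ c y : ℝ, y ∈ Icc c (c + d) → (y - c) / d ∈ Icc (0 : ℝ) 1 := by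
    intro c y hy
    exact ⟨div_nonneg (by linarith [hy.1]) hd0.le, (div_le_one hd0).2 (by linarith [hy.2])⟩
  ext t
  constructor
  · rintro ⟨p, ⟨h0, h1⟩, rfl⟩
    have h := projXY_mem (θ := θ) (key _ _ h0) (key _ _ h1)
    have h2 := e (corner w).1 (corner w).2 ((p 0 - (corner w).1) / d) ((p 1 - (corner w).2) / d)
    rw [mul_div_cancel₀ _ hd0.ne', mul_div_cancel₀ _ hd0.ne', add_sub_cancel, add_sub_cancel] at h2
    change projXY θ (p 0) (p 1) ∈ _
    rw [h2]
    exact ⟨by nlinarith [h.1], by nlinarith [h.2]⟩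
  · intro ht
    obtain ⟨a, ha, b, hb, hab⟩ := exists_projXY_eq (θ := θ)
      (t := (t - projXY θ (corner w).1 (corner w).2) / d)
      ⟨by rw [le_div_iff₀ hd0]; linarith [ht.1], by rw [div_le_iff₀ hd0]; linarith [ht.2]⟩
    refine ⟨!₂[(corner w).1 + d * a, (corner w).2 + d * b], ⟨?_, ?_⟩, ?_⟩
    · change (corner w).1 + d * a ∈ Icc _ _
      exact ⟨by nlinarith [ha.1], by nlinarith [ha.2]⟩
    · change (corner w).2 + d * b ∈ Icc _ _
      exact ⟨by nlinarith [hb.1], by nlinarith [hb.2]⟩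
    · change projXY θ ((corner w).1 + d * a) ((corner w).2 + d * b) = t
      rw [e, hab, mul_div_cancel₀ _ hd0.ne', add_sub_cancel]

/-- Each square projects to an interval, and the neighbourhood can leave that interval by less than
r at either end. -/
lemma volume_image_proj_thickening_le (hL : 0 < L) (x : Env L) (n : ℕ) (r θ : ℝ) :
    volume (proj θ '' Metric.thickening r (limitSet x)) ≤
      volume (proj θ '' approx x n) + (level x n).card * (2 * ENNReal.ofReal r) := by
  choose a b hab using fun w : List (Digit L) => image_proj_square hL θ w
  have hsub : proj θ '' Metric.thickening r (limitSet x) ⊆ proj θ '' approx x n ∪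
      ⋃ w ∈ level x n, (Ioo (a w - r) (a w) ∪ Ioo (b w) (b w + r)) := by
    rintro _ ⟨p, hp, rfl⟩
    obtain ⟨y, hy, hpy⟩ := Metric.mem_thickening_iff.1 hp
    have hyn : y ∈ approx x n := mem_iInter.1 hy n
    simp only [approx, mem_iUnion, exists_prop] at hyn
    obtain ⟨w, hw, hyw⟩ := hyn
    have hlt := (abs_le.1 ((abs_proj_sub_le θ p y).trans hpy.le))
    have hlt' := (abs_lt.1 ((abs_proj_sub_le θ p y).trans_lt hpy))
    have hym : proj θ y ∈ Icc (a w) (b w) := by rw [← hab]; exact mem_image_of_mem _ hyw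
    by_cases h1 : proj θ p < a w
    · exact Or.inr (mem_biUnion hw (Or.inl ⟨by linarith [hym.1], h1⟩))
    by_cases h2 : b w < proj θ p
    · exact Or.inr (mem_biUnion hw (Or.inr ⟨h2, by linarith [hym.2]⟩))
    · left
      have h3 : proj θ p ∈ proj θ '' square w := by
        rw [hab]; exact ⟨not_lt.1 h1, not_lt.1 h2⟩
      exact image_mono (subset_biUnion_of_mem (u := fun w => square w) hw) h3
  refine (measure_mono hsub).trans ((measure_union_le _ _).trans (add_le_add le_rfl ?_))
  refine (measure_biUnion_finset_le _ _).trans ?_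
  rw [← nsmul_eq_mul]
  refine Finset.sum_le_card_nsmul _ _ _ fun w _ => (measure_union_le _ _).trans (le_of_eq ?_)
  rw [Real.volume_Ioo, Real.volume_Ioo, sub_sub_cancel, add_sub_cancel_left, two_mul]

lemma volume_image_proj_approx (hL : 0 < L) (x : Env L) (n : ℕ) (θ : ℝ) :
    volume (proj θ '' approx x n) = ENNReal.ofReal (imageLength x n θ) := by
  have hmeas : MeasurableSet (proj θ '' approx x n) := by
    have h := measurable_hit_right hL x n θ (measurableSet_singleton 1)
    convert h using 1
    ext t
    by_cases ht : t ∈ proj θ '' approx x n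
    · simp [ht, hit]
    · simp [ht, hit]
  have hfin : volume (proj θ '' approx x n) ≠ ⊤ := by
    refine ne_top_of_le_ne_top ?_ (measure_mono (image_mono (approx_antitone hL x (Nat.zero_le n))))
    rw [approx_zero, image_proj_square_nil, Real.volume_Icc]
    exact ENNReal.ofReal_ne_top
  have h : imageLength x n θ = volume.real (proj θ '' approx x n) := by
    unfold imageLength hit
    rw [integral_indicator_const _ hmeas, smul_eq_mul, mul_one]
  rw [h, ofReal_measureReal hfin]

lemma lintegral_imageLength (hL : 0 < L) (x : Env L) (n : ℕ) :
    ∫⁻ θ in Icc (0 : ℝ) Real.pi, ENNReal.ofReal (imageLength x n θ) =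
      ENNReal.ofReal (favard x n) := by
  have hi := intervalIntegrable_imageLength hL x n
  rw [intervalIntegrable_iff_integrableOn_Icc_of_le Real.pi_pos.le] at hi
  rw [favard, intervalIntegral.integral_of_le Real.pi_pos.le, ← integral_Icc_eq_integral_Ioc,
    ofReal_integral_eq_lintegral_ofReal hi (Eventually.of_forall fun θ => imageLength_nonneg x n θ)]

lemma ofReal_favard_le (hL : 0 < L) {x : Env L} (hx : ∀ w, (x w).Nonempty) {n : ℕ} {r : ℝ}
    (hr : 2 * ((L : ℝ) ^ n)⁻¹ < r) :
    ENNReal.ofReal (favard x n) ≤ favardLength (Metric.thickening r (limitSet x)) := by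
  rw [← lintegral_imageLength hL, favardLength]
  refine lintegral_mono fun θ => ?_
  rw [← volume_image_proj_approx hL]
  exact measure_mono (image_mono (approx_subset_thickening hL hx hr))

lemma favardLength_thickening_le (hL : 0 < L) (x : Env L) (n : ℕ) {r : ℝ} (hr : 0 ≤ r) :
    favardLength (Metric.thickening r (limitSet x)) ≤
      ENNReal.ofReal (favard x n + 2 * Real.pi * r * (level x n).card) := by
  have h1 : ∀ θ, volume (proj θ '' Metric.thickening r (limitSet x)) ≤
      ENNReal.ofReal (imageLength x n θ) + (level x n).card * (2 * ENNReal.ofReal r) := fun θ => by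
    rw [← volume_image_proj_approx hL]
    exact volume_image_proj_thickening_le hL x n r θ
  refine (lintegral_mono h1).trans (le_of_eq ?_)
  rw [lintegral_add_right _ measurable_const, lintegral_imageLength hL, lintegral_const,
    Measure.restrict_apply_univ, Real.volume_Icc, sub_zero,
    ENNReal.ofReal_add (favard_nonneg x n) (by positivity)]
  congr 1
  rw [ENNReal.ofReal_mul (by positivity), ENNReal.ofReal_mul (by positivity),
    ENNReal.ofReal_mul (by positivity), ENNReal.ofReal_natCast, ENNReal.ofReal_ofNat]
  ring

lemma favardLength_thickening_ne_top (hL : 0 < L) (x : Env L) (r : ℝ) :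
    favardLength (Metric.thickening r (limitSet x)) ≠ ⊤ := by
  rcases le_total 0 r with hr | hr
  · exact ne_top_of_le_ne_top ENNReal.ofReal_ne_top (favardLength_thickening_le hL x 0 hr)
  · rw [Metric.thickening_of_nonpos hr]
    simp [favardLength]

end Thickening

/-! ### From the levels to the neighbourhoods -/

section Limit

variable {L : ℕ}

lemma tendsto_mul_comp_of_div {f : ℕ → ℝ} {z : ℝ} (hf : Tendsto (fun n : ℕ => n * f n) atTop (𝓝 z))
    {k : ℝ → ℕ} (hk : Tendsto (fun t : ℝ => (k t : ℝ) / t) atTop (𝓝 1)) :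
    Tendsto k atTop atTop ∧ Tendsto (fun t : ℝ => t * f (k t)) atTop (𝓝 z) := by
  have hk' : Tendsto k atTop atTop := by
    rw [← tendsto_natCast_atTop_iff (R := ℝ)]
    refine (hk.pos_mul_atTop one_pos tendsto_id).congr' ?_
    filter_upwards [eventually_gt_atTop 0] with t ht
    exact div_mul_cancel₀ _ ht.ne'
  refine ⟨hk', ?_⟩
  have h := (hk.inv₀ one_ne_zero).mul (hf.comp hk')
  rw [inv_one, one_mul] at h
  refine h.congr' ?_
  filter_upwards [hk'.eventually_gt_atTop 0] with t ht
  have : (k t : ℝ) ≠ 0 := by exact_mod_cast ht.ne'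
  simp only [Function.comp_apply]
  rw [inv_div]
  field_simp

lemma tendsto_floor_add_three_div :
    Tendsto (fun t : ℝ => ((⌊t⌋₊ + 3 : ℕ) : ℝ) / t) atTop (𝓝 1) := by
  have h := (tendsto_nat_floor_div_atTop (R := ℝ)).add
    ((tendsto_const_nhds (x := (3 : ℝ))).div_atTop tendsto_id)
  rw [add_zero] at h
  refine h.congr fun t => ?_
  push_cast
  rw [add_div]; rfl

/-- With t = log_L(1/r), the level ⌊t - √t⌋ is asymptotic to t, yet r Lⁿ ≤ L^(-√t). The boundary
term, of order t r |𝒮_n|, then vanishes in the limit. -/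
lemma tendsto_floor_sub_sqrt_div :
    Tendsto (fun t : ℝ => ((⌊t - √t⌋₊ : ℕ) : ℝ) / t) atTop (𝓝 1) := by
  have h1 : Tendsto (fun t : ℝ => 1 - (√t)⁻¹) atTop (𝓝 1) := by
    simpa using (tendsto_inv_atTop_zero.comp Real.tendsto_sqrt_atTop).const_sub 1
  have h2 : ∀ᶠ t : ℝ in atTop, (1 - (√t)⁻¹) * t = t - √t := by
    filter_upwards [eventually_gt_atTop 0] with t ht
    have hs : 0 < √t := Real.sqrt_pos.2 ht
    have : (√t)⁻¹ * t = √t := by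
      rw [inv_mul_eq_iff_eq_mul₀ hs.ne', Real.mul_self_sqrt ht.le]
    rw [sub_mul, this, one_mul]
  have h3 : Tendsto (fun t : ℝ => t - √t) atTop atTop :=
    (h1.pos_mul_atTop one_pos tendsto_id).congr' h2
  have h4 := ((tendsto_nat_floor_div_atTop (R := ℝ)).comp h3).mul h1
  rw [one_mul] at h4
  refine h4.congr' ?_
  filter_upwards [h2, eventually_gt_atTop 0, h3.eventually_gt_atTop 0] with t ht ht0 ht1
  simp only [Function.comp_apply]
  have h5 : 1 - (√t)⁻¹ = (t - √t) / t := by rw [eq_div_iff ht0.ne', ht]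
  rw [h5]
  field_simp

lemma tendsto_mul_rpow_neg_sqrt (hL : 2 ≤ L) :
    Tendsto (fun t : ℝ => t * (L : ℝ) ^ (-√t)) atTop (𝓝 0) := by
  have hL' : (1 : ℝ) < L := by exact_mod_cast (by omega : 1 < L)
  have hlog : 0 < Real.log L := Real.log_pos hL'
  have h := ((Real.tendsto_pow_mul_exp_neg_atTop_nhds_zero 2).comp
    (Real.tendsto_sqrt_atTop.const_mul_atTop hlog)).const_mul ((Real.log L ^ 2)⁻¹)
  rw [mul_zero] at h
  refine h.congr' ?_
  filter_upwards [eventually_ge_atTop 0] with t ht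
  simp only [Function.comp_apply]
  rw [Real.rpow_def_of_pos (by linarith), mul_pow, Real.sq_sqrt ht, mul_neg]
  field_simp

/-- The Favard length of the neighbourhoods is governed by the Favard length of the
approximations. -/
theorem tendsto_logb_mul_favardLength (hL : 2 ≤ L) {x : Env L} (hx : ∀ w, (x w).Nonempty) {ζ z : ℝ}
    (hZ : Tendsto (Zseq x) atTop (𝓝 ζ)) (hf : Tendsto (fun n : ℕ => n * favard x n) atTop (𝓝 z)) :
    Tendsto (fun r : ℝ => Real.logb L (1 / r) *
      (favardLength (Metric.thickening r (limitSet x))).toReal) (𝓝[>] 0) (𝓝 z) := by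
  have hL0 : 0 < L := by omega
  have hL2 : (2 : ℝ) ≤ L := by exact_mod_cast hL
  have hL1 : (1 : ℝ) < L := by linarith
  have hLp : (0 : ℝ) < L := by linarith
  have hN : Tendsto (fun r : ℝ => Real.logb L (1 / r)) (𝓝[>] 0) atTop := by
    simp only [one_div]
    exact (Real.tendsto_logb_atTop hL1).comp tendsto_inv_nhdsGT_zero
  have hlow := (tendsto_mul_comp_of_div hf tendsto_floor_add_three_div).2.comp hN
  obtain ⟨hk, hup1⟩ := tendsto_mul_comp_of_div hf tendsto_floor_sub_sqrt_div
  have hup2 := ((tendsto_mul_rpow_neg_sqrt hL).mul (hZ.comp hk)).const_mul (2 * Real.pi)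
  rw [zero_mul, mul_zero] at hup2
  have hup := (hup1.add hup2).comp hN
  rw [add_zero] at hup
  have hpos : ∀ᶠ r : ℝ in 𝓝[>] 0, 0 < r := eventually_mem_nhdsWithin
  refine tendsto_of_tendsto_of_tendsto_of_le_of_le' hlow hup ?_ ?_
  · filter_upwards [hpos, hN.eventually_ge_atTop 0] with r hr ht
    simp only [Function.comp_apply]
    set t := Real.logb L (1 / r) with htdef
    have hrt : (L : ℝ) ^ t = 1 / r := Real.rpow_logb hLp hL1.ne' (by positivity)
    refine mul_le_mul_of_nonneg_left ?_ ht
    -- Since ⌊t⌋ + 3 ≥ t + 2 and L² ≥ 4, twice the side length is at most r / 2.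
    have h1 : 2 * ((L : ℝ) ^ (⌊t⌋₊ + 3))⁻¹ < r := by
      have h2 : (1 / r) * 4 ≤ (L : ℝ) ^ (⌊t⌋₊ + 3) := by
        calc (1 / r) * 4 ≤ (L : ℝ) ^ t * (L : ℝ) ^ 2 := by
              rw [hrt]; gcongr; nlinarith
          _ = (L : ℝ) ^ (t + 2) := by rw [Real.rpow_add hLp]; norm_num
          _ ≤ (L : ℝ) ^ ((⌊t⌋₊ + 3 : ℕ) : ℝ) := by
              refine Real.rpow_le_rpow_of_exponent_le hL1.le ?_
              push_cast
              linarith [Nat.lt_floor_add_one t]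
          _ = _ := Real.rpow_natCast _ _
      have h3 : ((L : ℝ) ^ (⌊t⌋₊ + 3))⁻¹ ≤ ((1 / r) * 4)⁻¹ := inv_anti₀ (by positivity) h2
      have h4 : ((1 / r) * 4)⁻¹ = r / 4 := by field_simp
      linarith
    have h2 := ofReal_favard_le hL0 hx h1
    rwa [ENNReal.ofReal_le_iff_le_toReal (favardLength_thickening_ne_top hL0 x r)] at h2
  · filter_upwards [hpos, hN.eventually_ge_atTop 1] with r hr ht1
    simp only [Function.comp_apply]
    set t := Real.logb L (1 / r) with htdef
    have hrt : (L : ℝ) ^ t = 1 / r := Real.rpow_logb hLp hL1.ne' (by positivity)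
    have ht : 0 ≤ t := by linarith
    set n := ⌊t - √t⌋₊ with hn
    have hst : √t ≤ t := by
      rw [Real.sqrt_le_left ht]; nlinarith
    have hnt : (n : ℝ) ≤ t - √t := Nat.floor_le (by linarith)
    have h1 := ENNReal.toReal_mono ENNReal.ofReal_ne_top
      (favardLength_thickening_le hL0 x n hr.le)
    have hf0 := favard_nonneg x n
    rw [ENNReal.toReal_ofReal (by positivity)] at h1
    have h2 : ((level x n).card : ℝ) = (L : ℝ) ^ n * Zseq x n := by
      rw [Zseq, mul_inv_cancel_left₀ (by positivity)]
    have h3 : r * (L : ℝ) ^ n ≤ (L : ℝ) ^ (-√t) := by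
      have hr' : r = (L : ℝ) ^ (-t) := by rw [Real.rpow_neg hLp.le, hrt]; field_simp
      rw [hr', ← Real.rpow_natCast, ← Real.rpow_add hLp]
      exact Real.rpow_le_rpow_of_exponent_le hL1.le (by linarith)
    have h4 : r * ((level x n).card : ℝ) ≤ (L : ℝ) ^ (-√t) * Zseq x n := by
      rw [h2, ← mul_assoc]
      exact mul_le_mul_of_nonneg_right h3 (Zseq_nonneg x n)
    calc _ ≤ t * (favard x n + 2 * Real.pi * r * (level x n).card) :=
          mul_le_mul_of_nonneg_left h1 ht
      _ = t * favard x n + t * (2 * Real.pi) * (r * (level x n).card) := by ring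
      _ ≤ t * favard x n + t * (2 * Real.pi) * ((L : ℝ) ^ (-√t) * Zseq x n) := by
          gcongr
      _ = _ := by ring

end Limit

/-! ### Passage to arbitrary independent families of selections -/

section Environment

variable {L : ℕ} {𝔛 : Measure (Selection L)}

lemma ae_forall_nonempty [IsProbabilityMeasure 𝔛] (hsurv : IsSurviving 𝔛) :
    ∀ᵐ x ∂envMeasure 𝔛, ∀ w, (x w).Nonempty := by
  refine ae_all_iff.2 fun w => ?_
  have h : Measure.map (fun x : Env L => x w) (envMeasure 𝔛) = 𝔛 :=
    Measure.infinitePi_map_eval (fun _ : List (Digit L) => 𝔛) w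
  refine ae_of_ae_map (f := fun x : Env L => x w) (p := fun A : Selection L => A.Nonempty)
    (measurable_pi_apply w).aemeasurable ?_
  rw [h]
  filter_upwards [hsurv] with A hA
  exact Finset.card_pos.1 hA

/-- Independence with common law means that the joint law of the family is the product measure, so
almost sure statements transfer. -/
lemma ae_comp_of_ae_envMeasure {Ω : Type*} [MeasurableSpace Ω] {P : Measure Ω}
    [IsProbabilityMeasure P] {X : List (Digit L) → Ω → Selection L}
    (hlaw : ∀ w, HasLaw (X w) 𝔛 P) (hindep : iIndepFun X P) {p : Env L → Prop}
    (hp : ∀ᵐ x ∂envMeasure 𝔛, p x) : ∀ᵐ ω ∂P, p fun w => X w ω := by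
  have h := (iIndepFun_iff_map_fun_eq_infinitePi_map₀' fun w => (hlaw w).aemeasurable).1 hindep
  simp only [(hlaw _).map_eq] at h
  refine ae_of_ae_map (aemeasurable_pi_iff.2 fun w => (hlaw w).aemeasurable) ?_
  rw [h]
  exact hp

end Environment

end

end GridFractal

theorem corollary5p2 (L : ℕ) (hL : 2 ≤ L)
    (𝔛 : Measure (GridFractal.Selection L)) [IsProbabilityMeasure 𝔛]
    (hunif : GridFractal.IsUniform 𝔛)
    (hnondeg : GridFractal.IsNondegenerate 𝔛)
    (hsurv : GridFractal.IsSurviving 𝔛)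
    {Ω : Type*} [MeasurableSpace Ω] (P : Measure Ω) [IsProbabilityMeasure P]
    (X : List (GridFractal.Digit L) → Ω → GridFractal.Selection L)
    (hlaw : ∀ w, HasLaw (X w) 𝔛 P)
    (hindep : iIndepFun X P) :
    (∀ θ : ℝ, 0 < GridFractal.V 𝔛 θ) ∧
    IntervalIntegrable (fun θ : ℝ => 2 / GridFractal.V 𝔛 θ) volume 0 Real.pi ∧
    ∀ᵐ ω ∂P,
      Tendsto (GridFractal.Zseq fun w => X w ω) atTop (𝓝 (GridFractal.Z fun w => X w ω)) ∧
      0 < GridFractal.Z (fun w => X w ω) ∧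
      (∀ r : ℝ, GridFractal.favardLength
        (Metric.thickening r (GridFractal.limitSet fun w => X w ω)) ≠ ⊤) ∧
      Tendsto
        (fun r : ℝ => Real.logb L (1 / r) *
          (GridFractal.favardLength
            (Metric.thickening r (GridFractal.limitSet fun w => X w ω))).toReal)
        (𝓝[>] 0)
        (𝓝 (GridFractal.Z (fun w => X w ω) * ∫ θ in (0 : ℝ)..Real.pi, 2 / GridFractal.V 𝔛 θ)) := by
  have hL0 : 0 < L := by omega
  refine ⟨GridFractal.V_pos hL 𝔛 hunif hnondeg,
    GridFractal.intervalIntegrable_two_div_V hL 𝔛 hunif hnondeg, ?_⟩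
  refine GridFractal.ae_comp_of_ae_envMeasure hlaw hindep (p := fun x =>
    Tendsto (GridFractal.Zseq x) atTop (𝓝 (GridFractal.Z x)) ∧ 0 < GridFractal.Z x ∧
      (∀ r : ℝ, GridFractal.favardLength (Metric.thickening r (GridFractal.limitSet x)) ≠ ⊤) ∧
      Tendsto (fun r : ℝ => Real.logb L (1 / r) *
        (GridFractal.favardLength (Metric.thickening r (GridFractal.limitSet x))).toReal)
        (𝓝[>] 0) (𝓝 (GridFractal.Z x * ∫ θ in (0 : ℝ)..Real.pi, 2 / GridFractal.V 𝔛 θ))) ?_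
  filter_upwards [GridFractal.ae_tendsto_Zseq hL hunif, GridFractal.ae_Z_pos hL hunif hsurv,
    GridFractal.ae_forall_nonempty hsurv,
    GridFractal.ae_tendsto_mul_favard hL hunif hnondeg] with x h1 h2 h3 h4
  exact ⟨h1, h2, GridFractal.favardLength_thickening_ne_top hL0 x,
    GridFractal.tendsto_logb_mul_favardLength hL h3 h1 h4⟩
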